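/- Let $\mathcal H$ be a real separable Hilbert space with orthonormal basis $(\phi_j)_{j\ge1}$, and let $C:\mathcal H\to\mathcal H$ be a bounded linear operator with $C\phi_j=\lambda_j^2\phi_j$, where for some $\kappa>\tfrac12$ and $M_-,M_+\in(0,\infty)$ one has $M_-\le j^{\kappa}\lambda_j\le M_+$ for all $j\ge1$. For $r\in\mathbb R$ put $\langle x,y\rangle_r=\sum_j j^{2r}x_jy_j$ and $\|x\|_r^2=\sum_j j^{2r}x_j^2$ with $x_j=\langle x,\phi_j\rangle$, and let $\mathcal H^r$ be the corresponding space of expansions $\sum_j x_j\phi_j$ with $\|x\|_r<\infty$. Fix $s\in[0,\kappa-\tfrac12)$ and let $\Psi:\mathcal H^s\to\mathbb R$ be twice Fréchet differentiable, with gradient $\nabla\Psi(x)\in\mathcal H^{-s}$ (taken with respect to the pairing $\langle\cdot,\cdot\rangle$ of $\mathcal H$) and second derivative $\partial^2\Psi(x):\mathcal H^s\to\mathcal H^{-s}$, such that for some constants $M_1,\dots,M_4\in\mathbb R$ and all $x\in\mathcal H^s$ $$M_1\le\Psi(x)\le M_2(1+\|x\|_s^2),\qquad \|\nabla\Psi(x)\|_{-s}\le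 M_3(1+\|x\|_s),\qquad \|\partial^2\Psi(x)\|_{\mathcal L(\mathcal H^s,\mathcal H^{-s})}\le M_4 .$$ For $N\in\mathbb N$ let $P^N$ be the projection onto $X^N=\mathrm{span}\{\phi_1,\dots,\phi_N\}$, let $C^N=P^NCP^N$ and $\Psi^N=\Psi\circ P^N$. Let $\pi_0=\mathrm N(0,C)$ be the centred Gaussian measure on $\mathcal H$ with covariance operator $C$, and let $\pi^N$ be the probability measure with $d\pi^N/d\pi_0\propto\exp(-\Psi^N)$. Fix $\ell>0$ and let $\beta=2\Phi(-\ell/\sqrt2)$, where $\Phi$ is the standard normal distribution function. For each $N$ let $(x^k)_{k\ge0}$ be the random walk Metropolis (RWM) chain with $x^0=x\sim\pi^N$, $$x^{k+1}=\gamma^{k+1}y^{k+1}+(1-\gamma^{k+1})x^k,\qquad y^{k+1}=x^k+\sqrt{\tfrac{2\ell^2}{N}}\,C^{1/2}\xi^{k+1},\qquad \xi^{k+1}=\sum_{i=1}^N\xi_i^{k+1}\phi_i ,$$ where the $\xi_i^{k+1}$ are i.i.d. $\mathrm N(0,1)$, $\xi^{k+1}$ is independent of $\mathcal F_k=\sigma(x^n,\xi^n,\gamma^n:n\le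 k)$ (with $\xi^0=0$, $\gamma^0=0$), and, given $\mathcal F_k$ and $\xi^{k+1}$, $\gamma^{k+1}\in\{0,1\}$ is Bernoulli with parameter $\alpha(x^k,\xi^{k+1})=1\wedge e^{Q(x^k,\xi^{k+1})}$; here, with $y=x+\sqrt{2\ell^2/N}\,C^{1/2}\xi$, $$Q(x,\xi)=\tfrac12\|C^{-1/2}P^Nx\|^2-\tfrac12\|C^{-1/2}P^Ny\|^2+\Psi^N(x)-\Psi^N(y).$$ Write $\mathbb E_0=\mathbb E(\cdot\mid\mathcal F_0)$ and $(u\otimes v)z=\langle v,z\rangle u$. Then $x^1-x$ and $(x^1-x)\otimes(x^1-x)$ are integrable, and $$N\,\mathbb E_0(x^1-x)=-\ell^2\beta\big(P^Nx+C^N\nabla\Psi^N(x)\big)+r^N,$$ $$N\,\mathbb E_0\big[(x^1-x)\otimes(x^1-x)\big]=2\ell^2\beta\,C^N+E^N$$ almost surely, where the error terms satisfy, as $N\to\infty$, $$\mathbb E^{\pi^N}\|r^N\|_s^2\to0,\qquad \mathbb E^{\pi^N}\sum_{i=1}^N\big|\langle\phi_i,E^N\phi_i\rangle_s\big|\to0,\qquad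 \mathbb E^{\pi^N}\big|\langle\phi_i,E^N\phi_j\rangle_s\big|\to0\ \text{ for every fixed pair } i,j .$$ -/

import Mathlib

open MeasureTheory ProbabilityTheory Filter Topology

namespace RWM

noncomputable section

/-! ### Sobolev-like spaces

Basis indices start at `0` here, so the basis vector usually numbered `j + 1` is `φ j`, and
the weight of its coordinate in the norm of order `r` is `(j + 1) ^ (2 r)`. -/

/-- The weight `(j + 1) ^ (2 r)`. -/
def weight (r : ℝ) (j : ℕ) : ℝ := ((j : ℝ) + 1) ^ (2 * r)

lemma weight_pos (r : ℝ) (j : ℕ) : 0 < weight r j := Real.rpow_pos_of_pos (by positivity) _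

lemma summable_weight_mul {r : ℝ} {x y : ℕ → ℝ} (hx : Summable fun j => weight r j * x j ^ 2)
    (hy : Summable fun j => weight r j * y j ^ 2) :
    Summable fun j => weight r j * (x j * y j) := by
  refine Summable.of_norm_bounded (hx.add hy) fun j => ?_
  have h := (weight_pos r j).le
  rw [Real.norm_eq_abs, abs_mul, abs_of_nonneg h, ← mul_add]
  refine mul_le_mul_of_nonneg_left ?_ h
  rw [abs_le]
  constructor <;> nlinarith [sq_nonneg (x j + y j), sq_nonneg (x j - y j), sq_nonneg (x j),
    sq_nonneg (y j)]

/-- Coordinate sequences with finite norm of order `r`. -/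
def sobolevSubmodule (r : ℝ) : Submodule ℝ (ℕ → ℝ) where
  carrier := {x | Summable fun j => weight r j * x j ^ 2}
  zero_mem' := by simp [summable_zero]
  add_mem' := by
    intro x y hx hy
    have h := (hx.add hy).add ((summable_weight_mul hx hy).mul_left 2)
    refine h.congr fun j => ?_
    simp only [Pi.add_apply]
    ring
  smul_mem' := by
    intro c x hx
    refine (Summable.mul_left (c ^ 2) hx).congr fun j => ?_
    simp only [Pi.smul_apply, smul_eq_mul]
    ring

/-- The space `H^r`, `r` any real number: expansions `∑ j, x_j φ_j` in the eigenbasis with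
`∑ j, (j + 1) ^ (2 r) x_j ^ 2 < ∞`, an element being given by its coordinates `x_j`. -/
def SobolevSpace (r : ℝ) : Type := sobolevSubmodule r

namespace SobolevSpace

variable {r : ℝ}

/-- The element with given coordinates. -/
def mk (x : ℕ → ℝ) (hx : Summable fun j => weight r j * x j ^ 2) : SobolevSpace r := ⟨x, hx⟩

/-- The `j`-th coordinate `x_j = ⟨x, φ_j⟩`. -/
def coord (x : SobolevSpace r) (j : ℕ) : ℝ := x.1 j

lemma summable (x : SobolevSpace r) : Summable fun j => weight r j * x.coord j ^ 2 := x.2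

@[simp] lemma coord_mk (x : ℕ → ℝ) (hx : Summable fun j => weight r j * x j ^ 2) (j : ℕ) :
    (mk x hx).coord j = x j := rfl

@[ext] lemma ext {x y : SobolevSpace r} (h : ∀ j, x.coord j = y.coord j) : x = y :=
  Subtype.ext (funext h)

section Core

/-- Coordinatewise addition. -/
@[reducible] def addCommGroup (r : ℝ) : AddCommGroup (SobolevSpace r) :=
  inferInstanceAs (AddCommGroup (sobolevSubmodule r))

attribute [local instance] addCommGroup

/-- Coordinatewise multiplication by scalars. -/
@[reducible] def module (r : ℝ) : Module ℝ (SobolevSpace r) :=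
  inferInstanceAs (Module ℝ (sobolevSubmodule r))

attribute [local instance] module

/-- The inner product `⟨x, y⟩_r = ∑ j, (j + 1) ^ (2 r) x_j y_j`. -/
@[reducible] def innerCore (r : ℝ) : InnerProductSpace.Core ℝ (SobolevSpace r) where
  inner x y := ∑' j, weight r j * (x.coord j * y.coord j)
  conj_inner_symm x y := by
    simp only [conj_trivial]
    exact tsum_congr fun j => by ring
  re_inner_nonneg x := by
    simp only [RCLike.re_to_real]
    exact tsum_nonneg fun j => mul_nonneg (weight_pos r j).le (mul_self_nonneg _)
  add_left x y z := by
    rw [← (summable_weight_mul x.summable z.summable).tsum_add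
      (summable_weight_mul y.summable z.summable)]
    exact tsum_congr fun j => by
      rw [show (x + y).coord j = x.coord j + y.coord j from rfl]; ring
  smul_left x y c := by
    simp only [conj_trivial]
    rw [← tsum_mul_left]
    exact tsum_congr fun j => by
      rw [show (c • x).coord j = c * x.coord j from rfl]; ring
  definite x hx := by
    have hs := summable_weight_mul x.summable x.summable
    have h0 : ∀ j, 0 ≤ weight r j * (x.coord j * x.coord j) := fun j =>
      mul_nonneg (weight_pos r j).le (mul_self_nonneg _)
    have h := (hasSum_zero_iff_of_nonneg h0).1 (hx ▸ hs.hasSum)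
    refine ext fun j => ?_
    change x.coord j = 0
    have hj := congrFun h j
    simpa [(weight_pos r j).ne'] using hj

instance : NormedAddCommGroup (SobolevSpace r) := (innerCore r).toNormedAddCommGroup

instance : InnerProductSpace ℝ (SobolevSpace r) := InnerProductSpace.ofCore (innerCore r).toCore

end Core

@[simp] lemma coord_add (x y : SobolevSpace r) (j : ℕ) :
    (x + y).coord j = x.coord j + y.coord j := rfl

@[simp] lemma coord_smul (c : ℝ) (x : SobolevSpace r) (j : ℕ) :
    (c • x).coord j = c * x.coord j := rfl

@[simp] lemma coord_zero (j : ℕ) : (0 : SobolevSpace r).coord j = 0 := rfl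

lemma inner_def (x y : SobolevSpace r) :
    inner ℝ x y = ∑' j, weight r j * (x.coord j * y.coord j) := rfl

lemma norm_sq_eq (x : SobolevSpace r) : ‖x‖ ^ 2 = ∑' j, weight r j * x.coord j ^ 2 := by
  rw [← real_inner_self_eq_norm_sq, inner_def]
  exact tsum_congr fun j => by ring

/-- The element of `X^N = span {φ_0, …, φ_{N-1}}` with coordinates `x_j`, `j < N`. -/
def ofFinite (r : ℝ) (N : ℕ) (x : ℕ → ℝ) : SobolevSpace r :=
  mk (fun j => if j < N then x j else 0) <|
    summable_of_ne_finset_zero (s := Finset.range N) fun j hj => by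
      simp [Finset.mem_range.not.1 hj]

/-- The projection `P^N` of `H^r` onto `X^N`. -/
def proj (N : ℕ) (x : SobolevSpace r) : SobolevSpace r := ofFinite r N x.coord

/-- The basis vector `φ_j` as an element of `H^r`. -/
def basisVec (r : ℝ) (j : ℕ) : SobolevSpace r :=
  mk (Pi.single j 1) <|
    summable_of_ne_finset_zero (s := {j}) fun k hk => by
      simp [Pi.single_eq_of_ne (Finset.mem_singleton.not.1 hk)]

lemma coord_sum {ι : Type*} (F : Finset ι) (v : ι → SobolevSpace r) (j : ℕ) :
    (∑ i ∈ F, v i).coord j = ∑ i ∈ F, (v i).coord j := by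
  classical
  induction F using Finset.induction_on with
  | empty => simp
  | insert a F ha ih => rw [Finset.sum_insert ha, Finset.sum_insert ha, coord_add, ih]

lemma weight_neg (r : ℝ) (j : ℕ) : weight (-r) j = (weight r j)⁻¹ := by
  unfold weight
  rw [mul_neg, Real.rpow_neg (by positivity)]

/-- A bounded functional `L` on `H^r` has coordinates `L φ_j` in `H^{-r}`. -/
lemma summable_functional (L : SobolevSpace r →L[ℝ] ℝ) :
    Summable fun j => weight (-r) j * (L (basisVec r j)) ^ 2 := by
  refine summable_of_sum_le (c := ‖L‖ ^ 2)
    (fun j => mul_nonneg (weight_pos _ j).le (sq_nonneg _)) fun F => ?_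
  set S := ∑ j ∈ F, weight (-r) j * (L (basisVec r j)) ^ 2 with hS
  set v : SobolevSpace r := ∑ j ∈ F, (weight (-r) j * L (basisVec r j)) • basisVec r j with hv
  have hS0 : 0 ≤ S := Finset.sum_nonneg fun j _ => mul_nonneg (weight_pos _ j).le (sq_nonneg _)
  have hLv : L v = S := by
    rw [hv, map_sum, hS]
    refine Finset.sum_congr rfl fun j _ => ?_
    rw [map_smul, smul_eq_mul]
    ring
  have hvj : ∀ j, v.coord j = if j ∈ F then weight (-r) j * L (basisVec r j) else 0 := by
    intro j
    rw [hv, coord_sum]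
    simp [basisVec, Pi.single_apply]
  have hvn : ‖v‖ ^ 2 = S := by
    rw [norm_sq_eq, tsum_eq_sum (s := F) fun j hj => by rw [hvj, if_neg hj]; simp, hS]
    refine Finset.sum_congr rfl fun j hj => ?_
    rw [hvj, if_pos hj, weight_neg]
    have := (weight_pos r j).ne'
    field_simp
  have h1 : S ≤ ‖L‖ * ‖v‖ := by
    rw [← hLv]
    exact (le_abs_self _).trans (L.le_opNorm v)
  have h2 : S * S ≤ ‖L‖ ^ 2 * S := by
    calc S * S ≤ (‖L‖ * ‖v‖) * (‖L‖ * ‖v‖) := mul_self_le_mul_self hS0 h1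
      _ = ‖L‖ ^ 2 * S := by rw [← hvn]; ring
  rcases hS0.eq_or_lt with h | h
  · rw [← h]; positivity
  · exact le_of_mul_le_mul_right h2 h

/-- The gradient `∇f(x) ∈ H^{-r}` of `f : H^r → ℝ`, that is, the Fréchet derivative of `f` at `x`
read through the pairing `⟨·, ·⟩` of `H`: its coordinates are `∂f/∂φ_j (x)`. -/
def grad (f : SobolevSpace r → ℝ) (x : SobolevSpace r) : SobolevSpace (-r) :=
  mk (fun j => fderiv ℝ f x (basisVec r j)) (summable_functional _)

/-- The second derivative `∂²f(x) : H^r → H^{-r}`. -/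
def hess (f : SobolevSpace r → ℝ) (x : SobolevSpace r) : SobolevSpace r →L[ℝ] SobolevSpace (-r) :=
  fderiv ℝ (grad f) x

end SobolevSpace

open SobolevSpace

/-! ### Assumptions on the covariance and on the potential -/

/-- `M₋ ≤ i ^ κ λ_i ≤ M₊` for all `i ≥ 1`. -/
def EigenvalueDecay (lam : ℕ → ℝ) (κ : ℝ) : Prop :=
  ∃ Mm Mp : ℝ, 0 < Mm ∧ 0 < Mp ∧
    ∀ j : ℕ, Mm ≤ ((j : ℝ) + 1) ^ κ * lam j ∧ ((j : ℝ) + 1) ^ κ * lam j ≤ Mp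

/-- `Ψ : H^s → ℝ` is twice differentiable, bounded below, quadratically bounded above, its gradient
is linearly bounded in `H^{-s}` and its second derivative is bounded from `H^s` to `H^{-s}`. -/
structure PotentialBounds {s : ℝ} (Ψ : SobolevSpace s → ℝ) : Prop where
  differentiable : Differentiable ℝ Ψ
  differentiable_grad : Differentiable ℝ (grad Ψ)
  bounds : ∃ M₁ M₂ M₃ M₄ : ℝ, ∀ x : SobolevSpace s,
    M₁ ≤ Ψ x ∧ Ψ x ≤ M₂ * (1 + ‖x‖ ^ 2) ∧
    ‖grad Ψ x‖ ≤ M₃ * (1 + ‖x‖) ∧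
    ‖hess Ψ x‖ ≤ M₄

/-- `Ψ^N = Ψ ∘ P^N`. -/
def psiN {s : ℝ} (Ψ : SobolevSpace s → ℝ) (N : ℕ) (x : SobolevSpace s) : ℝ := Ψ (proj N x)

/-! ### Operators on `H` -/

variable {H : Type*} [NormedAddCommGroup H] [InnerProductSpace ℝ H]

/-- The operator on `H` which sends `φ_j` to `d_j φ_j` for `j < N` and to `0` for `j ≥ N`. -/
def diagN (φ : HilbertBasis ℕ ℝ H) (d : ℕ → ℝ) (N : ℕ) : H →L[ℝ] H :=
  ∑ j ∈ Finset.range N, d j • InnerProductSpace.rankOne ℝ (φ j) (φ j)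

/-- The projection `P^N` of `H` onto `X^N = span {φ_0, …, φ_{N-1}}`. -/
def PN (φ : HilbertBasis ℕ ℝ H) (N : ℕ) : H →L[ℝ] H := diagN φ (fun _ => 1) N

/-- `C^N = P^N C P^N`. -/
def CN (φ : HilbertBasis ℕ ℝ H) (C : H →L[ℝ] H) (N : ℕ) : H →L[ℝ] H :=
  PN φ N ∘L C ∘L PN φ N

/-- `P^N x`, for `x` in `H`, as an element of `H^s`. -/
def toSobolev (φ : HilbertBasis ℕ ℝ H) (s : ℝ) (N : ℕ) (x : H) : SobolevSpace s :=
  ofFinite s N fun j => inner ℝ (φ j) x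

/-- `∇Ψ^N(x)`, which lies in `X^N`, as an element of `H`. -/
def gradPsiN (φ : HilbertBasis ℕ ℝ H) {s : ℝ} (Ψ : SobolevSpace s → ℝ) (N : ℕ) (x : H) : H :=
  ∑ j ∈ Finset.range N, (grad (psiN Ψ N) (toSobolev φ s N x)).coord j • φ j

/-- `⟨u, v⟩_s` for `u, v` in `H`. -/
def sobInner (φ : HilbertBasis ℕ ℝ H) (s : ℝ) (u v : H) : ℝ :=
  ∑' j, weight s j * (inner ℝ (φ j) u * inner ℝ (φ j) v)

/-- `‖v‖_s ^ 2 ∈ [0, ∞]` for `v` in `H`. -/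
def sobNormSq (φ : HilbertBasis ℕ ℝ H) (s : ℝ) (v : H) : ENNReal :=
  ∑' j, ENNReal.ofReal (weight s j * inner ℝ (φ j) v ^ 2)

/-! ### The target measures and the chain -/

/-- `π₀ = N(0, C)`, the centred Gaussian measure on `H` with covariance operator `C`. -/
structure IsCenteredGaussian [MeasurableSpace H] [BorelSpace H] (π₀ : Measure H)
    (C : H →L[ℝ] H) : Prop where
  gaussian : IsGaussian π₀
  mean_zero : ∫ x, x ∂π₀ = 0
  covariance : ∀ u v : H, covarianceBilin π₀ u v = inner ℝ (C u) v

/-- `π^N`, with `dπ^N/dπ₀` proportional to `exp (-Ψ^N)` and total mass one. -/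
def targetN [MeasurableSpace H] (φ : HilbertBasis ℕ ℝ H) {s : ℝ} (Ψ : SobolevSpace s → ℝ)
    (π₀ : Measure H) (N : ℕ) : Measure H :=
  π₀.tilted fun x => -psiN Ψ N (toSobolev φ s N x)

/-- The law of `∑_{i < N} ξ_i φ_i` with `ξ_i` i.i.d. standard normal. -/
def noiseLaw [MeasurableSpace H] (φ : HilbertBasis ℕ ℝ H) (N : ℕ) : Measure H :=
  (Measure.pi fun _ : Fin N => gaussianReal 0 1).map fun z => ∑ i : Fin N, z i • φ i

/-- The proposal `y = x + √(2 ℓ² / N) C^{1/2} ξ`, for `ξ` in `X^N`. -/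
def proposal (φ : HilbertBasis ℕ ℝ H) (lam : ℕ → ℝ) (ℓ : ℝ) (N : ℕ) (x ξ : H) : H :=
  x + √(2 * ℓ ^ 2 / N) • diagN φ lam N ξ

/-- `Q(x, ξ) = ½‖C^{-1/2} P^N x‖² - ½‖C^{-1/2} P^N y‖² + Ψ^N(x) - Ψ^N(y)`,
`y` being the proposal. -/
def logRatio (φ : HilbertBasis ℕ ℝ H) (lam : ℕ → ℝ) {s : ℝ} (Ψ : SobolevSpace s → ℝ) (ℓ : ℝ)
    (N : ℕ) (x ξ : H) : ℝ :=
  let y := proposal φ lam ℓ N x ξ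
  1 / 2 * ‖diagN φ (fun j => (lam j)⁻¹) N x‖ ^ 2
    - 1 / 2 * ‖diagN φ (fun j => (lam j)⁻¹) N y‖ ^ 2
    + psiN Ψ N (toSobolev φ s N x) - psiN Ψ N (toSobolev φ s N y)

/-- The acceptance probability `α(x, ξ) = 1 ∧ exp Q(x, ξ)`. -/
def acceptProb (φ : HilbertBasis ℕ ℝ H) (lam : ℕ → ℝ) {s : ℝ} (Ψ : SobolevSpace s → ℝ) (ℓ : ℝ)
    (N : ℕ) (x ξ : H) : ℝ :=
  min 1 (Real.exp (logRatio φ lam Ψ ℓ N x ξ))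

/-- `F_k`, the σ-algebra generated by `x^n, ξ^n, γ^n`, `n ≤ k`. -/
@[reducible] def history {Ω : Type*} [MeasurableSpace H] (x ξ : ℕ → Ω → H) (γ : ℕ → Ω → ℝ) (k : ℕ) :
    MeasurableSpace Ω :=
  ⨆ n ∈ Finset.range (k + 1),
    (MeasurableSpace.comap (x n) inferInstance ⊔ MeasurableSpace.comap (ξ n) inferInstance ⊔
      MeasurableSpace.comap (γ n) inferInstance)

/-- `x^k` is the random walk Metropolis chain in dimension `N` started from `π^N`, driven by the
noises `ξ^k` and the acceptance variables `γ^k`, on the probability space `(Ω, P)`. -/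
structure IsRWMChain {Ω : Type*} [MeasurableSpace Ω] (P : Measure Ω) [MeasurableSpace H]
    (φ : HilbertBasis ℕ ℝ H) (lam : ℕ → ℝ) {s : ℝ} (Ψ : SobolevSpace s → ℝ) (π₀ : Measure H)
    (ℓ : ℝ) (N : ℕ) (x ξ : ℕ → Ω → H) (γ : ℕ → Ω → ℝ) : Prop where
  measurable_x : ∀ k, Measurable (x k)
  measurable_noise : ∀ k, Measurable (ξ k)
  measurable_accept : ∀ k, Measurable (γ k)
  /-- The chain starts in stationarity. -/
  law_init : P.map (x 0) = targetN φ Ψ π₀ N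
  noise_zero : ξ 0 = 0
  accept_zero : γ 0 = 0
  law_noise : ∀ k, P.map (ξ (k + 1)) = noiseLaw φ N
  /-- `ξ^{k+1}` is independent of the past. -/
  indep_noise : ∀ k,
    Indep (MeasurableSpace.comap (ξ (k + 1)) inferInstance) (history x ξ γ k) P
  accept_values : ∀ k ω, γ (k + 1) ω = 0 ∨ γ (k + 1) ω = 1
  /-- Given the past and `ξ^{k+1}`, the variable `γ^{k+1}` is Bernoulli with parameter
  `α(x^k, ξ^{k+1})`. -/
  accept_prob : ∀ k,
    P[γ (k + 1) | history x ξ γ k ⊔ MeasurableSpace.comap (ξ (k + 1)) inferInstance]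
      =ᵐ[P] fun ω => acceptProb φ lam Ψ ℓ N (x k ω) (ξ (k + 1) ω)
  step : ∀ k ω, x (k + 1) ω =
    γ (k + 1) ω • proposal φ lam ℓ N (x k ω) (ξ (k + 1) ω) + (1 - γ (k + 1) ω) • x k ω

/-- `β = 2 Φ(-ℓ/√2)`, `Φ` being the standard normal distribution function. -/
def beta (ℓ : ℝ) : ℝ := 2 * cdf (gaussianReal 0 1) (-ℓ / √2)

end

end RWM

namespace RWM

noncomputable section

/-! ### The Metropolis acceptance function -/

/-! In the normalised coordinates `X_j = x_j / λ_j` the reference measure is the standard Gaussian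
on `ℝ^N` and the proposal is `X + τ ξ` with `τ² = 2ℓ²/N`. Let `G` be the gradient of the potential
in these coordinates and `ζ = X + G(X)`. Expanding the squares and the potential gives `Q = -τ ∑ ζ_j
ξ_j - (τ²/2) ∑ ξ_j² + O(τ² wsq a ξ)`, where the weights `a_j`, namely `weight s j * lam j ^ 2`, are
summable because `s < κ - 1/2`. Given `X`, the first sum is exactly Gaussian, the second
concentrates at `N`, and `|ζ|²/N` is close to `|X|²/N`, hence to `1`. So `Q` is within
`O(N^(-1/2))`, tested against Lipschitz functions, of a variable `Z` with law `N(-ℓ², 2ℓ²)`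
(`abs_integral_finQ_sub_le`). For this law `E[1 ∧ e^Z] = β` and `E[e^Z; Z < 0] = β/2`
(`integral_acc`, `integral_accDeriv`).

The moments involve `Q` jointly with `ξ_i`. Let `q` be `Q` with `ξ_i` set to `0`: it is independent
of `ξ_i`, and `Q = q - τ ζ_i ξ_i + O(τ²)` (`abs_finQ_sub_update_le`). For second moments, replacing
`Q` by `q` already gives `E[acc(Q) ξ_i ξ_j] ≈ β` if `i = j` and `≈ 0` otherwise. For the drift the
leading term `E[acc(q) ξ_i]` vanishes, and the next order gives `N τ E[acc(Q) ξ_i] ≈ -N τ² ζ_i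
E[acc'(q)] ≈ -ℓ² β ζ_i`; multiplied by `λ_i`, this is the `i`-th coordinate of the claimed drift.

The kink of `acc` at `0` is the one delicate point, as `acc'` is not Lipschitz there. It is replaced
by the difference quotient `accSlope δ`, the error being controlled by a Lipschitz `bump δ` around
the kink (`abs_acc_add_sub_le`). Smoothing costs `δ`, while Lipschitz constants of order `1/δ`
against the Gaussian error `N^(-1/2)` cost `N^(-1/2)/δ`; hence `δ = ε = N^(-1/4)`.

The squared drift error and the covariance error of each coordinate are thus at most a constant
times `ε * stateDom a i X` (`exists_drift_sq_le`, `exists_covariance_le`), where `stateDom` has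
Gaussian mean bounded uniformly in `N` and `i`. The density of `π^N` with respect to `π₀` is bounded
uniformly in `N` (`exists_lintegral_targetN_le`), so the same holds under `π^N`, and the sum over
`i` with the summable weights is still `O(ε)`. Finally `condExp_accept_mul` identifies the
conditional expectations given `F_0` with these Gaussian integrals. -/

/-- The Metropolis acceptance function `q ↦ 1 ∧ exp q`. -/
def acc (q : ℝ) : ℝ := min 1 (Real.exp q)

lemma acc_nonneg (q : ℝ) : 0 ≤ acc q := le_min zero_le_one (Real.exp_pos q).le

lemma acc_le_one (q : ℝ) : acc q ≤ 1 := min_le_left _ _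

lemma acc_mono : Monotone acc := fun _ _ h => min_le_min le_rfl (Real.exp_le_exp.2 h)

lemma continuous_acc : Continuous acc := by unfold acc; fun_prop

lemma acc_of_nonneg {q : ℝ} (h : 0 ≤ q) : acc q = 1 := min_eq_left (Real.one_le_exp h)

lemma acc_of_nonpos {q : ℝ} (h : q ≤ 0) : acc q = Real.exp q :=
  min_eq_right (Real.exp_le_one_iff.2 h)

/-- The exponential has slope at most `1` on the negative half-line, and nothing is gained beyond
`0`; so `q` is first truncated to `min q 0` and then `1 + x ≤ exp x` is applied. -/
lemma acc_sub_le {p q : ℝ} (h : p ≤ q) : acc q - acc p ≤ q - p := by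
  rcases le_total 0 p with hp | hp
  · rw [acc_of_nonneg hp, acc_of_nonneg (hp.trans h)]; linarith
  · have h1 : acc q ≤ Real.exp (min q 0) := by
      rcases le_total q 0 with hq | hq
      · rw [min_eq_left hq, acc_of_nonpos hq]
      · rw [min_eq_right hq, Real.exp_zero]; exact acc_le_one q
    rw [acc_of_nonpos hp]
    have h2 : p ≤ min q 0 := le_min h hp
    have h3 := Real.add_one_le_exp (p - min q 0)
    have h4 : Real.exp (min q 0) * Real.exp (p - min q 0) = Real.exp p := by
      rw [← Real.exp_add]; ring_nf
    have h5 : Real.exp (min q 0) ≤ 1 := Real.exp_le_one_iff.2 (min_le_right _ _)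
    have h6 : min q 0 ≤ q := min_le_left _ _
    nlinarith [Real.exp_pos (min q 0)]

lemma abs_acc_sub_le (p q : ℝ) : |acc p - acc q| ≤ |p - q| := by
  rcases le_total p q with h | h
  · rw [abs_sub_comm, abs_sub_comm p, abs_of_nonneg (sub_nonneg.2 (acc_mono h)),
      abs_of_nonneg (sub_nonneg.2 h)]
    exact acc_sub_le h
  · rw [abs_of_nonneg (sub_nonneg.2 (acc_mono h)), abs_of_nonneg (sub_nonneg.2 h)]
    exact acc_sub_le h

/-- The forward difference quotient of the acceptance function. -/
def accSlope (δ q : ℝ) : ℝ := (acc (q + δ) - acc q) / δ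

/-- A Lipschitz cutoff which is `1` on `[-δ, δ]` and `0` outside `[-2δ, 2δ]`. -/
def bump (δ q : ℝ) : ℝ := max 0 (min 1 (2 - |q| / δ))

/-- The derivative of the acceptance function away from the kink. -/
def accDeriv (q : ℝ) : ℝ := if q < 0 then Real.exp q else 0

lemma continuous_accSlope (δ : ℝ) : Continuous (accSlope δ) :=
  ((continuous_acc.comp (by fun_prop)).sub continuous_acc).div_const δ

lemma continuous_bump (δ : ℝ) : Continuous (bump δ) := by unfold bump; fun_prop

lemma accSlope_nonneg {δ : ℝ} (hδ : 0 < δ) (q : ℝ) : 0 ≤ accSlope δ q :=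
  div_nonneg (sub_nonneg.2 (acc_mono (by linarith))) hδ.le

lemma accSlope_le_one {δ : ℝ} (hδ : 0 < δ) (q : ℝ) : accSlope δ q ≤ 1 := by
  rw [accSlope, div_le_one hδ]
  have := acc_sub_le (show q ≤ q + δ by linarith)
  linarith

lemma bump_nonneg (δ q : ℝ) : 0 ≤ bump δ q := le_max_left _ _

lemma bump_le_one (δ q : ℝ) : bump δ q ≤ 1 := max_le zero_le_one (min_le_left _ _)

lemma abs_accSlope_sub_le {δ : ℝ} (hδ : 0 < δ) (p q : ℝ) :
    |accSlope δ p - accSlope δ q| ≤ 2 / δ * |p - q| := by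
  have h1 := abs_acc_sub_le (p + δ) (q + δ)
  have h2 := abs_acc_sub_le p q
  rw [accSlope, accSlope, ← sub_div, abs_div, abs_of_pos hδ, div_mul_eq_mul_div]
  gcongr
  calc |acc (p + δ) - acc p - (acc (q + δ) - acc q)|
      = |(acc (p + δ) - acc (q + δ)) - (acc p - acc q)| := by ring_nf
    _ ≤ |acc (p + δ) - acc (q + δ)| + |acc p - acc q| := abs_sub _ _
    _ ≤ |p - q| + |p - q| := add_le_add (by rwa [add_sub_add_right_eq_sub] at h1) h2
    _ = 2 * |p - q| := by ring

lemma abs_bump_sub_le {δ : ℝ} (hδ : 0 < δ) (p q : ℝ) :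
    |bump δ p - bump δ q| ≤ 2 / δ * |p - q| := by
  have h1 : |bump δ p - bump δ q| ≤ |(2 - |p| / δ) - (2 - |q| / δ)| := by
    unfold bump
    refine (abs_max_sub_max_le_max _ _ _ _).trans (max_le (by simp) ?_)
    exact (abs_min_sub_min_le_max _ _ _ _).trans (max_le (by simp) le_rfl)
  refine h1.trans ?_
  rw [show (2 - |p| / δ) - (2 - |q| / δ) = (|q| - |p|) / δ by ring, abs_div, abs_of_pos hδ,
    div_mul_eq_mul_div]
  gcongr
  have := abs_abs_sub_abs_le q p
  rw [abs_sub_comm p q]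
  nlinarith [abs_nonneg (q - p)]

lemma bump_eq_one {δ q : ℝ} (hδ : 0 < δ) (h : |q| ≤ δ) : bump δ q = 1 := by
  have : |q| / δ ≤ 1 := (div_le_one hδ).2 h
  rw [bump, min_eq_left (by linarith), max_eq_right zero_le_one]

lemma bump_eq_zero {δ q : ℝ} (hδ : 0 < δ) (h : 2 * δ < |q|) : bump δ q = 0 := by
  have : 2 < |q| / δ := (lt_div_iff₀ hδ).2 h
  exact max_eq_left ((min_le_right _ _).trans (by linarith))

lemma exp_mul_abs_exp_sub_le {q h : ℝ} (hq : q ≤ 0) (hh : |h| ≤ 1) :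
    |Real.exp (q + h) - Real.exp q - h * Real.exp q| ≤ h ^ 2 := by
  rw [Real.exp_add, show Real.exp q * Real.exp h - Real.exp q - h * Real.exp q =
    Real.exp q * (Real.exp h - 1 - h) by ring, abs_mul, abs_of_pos (Real.exp_pos q)]
  have h1 := Real.abs_exp_sub_one_sub_id_le hh
  have h2 : Real.exp q ≤ 1 := Real.exp_le_one_iff.2 hq
  calc _ ≤ 1 * h ^ 2 := by gcongr
    _ = h ^ 2 := one_mul _

lemma abs_accSlope_sub_exp_le {δ q : ℝ} (hδ : 0 < δ) (hδ1 : δ ≤ 1) (hq : q ≤ -δ) :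
    |accSlope δ q - Real.exp q| ≤ δ := by
  rw [accSlope, acc_of_nonpos (by linarith), acc_of_nonpos (by linarith)]
  have h1 := exp_mul_abs_exp_sub_le (q := q) (h := δ) (by linarith) (by rwa [abs_of_pos hδ])
  rw [show (Real.exp (q + δ) - Real.exp q) / δ - Real.exp q =
    (Real.exp (q + δ) - Real.exp q - δ * Real.exp q) / δ by field_simp, abs_div, abs_of_pos hδ,
    div_le_iff₀ hδ]
  linarith [sq δ]

/-- First-order expansion of the acceptance function, with the kink absorbed into a bump. -/
lemma abs_acc_add_sub_le {δ : ℝ} (hδ : 0 < δ) (hδ1 : δ ≤ 1) (q h : ℝ) :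
    |acc (q + h) - acc q - h * accSlope δ q| ≤ |h| * (2 * δ + bump δ q + |h| / δ) := by
  have hk0 := accSlope_nonneg hδ q
  have hk1 := accSlope_le_one hδ q
  have hb := bump_nonneg δ q
  -- Both the increment of `acc` and `h * accSlope δ q` lie between `0` and `h`. This crude bound
  -- suffices when `|h| > δ`, where `|h| / δ ≥ 1`, and when `|q| ≤ δ`, where the bump equals `1`.
  -- Otherwise `q` and `q + h` are on the same side of the kink.
  have key : |acc (q + h) - acc q - h * accSlope δ q| ≤ |h| := by
    have h1 := abs_acc_sub_le (q + h) q
    rw [add_sub_cancel_left] at h1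
    rcases le_total 0 h with h0 | h0
    · have h2 := acc_mono (show q ≤ q + h by linarith)
      rw [abs_of_nonneg h0] at h1 ⊢
      rw [abs_of_nonneg (by linarith)] at h1
      rw [abs_le]; constructor <;> nlinarith
    · have h2 := acc_mono (show q + h ≤ q by linarith)
      rw [abs_of_nonpos h0] at h1 ⊢
      rw [abs_of_nonpos (by linarith)] at h1
      rw [abs_le]; constructor <;> nlinarith
  rcases lt_or_ge δ |h| with hh | hh
  · have : 1 ≤ |h| / δ := (one_le_div hδ).2 hh.le
    nlinarith [abs_nonneg h]
  have hd : 0 ≤ |h| / δ := div_nonneg (abs_nonneg h) hδ.le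
  rcases le_or_gt |q| δ with hq | hq
  · rw [bump_eq_one hδ hq]
    nlinarith [abs_nonneg h]
  rcases lt_or_ge q 0 with h0 | h0
  · rw [abs_of_neg h0] at hq
    have h3 := exp_mul_abs_exp_sub_le (q := q) (h := h) h0.le (hh.trans hδ1)
    have h4 := abs_accSlope_sub_exp_le hδ hδ1 (show q ≤ -δ by linarith)
    rw [acc_of_nonpos (q := q + h) (by linarith [le_abs_self h]), acc_of_nonpos h0.le]
    have h5 : |Real.exp (q + h) - Real.exp q - h * accSlope δ q| ≤
        |Real.exp (q + h) - Real.exp q - h * Real.exp q| + |h| * |accSlope δ q - Real.exp q| := by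
      rw [← abs_mul]
      calc _ = |(Real.exp (q + h) - Real.exp q - h * Real.exp q) -
            h * (accSlope δ q - Real.exp q)| := by ring_nf
        _ ≤ _ := abs_sub _ _
    have h6 : h ^ 2 ≤ |h| * δ := by rw [← sq_abs, sq]; gcongr
    nlinarith [abs_nonneg h, mul_le_mul_of_nonneg_left h4 (abs_nonneg h),
      mul_nonneg (abs_nonneg h) hb, mul_nonneg (abs_nonneg h) hd]
  · rw [abs_of_nonneg h0] at hq
    rw [accSlope, acc_of_nonneg h0, acc_of_nonneg (q := q + h) (by linarith [neg_abs_le h]),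
      acc_of_nonneg (q := q + δ) (by linarith)]
    simp only [sub_self, zero_div, mul_zero, abs_zero]
    positivity

/-- Away from the kink a difference quotient of step `δ` is `δ`-close to the derivative; near it
both lie in `[0, 1]` and the bump equals `1`. -/
lemma abs_accDeriv_sub_accSlope_le {δ : ℝ} (hδ : 0 < δ) (hδ1 : δ ≤ 1) (q : ℝ) :
    |accDeriv q - accSlope δ q| ≤ δ + bump δ q := by
  have hk0 := accSlope_nonneg hδ q
  have hk1 := accSlope_le_one hδ q
  have hb := bump_nonneg δ q
  rcases le_or_gt |q| δ with hq | hq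
  · rw [bump_eq_one hδ hq, accDeriv]
    split_ifs with h
    · have := Real.exp_pos q
      have := Real.exp_le_one_iff.2 h.le
      rw [abs_le]; constructor <;> linarith
    · rw [abs_le]; constructor <;> linarith
  rcases lt_or_ge q 0 with h0 | h0
  · rw [abs_of_neg h0] at hq
    rw [accDeriv, if_pos h0, abs_sub_comm]
    linarith [abs_accSlope_sub_exp_le hδ hδ1 (show q ≤ -δ by linarith)]
  · rw [accDeriv, if_neg h0.not_gt, accSlope, acc_of_nonneg h0, acc_of_nonneg (by linarith)]
    simp only [sub_self, zero_div, abs_zero]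
    positivity

/-! ### Gaussian averages of the acceptance function -/

/-- The limiting law `N(-ℓ², 2ℓ²)` of the log acceptance ratio. -/
def limitLaw (ℓ : ℝ) : Measure ℝ := gaussianReal (-ℓ ^ 2) (2 * ℓ ^ 2).toNNReal

instance (ℓ : ℝ) : IsProbabilityMeasure (limitLaw ℓ) := by unfold limitLaw; infer_instance

lemma map_affine_stdGaussian (m c : ℝ) :
    (gaussianReal 0 1).map (fun z => m + c * z) = gaussianReal m (c ^ 2).toNNReal := by
  have : (fun z : ℝ => m + c * z) = (fun z => m + z) ∘ (fun z => c * z) := rfl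
  rw [this, ← Measure.map_map (by fun_prop) (by fun_prop), gaussianReal_map_const_mul,
    gaussianReal_map_const_add]
  congr 1
  · ring
  · ext; simp [Real.coe_toNNReal _ (sq_nonneg c)]

lemma two_mul_sq_toNNReal_ne_zero {ℓ : ℝ} (hℓ : 0 < ℓ) : (2 * ℓ ^ 2).toNNReal ≠ 0 :=
  (Real.toNNReal_pos.2 (by positivity)).ne'

/-- Standardisation: `ℓ² + √2 ℓ z ≤ 0` means `z ≤ -ℓ/√2`. -/
lemma gaussianReal_Iic_zero {ℓ : ℝ} (hℓ : 0 < ℓ) :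
    (gaussianReal (ℓ ^ 2) (2 * ℓ ^ 2).toNNReal).real (Set.Iic 0) = beta ℓ / 2 := by
  have h2 : (0 : ℝ) < √2 := by positivity
  have hs : √2 * √2 = 2 := Real.mul_self_sqrt (by norm_num)
  rw [show 2 * ℓ ^ 2 = (√2 * ℓ) ^ 2 by rw [mul_pow, sq √2, hs], ← map_affine_stdGaussian,
    map_measureReal_apply (by fun_prop) measurableSet_Iic, beta, cdf_eq_real]
  rw [show (fun z => ℓ ^ 2 + √2 * ℓ * z) ⁻¹' Set.Iic 0 = Set.Iic (-ℓ / √2) by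
    ext z
    simp only [Set.mem_preimage, Set.mem_Iic, le_div_iff₀ h2]
    constructor <;> intro h <;> nlinarith]
  ring

/-- Exponential tilting: multiplying the density of `N(-ℓ², 2ℓ²)` by `e^z` shifts the mean by the
variance, which gives exactly the density of `N(ℓ², 2ℓ²)`. The integral is therefore the mass which
that law gives to the negative half-line. -/
lemma integral_accDeriv {ℓ : ℝ} (hℓ : 0 < ℓ) : ∫ z, accDeriv z ∂(limitLaw ℓ) = beta ℓ / 2 := by
  have hv := two_mul_sq_toNNReal_ne_zero hℓ
  rw [limitLaw, integral_gaussianReal_eq_integral_smul hv, ← gaussianReal_Iic_zero hℓ, measureReal_def,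
    gaussianReal_apply_eq_integral _ hv, ENNReal.toReal_ofReal
      (setIntegral_nonneg measurableSet_Iic fun _ _ => gaussianPDFReal_nonneg _ _ _),
    integral_Iic_eq_integral_Iio, ← integral_indicator measurableSet_Iio]
  congr 1
  ext z
  simp only [accDeriv, Set.indicator_apply, Set.mem_Iio, smul_eq_mul]
  split_ifs with h
  · simp only [gaussianPDFReal, mul_assoc, ← Real.exp_add]
    congr 2
    rw [Real.coe_toNNReal _ (by positivity)]
    field_simp
    ring
  · simp

lemma integrable_of_bounded {α : Type*} [MeasurableSpace α] {μ : Measure α} [IsFiniteMeasure μ]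
    {f : α → ℝ} {c : ℝ} (hf : Measurable f) (h : ∀ a, |f a| ≤ c) : Integrable f μ :=
  Integrable.of_bound hf.aestronglyMeasurable c (ae_of_all _ h)

lemma measurable_accDeriv : Measurable accDeriv :=
  Measurable.ite measurableSet_Iio Real.measurable_exp measurable_const

lemma abs_accDeriv_le (q : ℝ) : |accDeriv q| ≤ 1 := by
  unfold accDeriv
  split_ifs with h
  · rw [abs_of_pos (Real.exp_pos q)]; exact Real.exp_le_one_iff.2 h.le
  · simp

/-- Split `acc` at `0`: below it is `accDeriv`, worth `β/2`; above it is `1`, and the reflection `z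
↦ -z` identifies the mass of `[0, ∞)` with the same `β/2`. -/
lemma integral_acc {ℓ : ℝ} (hℓ : 0 < ℓ) : ∫ z, acc z ∂(limitLaw ℓ) = beta ℓ := by
  have h1 : ∀ z, acc z = accDeriv z + (Set.Ici (0 : ℝ)).indicator (fun _ => (1 : ℝ)) z := by
    intro z
    rcases lt_or_ge z 0 with h | h
    · simp [accDeriv, h, h.not_ge, acc_of_nonpos h.le]
    · simp [accDeriv, h, h.not_gt, acc_of_nonneg h]
  simp_rw [h1]
  rw [integral_add (integrable_of_bounded measurable_accDeriv abs_accDeriv_le)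
    ((integrable_const 1).indicator measurableSet_Ici), integral_accDeriv hℓ,
    integral_indicator measurableSet_Ici]
  have h2 : (limitLaw ℓ).real (Set.Ici 0) = beta ℓ / 2 := by
    rw [← gaussianReal_Iic_zero hℓ, limitLaw, ← gaussianReal_map_neg,
      map_measureReal_apply (by fun_prop) measurableSet_Ici]
    congr 1
    ext z
    simp
  simp [h2]

/-- The bump lives on an interval of length `4δ`, and the density of the limit law is at most `1 /
√(4πℓ²)`. -/
lemma integral_bump_le {ℓ : ℝ} (hℓ : 0 < ℓ) {δ : ℝ} (hδ : 0 < δ) :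
    ∫ z, bump δ z ∂(limitLaw ℓ) ≤ 4 / √(4 * Real.pi * ℓ ^ 2) * δ := by
  have hv := two_mul_sq_toNNReal_ne_zero hℓ
  have h1 : ∫ z, bump δ z ∂(limitLaw ℓ) ≤
      ∫ z, (Set.Icc (-(2 * δ)) (2 * δ)).indicator (fun _ => (1 : ℝ)) z ∂(limitLaw ℓ) := by
    refine integral_mono (integrable_of_bounded (continuous_bump δ).measurable (c := 1) fun z => ?_)
      ((integrable_const 1).indicator measurableSet_Icc) fun z => ?_
    · rw [abs_of_nonneg (bump_nonneg _ _)]; exact bump_le_one _ _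
    · by_cases h : z ∈ Set.Icc (-(2 * δ)) (2 * δ)
      · rw [Set.indicator_of_mem h]; exact bump_le_one _ _
      · rw [Set.indicator_of_notMem h, bump_eq_zero hδ]
        exact not_le.1 fun h' => h (Set.mem_Icc.2 (abs_le.1 h'))
  refine h1.trans ?_
  rw [integral_indicator measurableSet_Icc]
  simp only [integral_const, measureReal_restrict_apply_univ, smul_eq_mul, mul_one]
  rw [limitLaw, measureReal_def, gaussianReal_apply_eq_integral _ hv, ENNReal.toReal_ofReal
      (setIntegral_nonneg measurableSet_Icc fun _ _ => gaussianPDFReal_nonneg _ _ _)]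
  have h2 : ∀ z, gaussianPDFReal (-ℓ ^ 2) (2 * ℓ ^ 2).toNNReal z ≤ 1 / √(4 * Real.pi * ℓ ^ 2) := by
    intro z
    rw [gaussianPDFReal, Real.coe_toNNReal _ (by positivity), one_div,
      show 2 * Real.pi * (2 * ℓ ^ 2) = 4 * Real.pi * ℓ ^ 2 by ring]
    refine mul_le_of_le_one_right (by positivity) (Real.exp_le_one_iff.2 ?_)
    exact div_nonpos_of_nonpos_of_nonneg (by simp [sq_nonneg]) (by positivity)
  calc _ ≤ ∫ _ in Set.Icc (-(2 * δ)) (2 * δ), 1 / √(4 * Real.pi * ℓ ^ 2) :=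
        setIntegral_mono (integrable_gaussianPDFReal _ _).integrableOn
          (integrableOn_const (by simp)) h2
    _ = 4 / √(4 * Real.pi * ℓ ^ 2) * δ := by
      rw [setIntegral_const, Real.volume_real_Icc_of_le (by linarith), smul_eq_mul]; ring

lemma abs_integral_accSlope_sub_le {ℓ : ℝ} (hℓ : 0 < ℓ) {δ : ℝ} (hδ : 0 < δ) (hδ1 : δ ≤ 1) :
    |∫ z, accSlope δ z ∂(limitLaw ℓ) - beta ℓ / 2| ≤ (1 + 4 / √(4 * Real.pi * ℓ ^ 2)) * δ := by
  have i1 : Integrable (accSlope δ) (limitLaw ℓ) :=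
    integrable_of_bounded (continuous_accSlope δ).measurable (c := 1) fun z => by
      rw [abs_of_nonneg (accSlope_nonneg hδ _)]; exact accSlope_le_one hδ _
  have i2 : Integrable accDeriv (limitLaw ℓ) :=
    integrable_of_bounded measurable_accDeriv abs_accDeriv_le
  have i3 : Integrable (bump δ) (limitLaw ℓ) :=
    integrable_of_bounded (continuous_bump δ).measurable (c := 1) fun z => by
      rw [abs_of_nonneg (bump_nonneg _ _)]; exact bump_le_one _ _
  rw [← integral_accDeriv hℓ, ← integral_sub i1 i2]
  calc _ ≤ ∫ z, |accSlope δ z - accDeriv z| ∂(limitLaw ℓ) := abs_integral_le_integral_abs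
    _ ≤ ∫ z, (δ + bump δ z) ∂(limitLaw ℓ) :=
      integral_mono (i1.sub i2).abs ((integrable_const δ).add i3) fun z => by
        simp only
        rw [abs_sub_comm]; exact abs_accDeriv_sub_accSlope_le hδ hδ1 z
    _ ≤ _ := by
      rw [integral_add (integrable_const δ) i3]
      simp only [integral_const, probReal_univ, one_smul]
      linarith [integral_bump_le hℓ hδ]

end

end RWM

namespace RWM

noncomputable section

/-! ### Standard Gaussian vectors -/

/-- The standard Gaussian measure on `ℝ^N`. -/
abbrev stdPi (N : ℕ) : Measure (Fin N → ℝ) := Measure.pi fun _ => gaussianReal 0 1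

/-- The fourth moment of the standard normal distribution. -/
def gaussM4 : ℝ := ∫ z, z ^ 4 ∂(gaussianReal 0 1)

/-- The weighted square norm `∑ a_j u_j ^ 2`. -/
def wsq {N : ℕ} (a u : Fin N → ℝ) : ℝ := ∑ j, a j * u j ^ 2

lemma gaussM4_nonneg : 0 ≤ gaussM4 := integral_nonneg fun z => by positivity

lemma integrable_pow_gaussian (p : ℕ) : Integrable (fun z : ℝ => z ^ p) (gaussianReal 0 1) := by
  rcases eq_or_ne p 0 with rfl | hp
  · simp
  have h := (memLp_id_gaussianReal (μ := 0) (v := 1) (p : NNReal)).integrable_norm_rpow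
    (by simpa using hp) (by simp)
  rw [← integrable_norm_iff (by fun_prop)]
  simpa using h

lemma integral_sq_gaussian : ∫ z, z ^ 2 ∂(gaussianReal 0 1) = 1 := by
  have h := variance_fun_id_gaussianReal (μ := 0) (v := 1)
  rwa [variance_of_integral_eq_zero (by fun_prop) (by simp)] at h

variable {N : ℕ}

lemma integrable_eval_pow (i : Fin N) (p : ℕ) : Integrable (fun ξ => ξ i ^ p) (stdPi N) :=
  integrable_comp_eval (μ := fun _ : Fin N => gaussianReal 0 1) (i := i)
    (f := fun z : ℝ => z ^ p) (integrable_pow_gaussian p)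

lemma integral_eval_pow (i : Fin N) (p : ℕ) :
    ∫ ξ, ξ i ^ p ∂(stdPi N) = ∫ z, z ^ p ∂(gaussianReal 0 1) :=
  integral_comp_eval (μ := fun _ : Fin N => gaussianReal 0 1) (i := i) (f := fun z : ℝ => z ^ p)
    (by fun_prop)

lemma integral_eval_one (i : Fin N) : ∫ ξ, ξ i ∂(stdPi N) = 0 := by
  have := integral_eval_pow i 1
  simpa using this

lemma integral_eval_two (i : Fin N) : ∫ ξ, ξ i ^ 2 ∂(stdPi N) = 1 := by
  rw [integral_eval_pow, integral_sq_gaussian]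

lemma integral_eval_four (i : Fin N) : ∫ ξ, ξ i ^ 4 ∂(stdPi N) = gaussM4 := integral_eval_pow i 4

lemma wsq_nonneg {a : Fin N → ℝ} (ha : ∀ j, 0 ≤ a j) (u : Fin N → ℝ) : 0 ≤ wsq a u :=
  Finset.sum_nonneg fun j _ => mul_nonneg (ha j) (sq_nonneg _)

lemma continuous_wsq (a : Fin N → ℝ) : Continuous (wsq a) := by unfold wsq; fun_prop

lemma integrable_wsq (a : Fin N → ℝ) : Integrable (wsq a) (stdPi N) :=
  integrable_finsetSum _ fun j _ => (integrable_eval_pow j 2).const_mul (a j)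

lemma integral_wsq (a : Fin N → ℝ) : ∫ ξ, wsq a ξ ∂(stdPi N) = ∑ j, a j := by
  unfold wsq
  rw [integral_finsetSum _ fun j _ => (integrable_eval_pow j 2).const_mul (a j)]
  exact Finset.sum_congr rfl fun j _ => by rw [integral_const_mul, integral_eval_two, mul_one]

/-- Cauchy–Schwarz with respect to the weights `a`. It bounds second moments of `wsq` by `∑ a_j`
alone, with no dependence on the dimension. -/
lemma wsq_sq_le {a : Fin N → ℝ} (ha : ∀ j, 0 ≤ a j) (u : Fin N → ℝ) :
    wsq a u ^ 2 ≤ (∑ j, a j) * ∑ j, a j * u j ^ 4 :=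
  Finset.sum_sq_le_sum_mul_sum_of_sq_le_mul _ (fun j _ => ha j)
    (fun j _ => mul_nonneg (ha j) (by positivity)) fun j _ => by ring_nf; rfl

lemma integrable_wsq_sq {a : Fin N → ℝ} (ha : ∀ j, 0 ≤ a j) :
    Integrable (fun ξ => wsq a ξ ^ 2) (stdPi N) := by
  refine Integrable.mono' ((integrable_finsetSum Finset.univ fun j _ =>
    (integrable_eval_pow j 4).const_mul (a j)).const_mul (∑ j, a j))
    ((continuous_wsq a).pow 2).aestronglyMeasurable (ae_of_all _ fun ξ => ?_)
  rw [Real.norm_of_nonneg (sq_nonneg _)]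
  exact wsq_sq_le ha ξ

lemma integral_wsq_sq_le {a : Fin N → ℝ} (ha : ∀ j, 0 ≤ a j) :
    ∫ ξ, wsq a ξ ^ 2 ∂(stdPi N) ≤ gaussM4 * (∑ j, a j) ^ 2 := by
  have hi : Integrable (fun ξ : Fin N → ℝ => ∑ j, a j * ξ j ^ 4) (stdPi N) :=
    integrable_finsetSum _ fun j _ => (integrable_eval_pow j 4).const_mul (a j)
  calc _ ≤ ∫ ξ, (∑ j, a j) * ∑ j, a j * ξ j ^ 4 ∂(stdPi N) :=
        integral_mono (integrable_wsq_sq ha) (hi.const_mul _) fun ξ => wsq_sq_le ha ξ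
    _ = gaussM4 * (∑ j, a j) ^ 2 := by
      rw [integral_const_mul, integral_finsetSum _ fun j _ =>
        (integrable_eval_pow j 4).const_mul (a j)]
      simp_rw [integral_const_mul, integral_eval_four, ← Finset.sum_mul]
      ring

/-- Normalised fluctuation of the squared Euclidean norm. -/
def fluct (u : Fin N → ℝ) : ℝ := (∑ j, u j ^ 2) / N - 1

lemma continuous_fluct : Continuous (fluct : (Fin N → ℝ) → ℝ) := by unfold fluct; fun_prop

lemma memLp_sq_gaussian : MemLp (fun z : ℝ => z ^ 2) 2 (gaussianReal 0 1) := by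
  rw [memLp_two_iff_integrable_sq (by fun_prop)]
  simpa [← pow_mul] using integrable_pow_gaussian 4

lemma memLp_fluct : MemLp (fluct : (Fin N → ℝ) → ℝ) 2 (stdPi N) := by
  have h : MemLp (fun ξ : Fin N → ℝ => ∑ j, ξ j ^ 2) 2 (stdPi N) :=
    memLp_finsetSum _ fun j _ => memLp_sq_gaussian.comp_measurePreserving
      (measurePreserving_eval (fun _ : Fin N => gaussianReal 0 1) j)
  have := (h.mul_const ((N : ℝ)⁻¹)).sub (memLp_const 1)
  exact this.congr_norm continuous_fluct.aestronglyMeasurable (ae_of_all _ fun ξ => by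
    simp [fluct, div_eq_mul_inv])

lemma integrable_fluct_sq : Integrable (fun ξ : Fin N → ℝ => fluct ξ ^ 2) (stdPi N) :=
  memLp_fluct.integrable_sq

/-- Law of large numbers in `L²`: the variance of a sum of independent `ξ_j²` is at most `N *
gaussM4`, and it is divided by `N²`. -/
lemma integral_fluct_sq_le (hN : 0 < N) :
    ∫ ξ : Fin N → ℝ, fluct ξ ^ 2 ∂(stdPi N) ≤ gaussM4 / N := by
  have hN' : (0 : ℝ) < N := by exact_mod_cast hN
  have h1 : ∫ ξ, (∑ j, ξ j ^ 2) ∂(stdPi N) = N := by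
    rw [integral_finsetSum _ fun j _ => integrable_eval_pow j 2]
    simp [integral_eval_two]
  have h2 := variance_sum_pi (μ := fun _ : Fin N => gaussianReal 0 1)
    (X := fun _ z => z ^ 2) fun _ => memLp_sq_gaussian
  have h3 : Var[fun z : ℝ => z ^ 2; gaussianReal 0 1] ≤ gaussM4 := by
    refine (variance_le_expectation_sq (by fun_prop)).trans_eq ?_
    simp [gaussM4, ← pow_mul]
  have h4 : ∫ ξ : Fin N → ℝ, (∑ j, ξ j ^ 2 - N) ^ 2 ∂(stdPi N) ≤ N * gaussM4 := by
    have h5 : Var[∑ i, fun ω : Fin N → ℝ => ω i ^ 2; stdPi N] =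
        ∫ ξ : Fin N → ℝ, (∑ j, ξ j ^ 2 - N) ^ 2 ∂(stdPi N) := by
      rw [variance_eq_integral (by fun_prop)]
      simp only [Finset.sum_apply, h1]
    rw [← h5, h2]
    calc _ ≤ ∑ _i : Fin N, gaussM4 := Finset.sum_le_sum fun _ _ => h3
      _ = N * gaussM4 := by simp
  have h6 : ∀ ξ : Fin N → ℝ, fluct ξ ^ 2 = (N : ℝ)⁻¹ ^ 2 * (∑ j, ξ j ^ 2 - N) ^ 2 := by
    intro ξ; unfold fluct; field_simp
  simp_rw [h6]
  rw [integral_const_mul]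
  calc _ ≤ (N : ℝ)⁻¹ ^ 2 * (N * gaussM4) := by gcongr
    _ = gaussM4 / N := by field_simp

lemma integral_abs_fluct_le (hN : 0 < N) :
    ∫ ξ : Fin N → ℝ, |fluct ξ| ∂(stdPi N) ≤ √(gaussM4 / N) := by
  refine Real.le_sqrt_of_sq_le ((?_ : _ ≤ _).trans (integral_fluct_sq_le hN))
  -- Jensen's inequality, in the form that the variance of `|fluct|` is nonnegative.
  have h := variance_nonneg |(fluct : (Fin N → ℝ) → ℝ)| (stdPi N)
  rw [variance_eq_sub memLp_fluct.abs] at h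
  simpa using h

/-- The updated vector is a function of the coordinates other than `i`. This independence lets `ξ i`
be integrated out separately in `integral_update_mul`. -/
lemma indepFun_update_eval (i : Fin N) :
    IndepFun (fun ξ : Fin N → ℝ => Function.update ξ i 0) (fun ξ => ξ i) (stdPi N) := by
  have h := (iIndepFun_pi (μ := fun _ : Fin N => gaussianReal 0 1) (X := fun _ z => z)
    fun _ => aemeasurable_id).indepFun_finset (Finset.univ.erase i) {i} (by simp)
    fun j => measurable_pi_apply j
  have hφ : Measurable fun (v : ↥(Finset.univ.erase i) → ℝ) (j : Fin N) =>
      if hj : j = i then (0 : ℝ) else v ⟨j, by simp [hj]⟩ := by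
    refine measurable_pi_lambda _ fun j => ?_
    by_cases hj : j = i
    · simp [hj]
    · simp only [hj, dite_false]; exact measurable_pi_apply _
  have hψ : Measurable fun v : ↥({i} : Finset (Fin N)) → ℝ => v ⟨i, by simp⟩ :=
    measurable_pi_apply _
  have h' := h.comp hφ hψ
  convert h' using 1
  · ext ξ j
    by_cases hj : j = i
    · subst hj; simp
    · simp [hj]
  · rfl

lemma integral_update_mul {f : (Fin N → ℝ) → ℝ} (hf : Measurable f) {h : ℝ → ℝ}
    (hh : Measurable h) (i : Fin N) :
    ∫ ξ, f (Function.update ξ i 0) * h (ξ i) ∂(stdPi N) =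
      (∫ ξ, f (Function.update ξ i 0) ∂(stdPi N)) * ∫ z, h z ∂(gaussianReal 0 1) := by
  rw [(indepFun_update_eval i).integral_fun_comp_mul_comp (by fun_prop)
    (measurable_pi_apply i).aemeasurable
    hf.aestronglyMeasurable hh.aestronglyMeasurable]
  congr 1
  exact integral_comp_eval (μ := fun _ : Fin N => gaussianReal 0 1) (i := i) (f := h)
    hh.aestronglyMeasurable

lemma hasGaussianLaw_stdPi : HasGaussianLaw (fun ξ : Fin N → ℝ => (fun i => ξ i)) (stdPi N) := by
  refine iIndepFun.hasGaussianLaw (X := fun i (ξ : Fin N → ℝ) => ξ i) (fun i => ?_)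
    (iIndepFun_pi (X := fun _ z => z) fun _ => aemeasurable_id)
  exact ⟨by
    rw [(measurePreserving_eval (fun _ : Fin N => gaussianReal 0 1) i).map_eq]; infer_instance⟩

lemma map_linear_stdPi (ζ : Fin N → ℝ) :
    (stdPi N).map (fun ξ => ∑ j, ζ j * ξ j) = gaussianReal 0 (∑ j, ζ j ^ 2).toNNReal := by
  have h := (hasGaussianLaw_stdPi (N := N)).map_fun (∑ j, ζ j • ContinuousLinearMap.proj j)
  have h1 : (fun ξ : Fin N → ℝ => (∑ j, ζ j • ContinuousLinearMap.proj (R := ℝ) j :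
      (Fin N → ℝ) →L[ℝ] ℝ) (fun i => ξ i)) = fun ξ => ∑ j, ζ j * ξ j := by
    ext ξ; simp
  rw [h1] at h
  rw [h.map_eq_gaussianReal]
  congr 2
  · rw [integral_finsetSum _ fun j _ => by
      simpa using (integrable_eval_pow j 1).const_mul (ζ j)]
    simp [integral_const_mul, integral_eval_one]
  · have h2 := variance_sum_pi (μ := fun _ : Fin N => gaussianReal 0 1)
      (X := fun j z => ζ j * z) fun j => (memLp_id_gaussianReal 2).const_mul (ζ j)
    have h3 : (∑ i, fun ω : Fin N → ℝ => ζ i * ω i) = fun ξ => ∑ j, ζ j * ξ j := by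
      ext; simp
    rw [h3] at h2
    rw [h2]
    exact Finset.sum_congr rfl fun j _ => by rw [variance_const_mul]; simp

end

end RWM

namespace RWM

noncomputable section

/-! ### The acceptance ratio in coordinates -/

/-- A potential `V` on `ℝ^N` with gradient `G`, controlled in the weighted norm given by `a`. -/
structure FinPotential {N : ℕ} (a : Fin N → ℝ) (V : (Fin N → ℝ) → ℝ)
    (G : (Fin N → ℝ) → Fin N → ℝ) (B S : ℝ) : Prop where
  weight_nonneg : ∀ j, 0 ≤ a j
  sum_le : ∑ j, a j ≤ S
  const_nonneg : 0 ≤ B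
  continuous : Continuous V
  grad_le : ∀ X j, |G X j| ≤ B * (1 + √(wsq a X)) * √(a j)
  taylor_le : ∀ X u v, |V (X + u) - V (X + v) - ∑ j, G X j * (u j - v j)| ≤
    B * (√(wsq a u) + √(wsq a v)) * √(wsq a (u - v))

/-- The log acceptance ratio for a proposal `X + τ ξ`, with Gaussian reference measure and
potential `V`. -/
def finQ {N : ℕ} (V : (Fin N → ℝ) → ℝ) (τ : ℝ) (X ξ : Fin N → ℝ) : ℝ :=
  1 / 2 * ∑ j, X j ^ 2 - 1 / 2 * ∑ j, (X j + τ * ξ j) ^ 2 + V X - V (X + τ • ξ)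

variable {N : ℕ} {a : Fin N → ℝ} {V : (Fin N → ℝ) → ℝ} {G : (Fin N → ℝ) → Fin N → ℝ} {B S : ℝ}

lemma FinPotential.sum_nonneg (h : FinPotential a V G B S) : 0 ≤ S :=
  (Finset.sum_nonneg fun j _ => h.weight_nonneg j).trans h.sum_le

lemma continuous_finQ (hV : Continuous V) (τ : ℝ) :
    Continuous fun p : (Fin N → ℝ) × (Fin N → ℝ) => finQ V τ p.1 p.2 := by
  unfold finQ
  have h : ∀ j, Continuous fun p : (Fin N → ℝ) × (Fin N → ℝ) => p.1 j := fun j =>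
    (continuous_apply j).comp continuous_fst
  have h' : ∀ j, Continuous fun p : (Fin N → ℝ) × (Fin N → ℝ) => p.2 j := fun j =>
    (continuous_apply j).comp continuous_snd
  fun_prop

lemma continuous_finQ_right (hV : Continuous V) (τ : ℝ) (X : Fin N → ℝ) :
    Continuous fun ξ => finQ V τ X ξ := by
  unfold finQ
  fun_prop

lemma wsq_smul (a : Fin N → ℝ) (τ : ℝ) (u : Fin N → ℝ) : wsq a (τ • u) = τ ^ 2 * wsq a u := by
  simp only [wsq, Pi.smul_apply, smul_eq_mul, Finset.mul_sum]
  exact Finset.sum_congr rfl fun j _ => by ring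

lemma sqrt_wsq_smul (a : Fin N → ℝ) {τ : ℝ} (hτ : 0 ≤ τ) (u : Fin N → ℝ) :
    √(wsq a (τ • u)) = τ * √(wsq a u) := by
  rw [wsq_smul, Real.sqrt_mul (sq_nonneg τ), Real.sqrt_sq hτ]

/-- Expanding the square cancels `∑ X_j²`, and the Taylor bound with second displacement `0`
controls the potential. The quadratic term is kept exact, since for `τ² = 2ℓ²/N` it equals `ℓ² (1 +
fluct ξ)` and supplies the mean `-ℓ²` of the limit. -/
lemma abs_finQ_add_le (h : FinPotential a V G B S) (τ : ℝ) (X ξ : Fin N → ℝ) :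
    |finQ V τ X ξ + τ * ∑ j, (X j + G X j) * ξ j + τ ^ 2 / 2 * ∑ j, ξ j ^ 2| ≤
      B * τ ^ 2 * wsq a ξ := by
  have h1 := h.taylor_le X (τ • ξ) 0
  have h0 : wsq a 0 = 0 := by simp [wsq]
  rw [add_zero, sub_zero, h0, Real.sqrt_zero, add_zero, mul_assoc,
    Real.mul_self_sqrt (wsq_nonneg h.weight_nonneg _), wsq_smul, abs_sub_comm, abs_sub_comm] at h1
  have h2 : finQ V τ X ξ + τ * ∑ j, (X j + G X j) * ξ j + τ ^ 2 / 2 * ∑ j, ξ j ^ 2 =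
      -(V (X + τ • ξ) - V X - ∑ j, G X j * ((τ • ξ) j - (0 : Fin N → ℝ) j)) := by
    have h3 : ∑ j, (X j + τ * ξ j) ^ 2 =
        ∑ j, X j ^ 2 + 2 * τ * ∑ j, X j * ξ j + τ ^ 2 * ∑ j, ξ j ^ 2 := by
      simp only [Finset.mul_sum, ← Finset.sum_add_distrib]
      exact Finset.sum_congr rfl fun j _ => by ring
    have h4 : ∑ j, (X j + G X j) * ξ j = ∑ j, X j * ξ j + ∑ j, G X j * ξ j := by
      simp only [← Finset.sum_add_distrib]
      exact Finset.sum_congr rfl fun j _ => by ring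
    have h5 : ∑ j, G X j * ((τ • ξ) j - (0 : Fin N → ℝ) j) = τ * ∑ j, G X j * ξ j := by
      simp only [Finset.mul_sum]
      exact Finset.sum_congr rfl fun j _ => by simp; ring
    rw [finQ, h3, h4, h5]
    ring
  rw [h2, abs_neg]
  linarith

lemma wsq_update_le (ha : ∀ j, 0 ≤ a j) (ξ : Fin N → ℝ) (i : Fin N) :
    wsq a (Function.update ξ i 0) ≤ wsq a ξ := by
  refine Finset.sum_le_sum fun j _ => mul_le_mul_of_nonneg_left ?_ (ha j)
  by_cases hj : j = i
  · subst hj; simpa using sq_nonneg _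
  · simp [hj]

lemma wsq_sub_update_le (ha : ∀ j, 0 ≤ a j) (ξ : Fin N → ℝ) (i : Fin N) :
    wsq a (ξ - Function.update ξ i 0) ≤ wsq a ξ := by
  refine Finset.sum_le_sum fun j _ => mul_le_mul_of_nonneg_left ?_ (ha j)
  by_cases hj : j = i
  · subst hj; simp
  · simpa [hj] using sq_nonneg _

/-- Effect on the log acceptance ratio of removing one coordinate of the noise. -/
lemma abs_finQ_sub_update_le (h : FinPotential a V G B S) {τ : ℝ} (hτ : 0 ≤ τ) (X ξ : Fin N → ℝ)
    (i : Fin N) :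
    |finQ V τ X ξ - finQ V τ X (Function.update ξ i 0) + τ * (X i + G X i) * ξ i| ≤
      τ ^ 2 * (ξ i ^ 2 / 2 + 2 * B * wsq a ξ) := by
  set ξ' := Function.update ξ i 0 with hξ'
  have ha := h.weight_nonneg
  have hB := h.const_nonneg
  have hdiff : ∀ j, j ≠ i → ξ' j = ξ j := fun j hj => by simp [hξ', hj]
  have hi : ξ' i = 0 := by simp [hξ']
  have h1 := h.taylor_le X (τ • ξ) (τ • ξ')
  rw [← smul_sub, sqrt_wsq_smul a hτ, sqrt_wsq_smul a hτ, sqrt_wsq_smul a hτ] at h1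
  have e1 := Real.sqrt_le_sqrt (wsq_update_le ha ξ i)
  have e2 := Real.sqrt_le_sqrt (wsq_sub_update_le ha ξ i)
  have h2 : B * (τ * √(wsq a ξ) + τ * √(wsq a ξ')) * (τ * √(wsq a (ξ - ξ'))) ≤
      2 * B * τ ^ 2 * wsq a ξ := by
    calc _ ≤ B * (τ * √(wsq a ξ) + τ * √(wsq a ξ)) * (τ * √(wsq a ξ)) := by gcongr
      _ = 2 * B * τ ^ 2 * (√(wsq a ξ) * √(wsq a ξ)) := by ring
      _ = _ := by rw [Real.mul_self_sqrt (wsq_nonneg ha _)]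
  have h3 : ∑ j, G X j * ((τ • ξ) j - (τ • ξ') j) = τ * G X i * ξ i := by
    rw [Finset.sum_eq_single i (fun j _ hj => by simp [hdiff j hj]) (by simp)]
    simp [hi]; ring
  have h4 : ∑ j, (X j + τ * ξ j) ^ 2 - ∑ j, (X j + τ * ξ' j) ^ 2 =
      2 * τ * X i * ξ i + τ ^ 2 * ξ i ^ 2 := by
    rw [← Finset.sum_sub_distrib,
      Finset.sum_eq_single i (fun j _ hj => by simp [hdiff j hj]) (by simp)]
    simp only [hi]; ring
  have h5 : finQ V τ X ξ - finQ V τ X ξ' + τ * (X i + G X i) * ξ i =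
      -(V (X + τ • ξ) - V (X + τ • ξ') - ∑ j, G X j * ((τ • ξ) j - (τ • ξ') j)) -
        τ ^ 2 * ξ i ^ 2 / 2 := by
    rw [h3]; unfold finQ; linear_combination (-1 / 2 : ℝ) * h4
  rw [h5]
  refine (abs_sub _ _).trans ?_
  rw [abs_neg, abs_of_nonneg (show 0 ≤ τ ^ 2 * ξ i ^ 2 / 2 by positivity)]
  linarith

/-! ### Gaussian approximation of the log acceptance ratio -/

/-- Size of the deviation of the conditional law of the log acceptance ratio from its limit. -/
def devSize (a X : Fin N → ℝ) : ℝ := 1 + √(wsq a X) + √N * |fluct X|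

lemma one_le_devSize (a X : Fin N → ℝ) : 1 ≤ devSize a X := by
  unfold devSize
  have : 0 ≤ √(wsq a X) + √N * |fluct X| := by positivity
  linarith

lemma abs_sqrt_sum_sq_sub_le (u v : Fin N → ℝ) :
    |√(∑ j, (u j + v j) ^ 2) - √(∑ j, u j ^ 2)| ≤ √(∑ j, v j ^ 2) := by
  have h := abs_norm_sub_norm_le (WithLp.toLp 2 (u + v)) (WithLp.toLp 2 u)
  rw [← WithLp.toLp_sub, add_sub_cancel_left] at h
  simpa [EuclideanSpace.norm_eq, sq_abs] using h

lemma FinPotential.sqrt_sum_grad_sq_le (h : FinPotential a V G B S) (X : Fin N → ℝ) :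
    √(∑ j, G X j ^ 2) ≤ B * √S * (1 + √(wsq a X)) := by
  have hB := h.const_nonneg
  refine Real.sqrt_le_iff.2 ⟨by positivity, ?_⟩
  have h1 : ∀ j, G X j ^ 2 ≤ (B * (1 + √(wsq a X))) ^ 2 * a j := by
    intro j
    rw [← sq_abs]
    calc _ ≤ (B * (1 + √(wsq a X)) * √(a j)) ^ 2 := by
          gcongr; exact h.grad_le X j
      _ = _ := by rw [mul_pow, Real.sq_sqrt (h.weight_nonneg j)]
  calc _ ≤ ∑ j, (B * (1 + √(wsq a X))) ^ 2 * a j := Finset.sum_le_sum fun j _ => h1 j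
    _ = (B * (1 + √(wsq a X))) ^ 2 * ∑ j, a j := by rw [Finset.mul_sum]
    _ ≤ (B * (1 + √(wsq a X))) ^ 2 * S := by gcongr; exact h.sum_le
    _ = (B * √S * (1 + √(wsq a X))) ^ 2 := by
      rw [mul_pow, mul_pow, mul_pow, Real.sq_sqrt h.sum_nonneg]; ring

/-- Controls the conditional standard deviation of the log acceptance ratio. The gradient moves the
norm of `X` only by a quantity bounded in the dimension, and for `t ≥ 0` one has `|t - 1| ≤ |t² -
1|`, which for `t = |X|/√N` is `|fluct X|`. -/
lemma abs_norm_div_sub_one_le (h : FinPotential a V G B S) (hN : 0 < N) (X : Fin N → ℝ) :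
    |√(∑ j, (X j + G X j) ^ 2) / √N - 1| ≤ (B * √S + 1) * devSize a X / √N := by
  have hB := h.const_nonneg
  have hN' : (0 : ℝ) < √N := Real.sqrt_pos.2 (by exact_mod_cast hN)
  have hNs : √(N : ℝ) * √N = N := Real.mul_self_sqrt (by positivity)
  have h1 := (abs_sqrt_sum_sq_sub_le X (G X)).trans (h.sqrt_sum_grad_sq_le X)
  have h2 : |√(∑ j, X j ^ 2) / √N - 1| ≤ |fluct X| := by
    set t := √(∑ j, X j ^ 2) / √N
    have ht : 0 ≤ t := by positivity
    have : fluct X = (t - 1) * (t + 1) := by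
      have : t ^ 2 = (∑ j, X j ^ 2) / N := by
        rw [div_pow, Real.sq_sqrt (Finset.sum_nonneg fun _ _ => sq_nonneg _),
          Real.sq_sqrt (by positivity)]
      rw [fluct, ← this]; ring
    rw [this, abs_mul, abs_of_nonneg (show 0 ≤ t + 1 by linarith)]
    exact le_mul_of_one_le_right (abs_nonneg _) (by linarith)
  have h3 : |√(∑ j, (X j + G X j) ^ 2) / √N - 1| ≤
      |√(∑ j, (X j + G X j) ^ 2) - √(∑ j, X j ^ 2)| / √N + |√(∑ j, X j ^ 2) / √N - 1| := by
    rw [← abs_of_pos hN', ← abs_div, abs_of_pos hN']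
    refine le_trans (le_of_eq ?_) (abs_add_le _ _)
    congr 1; ring
  have h4 : |fluct X| = √N * |fluct X| / √N := by field_simp
  refine h3.trans ?_
  calc _ ≤ B * √S * (1 + √(wsq a X)) / √N + √N * |fluct X| / √N := by
        rw [← h4]; gcongr
    _ = (B * √S * (1 + √(wsq a X)) + √N * |fluct X|) / √N := by ring
    _ ≤ _ := by
      gcongr
      unfold devSize
      have h5 : 0 ≤ B * √S := by positivity
      have h6 : 0 ≤ √N * |fluct X| := by positivity
      have h7 : 0 ≤ √(wsq a X) := by positivity
      nlinarith [mul_nonneg h5 h6]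

lemma integral_abs_gaussian_le : ∫ z, |z| ∂(gaussianReal 0 1) ≤ 1 := by
  have h1 := integrable_pow_gaussian 1
  simp only [pow_one] at h1
  calc _ ≤ ∫ z, (1 / 2 + 1 / 2 * z ^ 2) ∂(gaussianReal 0 1) :=
        integral_mono h1.abs ((integrable_const _).add ((integrable_pow_gaussian 2).const_mul _))
          fun z => by
            simp only
            nlinarith [sq_nonneg (|z| - 1), sq_abs z]
    _ = 1 := by
      rw [integral_add (integrable_const _) ((integrable_pow_gaussian 2).const_mul _),
        integral_const_mul, integral_sq_gaussian]
      simp; norm_num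

lemma integrable_comp_of_bounded {α : Type*} [MeasurableSpace α] {μ : Measure α}
    [IsFiniteMeasure μ] {F : ℝ → ℝ} (hF : Continuous F) {M : ℝ} (hM : ∀ q, |F q| ≤ M)
    {f : α → ℝ} (hf : Measurable f) : Integrable (fun x => F (f x)) μ :=
  integrable_of_bounded (hF.measurable.comp hf) fun x => hM (f x)

lemma abs_integral_finQ_sub_le (h : FinPotential a V G B S) (hN : 0 < N) {ℓ : ℝ} (hℓ : 0 < ℓ)
    (X : Fin N → ℝ) {F : ℝ → ℝ} (hF : Continuous F) {M : ℝ} (hM : ∀ q, |F q| ≤ M) {L : ℝ}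
    (hL : 0 ≤ L) (hFL : ∀ p q, |F p - F q| ≤ L * |p - q|) :
    |∫ ξ, F (finQ V √(2 * ℓ ^ 2 / N) X ξ) ∂(stdPi N) - ∫ z, F z ∂(limitLaw ℓ)| ≤
      L * ((ℓ ^ 2 * √gaussM4 + 2 * ℓ ^ 2 * B * S + √2 * ℓ * (B * √S + 1)) *
        (devSize a X / √N)) := by
  set τ := √(2 * ℓ ^ 2 / N) with hτ
  have hB := h.const_nonneg
  have hS := h.sum_nonneg
  have hN1 : (1 : ℝ) ≤ N := by exact_mod_cast hN
  have hN0 : (0 : ℝ) < N := by linarith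
  have hsN : (0 : ℝ) < √N := Real.sqrt_pos.2 hN0
  have hsN1 : 1 ≤ √(N : ℝ) := Real.one_le_sqrt.2 hN1
  have hNs : √(N : ℝ) * √N = N := Real.mul_self_sqrt hN0.le
  have hτ0 : 0 ≤ τ := Real.sqrt_nonneg _
  have hτ2 : τ ^ 2 = 2 * ℓ ^ 2 / N := Real.sq_sqrt (by positivity)
  have hτ' : τ = √2 * ℓ / √N := by
    rw [hτ, Real.sqrt_div (by positivity), Real.sqrt_mul (by norm_num), Real.sqrt_sq hℓ.le]
  have hD := one_le_devSize a X
  set ζ : Fin N → ℝ := fun j => X j + G X j with hζ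
  -- At fixed `X` this linearisation is exactly Gaussian, with mean `-ℓ²` and variance `τ² |ζ|²`.
  set lin : (Fin N → ℝ) → ℝ := fun ξ => -ℓ ^ 2 + -τ * ∑ j, ζ j * ξ j with hlin
  have hlin_m : Measurable lin := by
    have : Continuous lin := by rw [hlin]; fun_prop
    exact this.measurable
  have hQm := (continuous_finQ_right h.continuous τ X).measurable
  have hc := hF
  have hb := hM
  have s1 : |∫ ξ, F (finQ V τ X ξ) ∂(stdPi N) - ∫ ξ, F (lin ξ) ∂(stdPi N)| ≤
      L * (ℓ ^ 2 * √(gaussM4 / N) + B * τ ^ 2 * S) := by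
    have i1 := integrable_comp_of_bounded (μ := stdPi N) hc hb hQm
    have i2 := integrable_comp_of_bounded (μ := stdPi N) hc hb hlin_m
    have i3 : Integrable (fun ξ : Fin N → ℝ => |fluct ξ|) (stdPi N) :=
      (memLp_fluct.integrable (by norm_num)).abs
    have i4 : Integrable (fun ξ : Fin N → ℝ => L * (ℓ ^ 2 * |fluct ξ| + B * τ ^ 2 * wsq a ξ))
        (stdPi N) :=
      ((i3.const_mul _).add ((integrable_wsq a).const_mul _)).const_mul _
    rw [← integral_sub i1 i2]
    refine abs_integral_le_integral_abs.trans ((integral_mono (i1.sub i2).abs i4 fun ξ => ?_).trans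
      ?_)
    · refine (hFL _ _).trans (mul_le_mul_of_nonneg_left ?_ hL)
      have := abs_finQ_add_le h τ X ξ
      have e : finQ V τ X ξ - lin ξ = (finQ V τ X ξ + τ * ∑ j, (X j + G X j) * ξ j +
          τ ^ 2 / 2 * ∑ j, ξ j ^ 2) - ℓ ^ 2 * fluct ξ := by
        simp only [hlin, hζ, hτ2, fluct]; ring
      rw [e]
      refine (abs_sub _ _).trans ?_
      rw [abs_mul, abs_of_nonneg (sq_nonneg ℓ)]
      linarith
    · rw [integral_const_mul, integral_add (i3.const_mul _) ((integrable_wsq a).const_mul _),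
        integral_const_mul, integral_const_mul, integral_wsq]
      gcongr
      · exact integral_abs_fluct_le hN
      · exact h.sum_le
  set n := √(∑ j, ζ j ^ 2) with hn
  have hs0 : 0 ≤ ∑ j, ζ j ^ 2 := Finset.sum_nonneg fun _ _ => sq_nonneg _
  have hlaw : (stdPi N).map lin = (gaussianReal 0 1).map fun z => -ℓ ^ 2 + τ * n * z := by
    have : lin = (fun z => -ℓ ^ 2 + z) ∘ (fun z => -τ * z) ∘ fun ξ => ∑ j, ζ j * ξ j := rfl
    rw [this, ← Measure.map_map (by fun_prop) (by fun_prop),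
      ← Measure.map_map (by fun_prop) (Continuous.measurable (by fun_prop)), map_linear_stdPi,
      gaussianReal_map_const_mul, gaussianReal_map_const_add, map_affine_stdGaussian]
    congr 1
    · ring
    · ext
      simp only [NNReal.coe_mul, NNReal.coe_mk]
      rw [Real.coe_toNNReal _ hs0, Real.coe_toNNReal _ (sq_nonneg _), mul_pow, hn,
        Real.sq_sqrt hs0]
      ring
  have hlim : limitLaw ℓ = (gaussianReal 0 1).map fun z => -ℓ ^ 2 + √2 * ℓ * z := by
    rw [map_affine_stdGaussian, limitLaw, mul_pow, Real.sq_sqrt (by norm_num)]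
  -- Both Gaussians have mean `-ℓ²` and are affine images of one standard normal `z`; this coupling
  -- costs the difference of standard deviations times `E|z| ≤ 1`.
  have s2 : |∫ ξ, F (lin ξ) ∂(stdPi N) - ∫ z, F z ∂(limitLaw ℓ)| ≤
      L * (√2 * ℓ * |n / √N - 1|) := by
    have e1 : ∫ ξ, F (lin ξ) ∂(stdPi N) = ∫ z, F (-ℓ ^ 2 + τ * n * z) ∂(gaussianReal 0 1) := by
      rw [← integral_map hlin_m.aemeasurable hc.aestronglyMeasurable, hlaw,
        integral_map (by fun_prop) hc.aestronglyMeasurable]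
    have e2 : ∫ z, F z ∂(limitLaw ℓ) = ∫ z, F (-ℓ ^ 2 + √2 * ℓ * z) ∂(gaussianReal 0 1) := by
      rw [hlim, integral_map (by fun_prop) hc.aestronglyMeasurable]
    have i1 : Integrable (fun z => F (-ℓ ^ 2 + τ * n * z)) (gaussianReal 0 1) :=
      integrable_comp_of_bounded hc hb (by fun_prop)
    have i2 : Integrable (fun z => F (-ℓ ^ 2 + √2 * ℓ * z)) (gaussianReal 0 1) :=
      integrable_comp_of_bounded hc hb (by fun_prop)
    have i3 : Integrable (fun z : ℝ => |z|) (gaussianReal 0 1) := by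
      simpa using (integrable_pow_gaussian 1).abs
    rw [e1, e2, ← integral_sub i1 i2]
    refine abs_integral_le_integral_abs.trans ((integral_mono (i1.sub i2).abs
      (i3.const_mul (L * (√2 * ℓ * |n / √N - 1|))) fun z => ?_).trans ?_)
    · refine (hFL _ _).trans (le_of_eq ?_)
      have : -ℓ ^ 2 + τ * n * z - (-ℓ ^ 2 + √2 * ℓ * z) = √2 * ℓ * (n / √N - 1) * z := by
        rw [hτ']; ring
      rw [this, abs_mul, abs_mul, abs_of_nonneg (show 0 ≤ √2 * ℓ by positivity)]
      ring
    · rw [integral_const_mul]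
      exact mul_le_of_le_one_right (by positivity) integral_abs_gaussian_le
  have s3 := abs_norm_div_sub_one_le h hN X
  have s4 : √(gaussM4 / N) ≤ √gaussM4 * (devSize a X / √N) := by
    rw [Real.sqrt_div gaussM4_nonneg, div_eq_mul_one_div]
    gcongr
  have s5 : (1 : ℝ) / N ≤ devSize a X / √N := by
    rw [div_le_div_iff₀ hN0 hsN]
    nlinarith
  calc _ ≤ |∫ ξ, F (finQ V τ X ξ) ∂(stdPi N) - ∫ ξ, F (lin ξ) ∂(stdPi N)| +
        |∫ ξ, F (lin ξ) ∂(stdPi N) - ∫ z, F z ∂(limitLaw ℓ)| := abs_sub_le _ _ _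
    _ ≤ L * (ℓ ^ 2 * √(gaussM4 / N) + B * τ ^ 2 * S) + L * (√2 * ℓ * |n / √N - 1|) :=
      add_le_add s1 s2
    _ = L * (ℓ ^ 2 * √(gaussM4 / N) + 2 * ℓ ^ 2 * B * S * (1 / N) + √2 * ℓ * |n / √N - 1|) := by
      rw [hτ2]; ring
    _ ≤ L * (ℓ ^ 2 * (√gaussM4 * (devSize a X / √N)) + 2 * ℓ ^ 2 * B * S * (devSize a X / √N) +
        √2 * ℓ * ((B * √S + 1) * devSize a X / √N)) := by gcongr
    _ = _ := by ring

end

end RWM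

namespace RWM

noncomputable section

variable {N : ℕ} {a : Fin N → ℝ} {V : (Fin N → ℝ) → ℝ} {G : (Fin N → ℝ) → Fin N → ℝ} {B S : ℝ}

/-! ### Conditional moments of an accepted move -/

/-- A polynomial dominating the moments of two coordinates of the noise. -/
def noiseDom (a : Fin N → ℝ) (i j : Fin N) (ξ : Fin N → ℝ) : ℝ :=
  1 + ξ i ^ 4 + ξ j ^ 4 + wsq a ξ ^ 2

lemma one_le_noiseDom (a : Fin N → ℝ) (i j : Fin N) (ξ : Fin N → ℝ) : 1 ≤ noiseDom a i j ξ := by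
  unfold noiseDom
  have : 0 ≤ ξ i ^ 4 + ξ j ^ 4 + wsq a ξ ^ 2 := by positivity
  linarith

lemma integrable_noiseDom (ha : ∀ j, 0 ≤ a j) (i j : Fin N) :
    Integrable (noiseDom a i j) (stdPi N) :=
  (((integrable_const 1).add (integrable_eval_pow i 4)).add (integrable_eval_pow j 4)).add
    (integrable_wsq_sq ha)

/-- A bound for the mean of `noiseDom`. -/
def noiseDomMean (S : ℝ) : ℝ := 1 + 2 * gaussM4 + gaussM4 * S ^ 2

lemma noiseDomMean_nonneg (S : ℝ) : 0 ≤ noiseDomMean S := by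
  have := gaussM4_nonneg
  unfold noiseDomMean
  positivity

lemma integral_noiseDom_le (h : FinPotential a V G B S) (i j : Fin N) :
    ∫ ξ, noiseDom a i j ξ ∂(stdPi N) ≤ noiseDomMean S := by
  have ha := h.weight_nonneg
  have i1 : Integrable (fun ξ : Fin N → ℝ => 1 + ξ i ^ 4) (stdPi N) :=
    (integrable_const 1).add (integrable_eval_pow i 4)
  have i2 : Integrable (fun ξ : Fin N → ℝ => 1 + ξ i ^ 4 + ξ j ^ 4) (stdPi N) :=
    i1.add (integrable_eval_pow j 4)
  unfold noiseDom
  rw [integral_add i2 (integrable_wsq_sq ha), integral_add i1 (integrable_eval_pow j 4),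
    integral_add (integrable_const 1) (integrable_eval_pow i 4), integral_eval_four,
    integral_eval_four]
  have h1 : gaussM4 * (∑ j, a j) ^ 2 ≤ gaussM4 * S ^ 2 := by
    have := gaussM4_nonneg
    have := Finset.sum_nonneg fun j (_ : j ∈ Finset.univ) => ha j
    gcongr
    exact h.sum_le
  have := integral_wsq_sq_le ha
  simp only [integral_const, probReal_univ, one_smul, noiseDomMean]
  linarith

/-- The majorant `1 + ξ_i² + ξ_j²` covers every factor `p` needed later: `1`, `|ξ_i|` and `|ξ_i
ξ_j|`. Products of quadratic quantities are then absorbed by `noiseDom`, of degree four. -/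
lemma abs_sub_update_mul_le (h : FinPotential a V G B S) {τ : ℝ} (hτ : 0 ≤ τ)
    (X ξ : Fin N → ℝ) (i j : Fin N) {p : ℝ} (hp0 : 0 ≤ p) (hp : p ≤ 1 + ξ i ^ 2 + ξ j ^ 2) :
    |finQ V τ X ξ - finQ V τ X (Function.update ξ i 0) + τ * (X i + G X i) * ξ i| * p ≤
      4 * (1 + B) * τ ^ 2 * noiseDom a i j ξ := by
  have hB := h.const_nonneg
  have hw := wsq_nonneg h.weight_nonneg ξ
  calc _ ≤ τ ^ 2 * (ξ i ^ 2 / 2 + 2 * B * wsq a ξ) * (1 + ξ i ^ 2 + ξ j ^ 2) := by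
        gcongr
        exact abs_finQ_sub_update_le h hτ X ξ i
    _ ≤ τ ^ 2 * ((1 + B) * (ξ i ^ 2 + 2 * wsq a ξ)) * (1 + ξ i ^ 2 + ξ j ^ 2) := by
        gcongr
        nlinarith [sq_nonneg (ξ i), mul_nonneg hB (sq_nonneg (ξ i))]
    _ = τ ^ 2 * (1 + B) * ((ξ i ^ 2 + 2 * wsq a ξ) * (1 + ξ i ^ 2 + ξ j ^ 2)) := by ring
    _ ≤ τ ^ 2 * (1 + B) * (4 * noiseDom a i j ξ) := by
        refine mul_le_mul_of_nonneg_left ?_ (by positivity)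
        unfold noiseDom
        nlinarith [sq_nonneg (ξ i ^ 2 + 2 * wsq a ξ - (1 + ξ i ^ 2 + ξ j ^ 2)),
          sq_nonneg (ξ i ^ 2 - 2 * wsq a ξ), sq_nonneg (1 - ξ i ^ 2), sq_nonneg (1 - ξ j ^ 2),
          sq_nonneg (ξ i ^ 2 - ξ j ^ 2), sq_nonneg (ξ j ^ 2)]
    _ = _ := by ring

lemma abs_eval_mul_le (a : Fin N → ℝ) (ξ : Fin N → ℝ) (i j : Fin N) {p : ℝ}
    (hp : p ≤ 1 + ξ i ^ 2 + ξ j ^ 2) : |ξ i| * p ≤ 4 * noiseDom a i j ξ := by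
  have h1 : |ξ i| * p ≤ |ξ i| * (1 + ξ i ^ 2 + ξ j ^ 2) := by gcongr
  refine h1.trans ?_
  unfold noiseDom
  nlinarith [sq_nonneg (|ξ i| - (1 + ξ i ^ 2 + ξ j ^ 2)), sq_abs (ξ i), sq_nonneg (1 - ξ i ^ 2),
    sq_nonneg (1 - ξ j ^ 2), sq_nonneg (ξ i ^ 2 - ξ j ^ 2), sq_nonneg (wsq a ξ),
    sq_nonneg (ξ i ^ 2), sq_nonneg (ξ j ^ 2)]

lemma abs_sub_update_mul_le' (h : FinPotential a V G B S) {τ : ℝ} (hτ : 0 ≤ τ)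
    (X ξ : Fin N → ℝ) (i j : Fin N) {p : ℝ} (hp0 : 0 ≤ p) (hp : p ≤ 1 + ξ i ^ 2 + ξ j ^ 2) :
    |finQ V τ X ξ - finQ V τ X (Function.update ξ i 0)| * p ≤
      4 * (1 + B) * (τ * |X i + G X i| + τ ^ 2) * noiseDom a i j ξ := by
  have hB := h.const_nonneg
  have hM := one_le_noiseDom a i j ξ
  have h1 := abs_sub_update_mul_le h hτ X ξ i j hp0 hp
  have h2 := abs_eval_mul_le a ξ i j hp
  have h3 : |finQ V τ X ξ - finQ V τ X (Function.update ξ i 0)| ≤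
      |finQ V τ X ξ - finQ V τ X (Function.update ξ i 0) + τ * (X i + G X i) * ξ i| +
        τ * |X i + G X i| * |ξ i| := by
    calc _ = |(finQ V τ X ξ - finQ V τ X (Function.update ξ i 0) + τ * (X i + G X i) * ξ i) -
          τ * (X i + G X i) * ξ i| := by ring_nf
      _ ≤ _ := by
        refine (abs_sub _ _).trans_eq ?_
        rw [abs_mul (τ * _), abs_mul τ, abs_of_nonneg hτ]
  calc _ ≤ (|finQ V τ X ξ - finQ V τ X (Function.update ξ i 0) + τ * (X i + G X i) * ξ i| +
        τ * |X i + G X i| * |ξ i|) * p := by gcongr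
    _ = |finQ V τ X ξ - finQ V τ X (Function.update ξ i 0) + τ * (X i + G X i) * ξ i| * p +
        τ * |X i + G X i| * (|ξ i| * p) := by ring
    _ ≤ 4 * (1 + B) * τ ^ 2 * noiseDom a i j ξ +
        τ * |X i + G X i| * (4 * noiseDom a i j ξ) := by gcongr
    _ ≤ _ := by
      have : 0 ≤ B * (τ * |X i + G X i|) * noiseDom a i j ξ := by positivity
      linarith

lemma continuous_finQ_update (hV : Continuous V) (τ : ℝ) (X : Fin N → ℝ) (i : Fin N) :
    Continuous fun ξ => finQ V τ X (Function.update ξ i 0) :=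
  (continuous_finQ_right hV τ X).comp (by fun_prop)

lemma integrable_bdd_mul {α : Type*} [MeasurableSpace α] {μ : Measure α} {f g : α → ℝ}
    (hf : Measurable f) (hf1 : ∀ x, |f x| ≤ 1) (hg : Integrable g μ) :
    Integrable (fun x => f x * g x) μ :=
  hg.bdd_mul hf.aestronglyMeasurable (ae_of_all _ hf1)

lemma abs_acc_le_one (q : ℝ) : |acc q| ≤ 1 := by
  rw [abs_of_nonneg (acc_nonneg q)]; exact acc_le_one q

lemma abs_mul_abs_le (ξ : Fin N → ℝ) (i j : Fin N) :
    |ξ i| * |ξ j| ≤ 1 + ξ i ^ 2 + ξ j ^ 2 := by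
  nlinarith [sq_nonneg (|ξ i| - |ξ j|), sq_abs (ξ i), sq_abs (ξ j), sq_nonneg (ξ i),
    sq_nonneg (ξ j)]

/-- Zeroth-order decoupling: a Lipschitz function of the log acceptance ratio may be replaced by one
independent of `ξ i`, at a cost of order `τ` in mean. -/
lemma integral_abs_sub_update_mul_le (h : FinPotential a V G B S) {τ : ℝ} (hτ : 0 ≤ τ)
    (X : Fin N → ℝ) (i j : Fin N) {F : ℝ → ℝ} (hF : Continuous F) {L : ℝ}
    (hL : 0 ≤ L) (hFL : ∀ p q, |F p - F q| ≤ L * |p - q|) {p : (Fin N → ℝ) → ℝ}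
    (hpc : Continuous p) (hp : ∀ ξ, |p ξ| ≤ 1 + ξ i ^ 2 + ξ j ^ 2) :
    Integrable (fun ξ => (F (finQ V τ X ξ) - F (finQ V τ X (Function.update ξ i 0))) * p ξ)
      (stdPi N) ∧
    |∫ ξ, (F (finQ V τ X ξ) - F (finQ V τ X (Function.update ξ i 0))) * p ξ ∂(stdPi N)| ≤
      L * (4 * (1 + B) * (τ * |X i + G X i| + τ ^ 2) * noiseDomMean S) := by
  have hB := h.const_nonneg
  have hc : Continuous fun ξ =>
      (F (finQ V τ X ξ) - F (finQ V τ X (Function.update ξ i 0))) * p ξ :=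
    ((hF.comp (continuous_finQ_right h.continuous τ X)).sub
      (hF.comp (continuous_finQ_update h.continuous τ X i))).mul hpc
  have hi := ((integrable_noiseDom h.weight_nonneg i j).const_mul
    (L * (4 * (1 + B) * (τ * |X i + G X i| + τ ^ 2))))
  have hle : ∀ ξ, |(F (finQ V τ X ξ) - F (finQ V τ X (Function.update ξ i 0))) * p ξ| ≤
      L * (4 * (1 + B) * (τ * |X i + G X i| + τ ^ 2)) * noiseDom a i j ξ := by
    intro ξ
    rw [abs_mul]
    calc _ ≤ L * |finQ V τ X ξ - finQ V τ X (Function.update ξ i 0)| * |p ξ| := by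
          gcongr; exact hFL _ _
      _ = L * (|finQ V τ X ξ - finQ V τ X (Function.update ξ i 0)| * |p ξ|) := by ring
      _ ≤ L * (4 * (1 + B) * (τ * |X i + G X i| + τ ^ 2) * noiseDom a i j ξ) := by
          refine mul_le_mul_of_nonneg_left ?_ hL
          exact abs_sub_update_mul_le' h hτ X ξ i j (abs_nonneg _) (hp ξ)
      _ = _ := by ring
  have hint := Integrable.mono' hi hc.aestronglyMeasurable (ae_of_all _ hle)
  refine ⟨hint, abs_integral_le_integral_abs.trans
    ((integral_mono hint.abs hi hle).trans ?_)⟩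
  rw [integral_const_mul]
  calc _ ≤ L * (4 * (1 + B) * (τ * |X i + G X i| + τ ^ 2)) * noiseDomMean S := by
        gcongr; exact integral_noiseDom_le h i j
    _ = _ := by ring

/-- The rate constant for removing one coordinate of the noise. -/
def rateUpdate (ℓ B S : ℝ) : ℝ := 4 * (1 + B) * (√2 * ℓ + 2 * ℓ ^ 2) * noiseDomMean S

/-- The rate constant of the Gaussian approximation. -/
def rateGauss (ℓ B S : ℝ) : ℝ :=
  ℓ ^ 2 * √gaussM4 + 2 * ℓ ^ 2 * B * S + √2 * ℓ * (B * √S + 1) + rateUpdate ℓ B S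

lemma rateUpdate_nonneg {ℓ B S : ℝ} (hℓ : 0 < ℓ) (hB : 0 ≤ B) : 0 ≤ rateUpdate ℓ B S := by
  have := noiseDomMean_nonneg S
  unfold rateUpdate
  positivity

lemma rateGauss_nonneg {ℓ B S : ℝ} (hℓ : 0 < ℓ) (hB : 0 ≤ B) (hS : 0 ≤ S) :
    0 ≤ rateGauss ℓ B S := by
  have := rateUpdate_nonneg (S := S) hℓ hB
  unfold rateGauss
  positivity

/-! ### The scale `ε = N ^ (-1/4)`. -/

section Scale

variable {ε : ℝ}

/-- Encoding the scale as `ε ^ 4 * N = 1` forces `N ≠ 0` and turns rates into polynomials in `ε`: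
both `τ` and `1/√N` are of order `ε²`. -/
lemma tau_eq {ℓ : ℝ} (hℓ : 0 < ℓ) (hε : 0 < ε) (hεN : ε ^ 4 * N = 1) :
    √(2 * ℓ ^ 2 / N) = √2 * ℓ * ε ^ 2 := by
  have hN : (N : ℝ) ≠ 0 := by rintro h; simp [h] at hεN
  have : 2 * ℓ ^ 2 / N = (√2 * ℓ * ε ^ 2) ^ 2 := by
    rw [mul_pow, mul_pow, Real.sq_sqrt (by norm_num), div_eq_iff hN]
    linear_combination (-2 * ℓ ^ 2) * hεN
  rw [this, Real.sqrt_sq (by positivity)]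

lemma one_div_sqrt_eq (hε : 0 < ε) (hεN : ε ^ 4 * N = 1) : 1 / √(N : ℝ) = ε ^ 2 := by
  have hN : (N : ℝ) ≠ 0 := by rintro h; simp [h] at hεN
  have : (1 : ℝ) / N = (ε ^ 2) ^ 2 := by
    rw [div_eq_iff hN]; linear_combination -hεN
  rw [← Real.sqrt_one, ← Real.sqrt_div zero_le_one, this, Real.sqrt_sq (by positivity)]

lemma pos_of_scale (hεN : ε ^ 4 * N = 1) : 0 < N := by
  rcases Nat.eq_zero_or_pos N with h | h
  · simp [h] at hεN
  · exact h

lemma rate_update_le {ℓ : ℝ} (hℓ : 0 < ℓ) (hε : 0 < ε) (hε1 : ε ≤ 1) (hεN : ε ^ 4 * N = 1)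
    (hB : 0 ≤ B) (z : ℝ) :
    4 * (1 + B) * (√(2 * ℓ ^ 2 / N) * |z| + √(2 * ℓ ^ 2 / N) ^ 2) * noiseDomMean S ≤
      rateUpdate ℓ B S * (ε ^ 2 * (1 + |z|)) := by
  have hM := noiseDomMean_nonneg S
  have h2 : √2 * √2 = (2 : ℝ) := Real.mul_self_sqrt (by norm_num)
  rw [tau_eq hℓ hε hεN, rateUpdate]
  have hε2 : ε ^ 2 ≤ 1 := pow_le_one₀ hε.le hε1
  have h1 : √2 * ℓ * ε ^ 2 * |z| + (√2 * ℓ * ε ^ 2) ^ 2 ≤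
      (√2 * ℓ + 2 * ℓ ^ 2) * (ε ^ 2 * (1 + |z|)) := by
    have e : (√2 * ℓ * ε ^ 2) ^ 2 = 2 * ℓ ^ 2 * (ε ^ 2 * ε ^ 2) := by
      rw [mul_pow, mul_pow, sq √2, h2]; ring
    rw [e]
    have : ε ^ 2 * ε ^ 2 ≤ ε ^ 2 * 1 := by gcongr
    have : 2 * ℓ ^ 2 * (ε ^ 2 * ε ^ 2) ≤ 2 * ℓ ^ 2 * (ε ^ 2 * 1) := by gcongr
    have : 0 ≤ √2 * ℓ * ε ^ 2 := by positivity
    have : 0 ≤ 2 * ℓ ^ 2 * ε ^ 2 * |z| := by positivity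
    nlinarith
  calc _ ≤ 4 * (1 + B) * ((√2 * ℓ + 2 * ℓ ^ 2) * (ε ^ 2 * (1 + |z|))) * noiseDomMean S := by
        gcongr
    _ = _ := by ring

/-- The conditional law of the log acceptance ratio, with one noise coordinate removed, is close to
its Gaussian limit. -/
lemma abs_integral_update_sub_le (h : FinPotential a V G B S) {ℓ : ℝ} (hℓ : 0 < ℓ)
    (hε : 0 < ε) (hε1 : ε ≤ 1) (hεN : ε ^ 4 * N = 1)
    (X : Fin N → ℝ) (i : Fin N) {F : ℝ → ℝ} (hF : Continuous F) (hM : ∀ q, |F q| ≤ 1) {L : ℝ}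
    (hL : 0 ≤ L) (hFL : ∀ p q, |F p - F q| ≤ L * |p - q|) :
    |∫ ξ, F (finQ V √(2 * ℓ ^ 2 / N) X (Function.update ξ i 0)) ∂(stdPi N) -
      ∫ z, F z ∂(limitLaw ℓ)| ≤
      L * (rateGauss ℓ B S * (ε ^ 2 * (|X i + G X i| + devSize a X))) := by
  set τ := √(2 * ℓ ^ 2 / N) with hτ
  have hB := h.const_nonneg
  have hS := h.sum_nonneg
  have hD := one_le_devSize a X
  have h1 := (integral_abs_sub_update_mul_le h (τ := τ) (Real.sqrt_nonneg _) X i i hF hL hFL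
    (p := fun _ => 1) continuous_const fun ξ => by
      simp only [abs_one]; nlinarith [sq_nonneg (ξ i)]).2
  have h2 := abs_integral_finQ_sub_le h (pos_of_scale hεN) hℓ X hF hM hL hFL
  rw [← hτ, div_eq_mul_one_div (devSize a X), one_div_sqrt_eq hε hεN] at h2
  have i1 : Integrable (fun ξ => F (finQ V τ X ξ)) (stdPi N) :=
    integrable_comp_of_bounded hF hM (continuous_finQ_right h.continuous τ X).measurable
  have i2 : Integrable (fun ξ => F (finQ V τ X (Function.update ξ i 0))) (stdPi N) :=
    integrable_comp_of_bounded hF hM (continuous_finQ_update h.continuous τ X i).measurable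
  simp only [mul_one] at h1
  rw [integral_sub i1 i2, abs_sub_comm] at h1
  have h3 := rate_update_le (S := S) hℓ hε hε1 hεN hB (X i + G X i)
  have h4 := mul_le_mul_of_nonneg_left h3 hL
  have hU := rateUpdate_nonneg (S := S) hℓ hB
  refine (abs_sub_le _ (∫ ξ, F (finQ V τ X ξ) ∂(stdPi N)) _).trans
    ((add_le_add (h1.trans h4) h2).trans ?_)
  rw [← mul_add]
  refine mul_le_mul_of_nonneg_left ?_ hL
  set z := |X i + G X i|
  have hz : 0 ≤ z := abs_nonneg _
  set K := ℓ ^ 2 * √gaussM4 + 2 * ℓ ^ 2 * B * S + √2 * ℓ * (B * √S + 1) with hK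
  have hK0 : 0 ≤ K := by positivity
  rw [rateGauss, ← hK]
  have e1 : rateUpdate ℓ B S * (ε ^ 2 * (1 + z)) ≤
      rateUpdate ℓ B S * (ε ^ 2 * (z + devSize a X)) := by
    refine mul_le_mul_of_nonneg_left (mul_le_mul_of_nonneg_left ?_ (sq_nonneg ε)) hU
    linarith
  have e2 : 0 ≤ K * (ε ^ 2 * z) := by positivity
  linarith

end Scale

end

end RWM

namespace RWM

noncomputable section

variable {N : ℕ} {a : Fin N → ℝ} {V : (Fin N → ℝ) → ℝ} {G : (Fin N → ℝ) → Fin N → ℝ} {B S ε : ℝ}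

lemma integrable_acc_mul (hV : Continuous V) (τ : ℝ) (X : Fin N → ℝ) {p : (Fin N → ℝ) → ℝ}
    (hp : Integrable p (stdPi N)) :
    Integrable (fun ξ => acc (finQ V τ X ξ) * p ξ) (stdPi N) :=
  integrable_bdd_mul (continuous_acc.comp (continuous_finQ_right hV τ X)).measurable
    (fun _ => abs_acc_le_one _) hp

lemma integrable_acc_update_mul (hV : Continuous V) (τ : ℝ) (X : Fin N → ℝ) (i : Fin N)
    {p : (Fin N → ℝ) → ℝ} (hp : Integrable p (stdPi N)) :
    Integrable (fun ξ => acc (finQ V τ X (Function.update ξ i 0)) * p ξ) (stdPi N) :=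
  integrable_bdd_mul (continuous_acc.comp (continuous_finQ_update hV τ X i)).measurable
    (fun _ => abs_acc_le_one _) hp

lemma integrable_eval (i : Fin N) : Integrable (fun ξ => ξ i) (stdPi N) := by
  simpa using integrable_eval_pow i 1

lemma integrable_eval_mul (i j : Fin N) : Integrable (fun ξ => ξ i * ξ j) (stdPi N) := by
  refine Integrable.mono' (((integrable_const (1 : ℝ)).add (integrable_eval_pow i 2)).add
    (integrable_eval_pow j 2)) (Continuous.aestronglyMeasurable (by fun_prop))
    (ae_of_all _ fun ξ => ?_)
  rw [Real.norm_eq_abs, abs_mul]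
  exact abs_mul_abs_le ξ i j

lemma beta_div_two_mem {ℓ : ℝ} : 0 ≤ beta ℓ / 2 ∧ beta ℓ / 2 ≤ 1 := by
  unfold beta
  have h0 := cdf_nonneg (gaussianReal 0 1) (-ℓ / √2)
  have h1 := cdf_le_one (gaussianReal 0 1) (-ℓ / √2)
  constructor <;> linarith

/-! #### Second moments -/

/-- Once coordinate `i` is removed from the ratio, `ξ i` factors out: it contributes `E ξ_i² = 1` on
the diagonal, leaving the mean acceptance probability, and `E ξ_i = 0` off it. -/
lemma abs_integral_acc_mul_mul_sub_le (h : FinPotential a V G B S) {ℓ : ℝ} (hℓ : 0 < ℓ)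
    (hε : 0 < ε) (hε1 : ε ≤ 1) (hεN : ε ^ 4 * N = 1) (X : Fin N → ℝ) (i j : Fin N) :
    |∫ ξ, acc (finQ V √(2 * ℓ ^ 2 / N) X ξ) * (ξ i * ξ j) ∂(stdPi N) -
      (if i = j then beta ℓ else 0)| ≤
      (rateUpdate ℓ B S + rateGauss ℓ B S) * (ε ^ 2 * (|X i + G X i| + devSize a X)) := by
  set τ := √(2 * ℓ ^ 2 / N) with hτ
  have hB := h.const_nonneg
  have hS := h.sum_nonneg
  have hD := one_le_devSize a X
  have hU := rateUpdate_nonneg (S := S) hℓ hB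
  have hR := rateGauss_nonneg hℓ hB hS
  obtain ⟨h1, h2⟩ := integral_abs_sub_update_mul_le h (τ := τ) (Real.sqrt_nonneg _) X i j
    continuous_acc zero_le_one (fun p q => by rw [one_mul]; exact abs_acc_sub_le p q)
    (p := fun ξ => ξ i * ξ j) (by fun_prop) fun ξ => by rw [abs_mul]; exact abs_mul_abs_le ξ i j
  have h3 := h2.trans ((one_mul _).trans_le (rate_update_le (S := S) hℓ hε hε1 hεN hB
    (X i + G X i)))
  have h3' : rateUpdate ℓ B S * (ε ^ 2 * (1 + |X i + G X i|)) ≤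
      rateUpdate ℓ B S * (ε ^ 2 * (|X i + G X i| + devSize a X)) := by
    refine mul_le_mul_of_nonneg_left (mul_le_mul_of_nonneg_left ?_ (sq_nonneg ε)) hU
    linarith
  have h4 : ∫ ξ, acc (finQ V τ X ξ) * (ξ i * ξ j) ∂(stdPi N) =
      ∫ ξ, (acc (finQ V τ X ξ) - acc (finQ V τ X (Function.update ξ i 0))) * (ξ i * ξ j)
        ∂(stdPi N) +
      ∫ ξ, acc (finQ V τ X (Function.update ξ i 0)) * (ξ i * ξ j) ∂(stdPi N) := by
    rw [← integral_add h1 (integrable_acc_update_mul h.continuous τ X i (integrable_eval_mul i j))]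
    exact integral_congr_ae (ae_of_all _ fun ξ => by ring)
  have h5 : |∫ ξ, acc (finQ V τ X (Function.update ξ i 0)) * (ξ i * ξ j) ∂(stdPi N) -
      (if i = j then beta ℓ else 0)| ≤
      rateGauss ℓ B S * (ε ^ 2 * (|X i + G X i| + devSize a X)) := by
    split_ifs with hij
    · subst hij
      have e : ∫ ξ, acc (finQ V τ X (Function.update ξ i 0)) * (ξ i * ξ i) ∂(stdPi N) =
          ∫ ξ, acc (finQ V τ X (Function.update ξ i 0)) ∂(stdPi N) := by
        rw [integral_update_mul (f := fun ξ => acc (finQ V τ X ξ)) (h := fun z => z * z)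
          (continuous_acc.comp (continuous_finQ_right h.continuous τ X)).measurable (by fun_prop)]
        have := integral_sq_gaussian
        simp only [sq] at this
        rw [this, mul_one]
      rw [e, ← integral_acc hℓ]
      have := abs_integral_update_sub_le h hℓ hε hε1 hεN X i continuous_acc abs_acc_le_one
        zero_le_one (fun p q => by rw [one_mul]; exact abs_acc_sub_le p q)
      rwa [one_mul] at this
    · have e : ∫ ξ, acc (finQ V τ X (Function.update ξ i 0)) * (ξ i * ξ j) ∂(stdPi N) = 0 := by
        -- As `j ≠ i`, the factor `ξ j` survives the update and belongs to the function of the other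
        -- coordinates.
        have e1 := integral_update_mul (f := fun ξ => acc (finQ V τ X ξ) * ξ j) (h := fun z => z)
          ((continuous_acc.comp (continuous_finQ_right h.continuous τ X)).mul
            (continuous_apply j)).measurable measurable_id i
        rw [integral_id_gaussianReal, mul_zero] at e1
        refine Eq.trans (integral_congr_ae (ae_of_all _ fun ξ => ?_)) e1
        simp only [Function.update_of_ne (Ne.symm hij)]
        ring
      rw [e, sub_zero, abs_zero]
      positivity
  rw [h4, add_sub_assoc]
  refine (abs_add_le _ _).trans ((add_le_add (h3.trans h3') h5).trans_eq ?_)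
  ring

/-! #### First moments -/

/-- The rate constant for the slope and the bump. -/
def rateSlope (ℓ B S : ℝ) : ℝ := 1 + 4 / √(4 * Real.pi * ℓ ^ 2) + 2 * rateGauss ℓ B S

/-- The rate constant for the drift. -/
def rateDrift (ℓ B S : ℝ) : ℝ :=
  2 * ℓ ^ 2 * (4 * (1 + B) * (√2 * ℓ) * noiseDomMean S + 4 + √2 * ℓ * noiseDomMean S)

/-- First-order expansion around the decoupled ratio `q`: the term `acc(q) ξ_i` has mean zero, and
the linear term produces `ξ_i²`, of mean one and independent of `q`. The three errors come from
linearising `Q - q` in `ξ_i`, from the kink, and from the quadratic remainder `h²/δ` with `h = -τ ζ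
ξ_i`. -/
lemma abs_integral_acc_mul_add_le (h : FinPotential a V G B S) {τ : ℝ} (hτ : 0 ≤ τ) {δ : ℝ}
    (hδ : 0 < δ) (hδ1 : δ ≤ 1) (X : Fin N → ℝ) (i : Fin N) :
    |∫ ξ, acc (finQ V τ X ξ) * ξ i ∂(stdPi N) + τ * (X i + G X i) *
        ∫ ξ, accSlope δ (finQ V τ X (Function.update ξ i 0)) ∂(stdPi N)| ≤
      4 * (1 + B) * τ ^ 2 * noiseDomMean S +
      τ * |X i + G X i| *
        (2 * δ + ∫ ξ, bump δ (finQ V τ X (Function.update ξ i 0)) ∂(stdPi N)) +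
      τ ^ 2 * (X i + G X i) ^ 2 / δ * noiseDomMean S := by
  set ζ := X i + G X i with hζ
  have hB := h.const_nonneg
  set q : (Fin N → ℝ) → ℝ := fun ξ => finQ V τ X (Function.update ξ i 0) with hq
  have hqc : Continuous q := continuous_finQ_update h.continuous τ X i
  have hk1 : ∀ z, |accSlope δ z| ≤ 1 := fun z => by
    rw [abs_of_nonneg (accSlope_nonneg hδ _)]; exact accSlope_le_one hδ _
  have hb1 : ∀ z, |bump δ z| ≤ 1 := fun z => by
    rw [abs_of_nonneg (bump_nonneg _ _)]; exact bump_le_one _ _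
  have i1 := integrable_acc_mul h.continuous τ X (integrable_eval i)
  have i2 := integrable_acc_update_mul h.continuous τ X i (integrable_eval i)
  have i3 : Integrable (fun ξ => accSlope δ (q ξ) * ξ i ^ 2) (stdPi N) :=
    integrable_bdd_mul ((continuous_accSlope δ).comp hqc).measurable (fun ξ => hk1 _)
      (integrable_eval_pow i 2)
  have i4 : Integrable (fun ξ => bump δ (q ξ) * ξ i ^ 2) (stdPi N) :=
    integrable_bdd_mul ((continuous_bump δ).comp hqc).measurable (fun ξ => hb1 _)
      (integrable_eval_pow i 2)
  have i5 := integrable_noiseDom h.weight_nonneg i i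
  have e0 : ∫ ξ, acc (q ξ) * ξ i ∂(stdPi N) = 0 := by
    have := integral_update_mul (f := fun ξ => acc (finQ V τ X ξ)) (h := fun z => z)
      (continuous_acc.comp (continuous_finQ_right h.continuous τ X)).measurable measurable_id i
    rwa [integral_id_gaussianReal, mul_zero] at this
  have e1 : ∫ ξ, accSlope δ (q ξ) * ξ i ^ 2 ∂(stdPi N) = ∫ ξ, accSlope δ (q ξ) ∂(stdPi N) := by
    rw [integral_update_mul (f := fun ξ => accSlope δ (finQ V τ X ξ)) (h := fun z => z ^ 2)
      ((continuous_accSlope δ).comp (continuous_finQ_right h.continuous τ X)).measurable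
      (by fun_prop), integral_sq_gaussian, mul_one]
  have e2 : ∫ ξ, bump δ (q ξ) * ξ i ^ 2 ∂(stdPi N) = ∫ ξ, bump δ (q ξ) ∂(stdPi N) := by
    rw [integral_update_mul (f := fun ξ => bump δ (finQ V τ X ξ)) (h := fun z => z ^ 2)
      ((continuous_bump δ).comp (continuous_finQ_right h.continuous τ X)).measurable
      (by fun_prop), integral_sq_gaussian, mul_one]
  have i6 : Integrable (fun ξ => acc (finQ V τ X ξ) * ξ i - acc (q ξ) * ξ i +
      τ * ζ * (accSlope δ (q ξ) * ξ i ^ 2)) (stdPi N) := (i1.sub i2).add (i3.const_mul _)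
  have e3 : ∫ ξ, acc (finQ V τ X ξ) * ξ i ∂(stdPi N) +
      τ * ζ * ∫ ξ, accSlope δ (q ξ) ∂(stdPi N) =
      ∫ ξ, (acc (finQ V τ X ξ) * ξ i - acc (q ξ) * ξ i +
        τ * ζ * (accSlope δ (q ξ) * ξ i ^ 2)) ∂(stdPi N) := by
    have i12 : Integrable (fun ξ => acc (finQ V τ X ξ) * ξ i - acc (q ξ) * ξ i) (stdPi N) :=
      i1.sub i2
    rw [integral_add i12 (i3.const_mul _), integral_sub i1 i2, e0, integral_const_mul, e1,
      sub_zero]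
  have i7 : Integrable (fun ξ : Fin N → ℝ => 4 * (1 + B) * τ ^ 2 * noiseDom a i i ξ) (stdPi N) :=
    i5.const_mul _
  have i8 : Integrable (fun ξ : Fin N → ℝ => τ * |ζ| * (2 * δ * ξ i ^ 2 + bump δ (q ξ) * ξ i ^ 2))
      (stdPi N) := (((integrable_eval_pow i 2).const_mul _).add i4).const_mul _
  have i9 : Integrable (fun ξ : Fin N → ℝ => τ ^ 2 * ζ ^ 2 / δ * noiseDom a i i ξ) (stdPi N) :=
    i5.const_mul _
  have i78 : Integrable (fun ξ : Fin N → ℝ => 4 * (1 + B) * τ ^ 2 * noiseDom a i i ξ +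
      τ * |ζ| * (2 * δ * ξ i ^ 2 + bump δ (q ξ) * ξ i ^ 2)) (stdPi N) := i7.add i8
  rw [e3]
  refine abs_integral_le_integral_abs.trans ((integral_mono i6.abs (i78.add i9) fun ξ => ?_).trans
    ?_)
  · set t := ξ i with ht
    have hp : |t| ≤ 1 + ξ i ^ 2 + ξ i ^ 2 := by
      nlinarith [sq_nonneg (|t| - 1), sq_abs t]
    have b1 := abs_sub_update_mul_le h hτ X ξ i i (abs_nonneg t) hp
    have b2 := abs_acc_add_sub_le hδ hδ1 (q ξ) (-(τ * ζ * t))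
    have b3 := abs_acc_sub_le (finQ V τ X ξ) (q ξ + -(τ * ζ * t))
    have b4 : finQ V τ X ξ - (q ξ + -(τ * ζ * t)) =
        finQ V τ X ξ - finQ V τ X (Function.update ξ i 0) + τ * (X i + G X i) * ξ i := by
      simp only [hq, hζ, ht]; ring
    rw [b4] at b3
    -- The ratio is first replaced by its linearisation in `ξ i`, using that `acc` is 1-Lipschitz,
    -- and `acc` is then expanded around `q ξ`.
    have b5 : acc (finQ V τ X ξ) * t - acc (q ξ) * t + τ * ζ * (accSlope δ (q ξ) * t ^ 2) =
        (acc (finQ V τ X ξ) - acc (q ξ + -(τ * ζ * t))) * t +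
        (acc (q ξ + -(τ * ζ * t)) - acc (q ξ) - -(τ * ζ * t) * accSlope δ (q ξ)) * t := by ring
    have b6 : |-(τ * ζ * t)| = τ * |ζ| * |t| := by
      rw [abs_neg, abs_mul, abs_mul, abs_of_nonneg hτ]
    have b7 : |t| ^ 3 ≤ noiseDom a i i ξ := by
      have : 0 ≤ wsq a ξ ^ 2 := sq_nonneg _
      have e4 : t ^ 4 = |t| ^ 4 := by rw [← Even.pow_abs (by decide : Even 4)]
      simp only [noiseDom, ← ht, e4]
      have : 0 ≤ |t| := abs_nonneg t
      nlinarith [sq_nonneg (|t| ^ 2 - |t|), sq_nonneg (|t| - 1), sq_nonneg (|t| ^ 2),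
        sq_nonneg (|t| ^ 2 - 1)]
    simp only [Pi.add_apply]
    rw [b5]
    refine (abs_add_le _ _).trans ?_
    rw [abs_mul, abs_mul]
    have c1 : |acc (finQ V τ X ξ) - acc (q ξ + -(τ * ζ * t))| * |t| ≤
        4 * (1 + B) * τ ^ 2 * noiseDom a i i ξ :=
      (mul_le_mul_of_nonneg_right b3 (abs_nonneg t)).trans b1
    have c2 := mul_le_mul_of_nonneg_right b2 (abs_nonneg t)
    rw [b6] at c2
    have c3 : τ * |ζ| * |t| * (2 * δ + bump δ (q ξ) + τ * |ζ| * |t| / δ) * |t| =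
        τ * |ζ| * (2 * δ * t ^ 2 + bump δ (q ξ) * t ^ 2) + τ ^ 2 * ζ ^ 2 / δ * |t| ^ 3 := by
      rw [← sq_abs t, ← sq_abs ζ]; ring
    have c4 : τ ^ 2 * ζ ^ 2 / δ * |t| ^ 3 ≤ τ ^ 2 * ζ ^ 2 / δ * noiseDom a i i ξ := by gcongr
    linarith
  · have i10 : Integrable (fun ξ : Fin N → ℝ => 2 * δ * ξ i ^ 2) (stdPi N) :=
      (integrable_eval_pow i 2).const_mul _
    have e4 : ∫ ξ, (4 * (1 + B) * τ ^ 2 * noiseDom a i i ξ +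
        τ * |ζ| * (2 * δ * ξ i ^ 2 + bump δ (q ξ) * ξ i ^ 2) +
        τ ^ 2 * ζ ^ 2 / δ * noiseDom a i i ξ) ∂(stdPi N) =
        4 * (1 + B) * τ ^ 2 * ∫ ξ, noiseDom a i i ξ ∂(stdPi N) +
        τ * |ζ| * (2 * δ + ∫ ξ, bump δ (q ξ) ∂(stdPi N)) +
        τ ^ 2 * ζ ^ 2 / δ * ∫ ξ, noiseDom a i i ξ ∂(stdPi N) := by
      rw [integral_add i78 i9, integral_add i7 i8, integral_const_mul, integral_const_mul,
        integral_const_mul, integral_add i10 i4, integral_const_mul, integral_eval_two, e2, mul_one]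
    have hm := integral_noiseDom_le h i i
    refine e4.trans_le ?_
    gcongr

/-- The slope has Lipschitz constant `2/ε` and the Gaussian approximation has error of order `ε²`,
so the product matches the smoothing error `ε`. The trivial bound `1` is retained because it saves
moments when the drift error is squared in `drift_bound_sq_le`. -/
lemma abs_integral_accSlope_update_sub_le (h : FinPotential a V G B S) {ℓ : ℝ} (hℓ : 0 < ℓ)
    (hε : 0 < ε) (hε1 : ε ≤ 1) (hεN : ε ^ 4 * N = 1) (X : Fin N → ℝ) (i : Fin N) :
    |∫ ξ, accSlope ε (finQ V √(2 * ℓ ^ 2 / N) X (Function.update ξ i 0)) ∂(stdPi N) -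
      beta ℓ / 2| ≤ min 1 (rateSlope ℓ B S * (ε * (|X i + G X i| + devSize a X))) := by
  have hk1 : ∀ z, |accSlope ε z| ≤ 1 := fun z => by
    rw [abs_of_nonneg (accSlope_nonneg hε _)]; exact accSlope_le_one hε _
  have hD := one_le_devSize a X
  have hz := abs_nonneg (X i + G X i)
  refine le_min ?_ ?_
  · have h0 : 0 ≤ ∫ ξ, accSlope ε (finQ V √(2 * ℓ ^ 2 / N) X (Function.update ξ i 0))
        ∂(stdPi N) := integral_nonneg fun _ => accSlope_nonneg hε _
    have h1 : ∫ ξ, accSlope ε (finQ V √(2 * ℓ ^ 2 / N) X (Function.update ξ i 0))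
        ∂(stdPi N) ≤ 1 := by
      have := integral_mono (integrable_comp_of_bounded (μ := stdPi N) (continuous_accSlope ε) hk1
        (continuous_finQ_update h.continuous √(2 * ℓ ^ 2 / N) X i).measurable)
        (integrable_const 1) fun _ => accSlope_le_one hε _
      simpa using this
    have := beta_div_two_mem (ℓ := ℓ)
    rw [abs_le]; constructor <;> linarith
  · have h1 := abs_integral_update_sub_le h hℓ hε hε1 hεN X i (continuous_accSlope ε) hk1
      (L := 2 / ε) (by positivity) (abs_accSlope_sub_le hε)
    have h2 := abs_integral_accSlope_sub_le hℓ hε hε1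
    refine (abs_sub_le _ _ _).trans ((add_le_add h1 h2).trans ?_)
    have e1 : 2 / ε * (rateGauss ℓ B S * (ε ^ 2 * (|X i + G X i| + devSize a X))) =
        2 * rateGauss ℓ B S * (ε * (|X i + G X i| + devSize a X)) := by
      field_simp
    have e2 : (1 + 4 / √(4 * Real.pi * ℓ ^ 2)) * ε ≤
        (1 + 4 / √(4 * Real.pi * ℓ ^ 2)) * (ε * (|X i + G X i| + devSize a X)) := by
      gcongr
      exact le_mul_of_one_le_right hε.le (by linarith)
    rw [e1, rateSlope]
    linarith

lemma integral_bump_update_le (h : FinPotential a V G B S) {ℓ : ℝ} (hℓ : 0 < ℓ)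
    (hε : 0 < ε) (hε1 : ε ≤ 1) (hεN : ε ^ 4 * N = 1) (X : Fin N → ℝ) (i : Fin N) :
    ∫ ξ, bump ε (finQ V √(2 * ℓ ^ 2 / N) X (Function.update ξ i 0)) ∂(stdPi N) ≤
      min 1 (rateSlope ℓ B S * (ε * (|X i + G X i| + devSize a X))) := by
  have hb1 : ∀ z, |bump ε z| ≤ 1 := fun z => by
    rw [abs_of_nonneg (bump_nonneg _ _)]; exact bump_le_one _ _
  have hD := one_le_devSize a X
  have hz := abs_nonneg (X i + G X i)
  refine le_min ?_ ?_
  · have := integral_mono (integrable_comp_of_bounded (μ := stdPi N) (continuous_bump ε) hb1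
      (continuous_finQ_update h.continuous √(2 * ℓ ^ 2 / N) X i).measurable)
      (integrable_const 1) fun _ => bump_le_one ε _
    simpa using this
  · have h1 := abs_integral_update_sub_le h hℓ hε hε1 hεN X i (continuous_bump ε) hb1
      (L := 2 / ε) (by positivity) (abs_bump_sub_le hε)
    have h2 := integral_bump_le hℓ hε
    have h3 := le_abs_self (∫ ξ, bump ε (finQ V √(2 * ℓ ^ 2 / N) X (Function.update ξ i 0))
      ∂(stdPi N) - ∫ z, bump ε z ∂(limitLaw ℓ))
    have e1 : 2 / ε * (rateGauss ℓ B S * (ε ^ 2 * (|X i + G X i| + devSize a X))) =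
        2 * rateGauss ℓ B S * (ε * (|X i + G X i| + devSize a X)) := by
      field_simp
    rw [e1] at h1
    have e2 : 4 / √(4 * Real.pi * ℓ ^ 2) * ε ≤
        4 / √(4 * Real.pi * ℓ ^ 2) * (ε * (|X i + G X i| + devSize a X)) := by
      gcongr
      exact le_mul_of_one_le_right hε.le (by linarith)
    have e3 : 0 ≤ ε * (|X i + G X i| + devSize a X) := by positivity
    rw [rateSlope]
    linarith

/-- The constant is `N τ² * (β/2) = ℓ² β`: the expansion gives `-τ ζ` times the mean slope, which is
close to `β/2`. -/
lemma abs_drift_le (h : FinPotential a V G B S) {ℓ : ℝ} (hℓ : 0 < ℓ)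
    (hε : 0 < ε) (hε1 : ε ≤ 1) (hεN : ε ^ 4 * N = 1) (X : Fin N → ℝ) (i : Fin N) :
    |N * √(2 * ℓ ^ 2 / N) * ∫ ξ, acc (finQ V √(2 * ℓ ^ 2 / N) X ξ) * ξ i ∂(stdPi N) +
      ℓ ^ 2 * beta ℓ * (X i + G X i)| ≤
      rateDrift ℓ B S * (ε * (1 + (X i + G X i) ^ 2) + |X i + G X i| *
        min 1 (rateSlope ℓ B S * (ε * (|X i + G X i| + devSize a X)))) := by
  have hτe := tau_eq hℓ hε hεN
  have hd := abs_integral_acc_mul_add_le h (Real.sqrt_nonneg (2 * ℓ ^ 2 / N)) hε hε1 X i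
  have hk := abs_integral_accSlope_update_sub_le h hℓ hε hε1 hεN X i
  have hb := integral_bump_update_le h hℓ hε hε1 hεN X i
  set τ := √(2 * ℓ ^ 2 / N) with hτ
  have hB := h.const_nonneg
  have hM := noiseDomMean_nonneg S
  have hN : (0 : ℝ) < N := by exact_mod_cast pos_of_scale hεN
  have hτ0 : 0 ≤ τ := Real.sqrt_nonneg _
  have hτ2 : τ ^ 2 = 2 * ℓ ^ 2 / N := Real.sq_sqrt (by positivity)
  have hNτ : N * τ * τ = 2 * ℓ ^ 2 := by
    rw [mul_assoc, ← sq, hτ2]; field_simp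
  set ζ := X i + G X i with hζ
  set m := min 1 (rateSlope ℓ B S * (ε * (|ζ| + devSize a X))) with hm
  set I := ∫ ξ, acc (finQ V τ X ξ) * ξ i ∂(stdPi N) with hI
  set k := ∫ ξ, accSlope ε (finQ V τ X (Function.update ξ i 0)) ∂(stdPi N) with hkk
  set b := ∫ ξ, bump ε (finQ V τ X (Function.update ξ i 0)) ∂(stdPi N) with hbb
  have e1 : N * τ * I + ℓ ^ 2 * beta ℓ * ζ =
      N * τ * (I + τ * ζ * k) - 2 * ℓ ^ 2 * ζ * (k - beta ℓ / 2) := by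
    linear_combination (-ζ * k) * hNτ
  rw [e1]
  refine (abs_sub _ _).trans ?_
  rw [abs_mul, abs_of_nonneg (show (0 : ℝ) ≤ N * τ by positivity), abs_mul, abs_mul,
    abs_of_nonneg (show (0 : ℝ) ≤ 2 * ℓ ^ 2 by positivity)]
  have e2 : N * τ * |I + τ * ζ * k| ≤ 2 * ℓ ^ 2 * (4 * (1 + B) * τ * noiseDomMean S +
      |ζ| * (2 * ε + m) + τ * ζ ^ 2 / ε * noiseDomMean S) := by
    calc _ ≤ N * τ * (4 * (1 + B) * τ ^ 2 * noiseDomMean S + τ * |ζ| * (2 * ε + b) +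
          τ ^ 2 * ζ ^ 2 / ε * noiseDomMean S) := by gcongr
      _ = N * τ * τ * (4 * (1 + B) * τ * noiseDomMean S +
          |ζ| * (2 * ε + b) + τ * ζ ^ 2 / ε * noiseDomMean S) := by ring
      _ ≤ _ := by rw [hNτ]; gcongr
  have e3 : 2 * ℓ ^ 2 * |ζ| * |k - beta ℓ / 2| ≤ 2 * ℓ ^ 2 * (|ζ| * m) := by
    rw [mul_assoc]; gcongr
  refine (add_le_add e2 e3).trans ?_
  have hm0 : 0 ≤ m := (abs_nonneg _).trans hk
  have e4 : τ * ζ ^ 2 / ε = √2 * ℓ * (ε * ζ ^ 2) := by rw [hτe]; field_simp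
  have e5 : τ ≤ √2 * ℓ * ε := by
    rw [hτe]; gcongr; exact pow_le_of_le_one hε.le hε1 two_ne_zero
  rw [e4, rateDrift]
  have hz2 : |ζ| ≤ (1 + ζ ^ 2) / 2 := by nlinarith [sq_nonneg (|ζ| - 1), sq_abs ζ]
  have hA : 0 ≤ 4 * (1 + B) * (√2 * ℓ) * noiseDomMean S := by positivity
  have hC : 0 ≤ √2 * ℓ * noiseDomMean S := by positivity
  have e6 : 4 * (1 + B) * τ * noiseDomMean S ≤
      4 * (1 + B) * (√2 * ℓ) * noiseDomMean S * ε := by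
    calc _ ≤ 4 * (1 + B) * (√2 * ℓ * ε) * noiseDomMean S := by gcongr
      _ = _ := by ring
  set A := 4 * (1 + B) * (√2 * ℓ) * noiseDomMean S
  set D := √2 * ℓ * noiseDomMean S
  have e7 : 4 * (1 + B) * τ * noiseDomMean S + |ζ| * (2 * ε + m) +
      √2 * ℓ * (ε * ζ ^ 2) * noiseDomMean S + |ζ| * m ≤
      (A + 4 + D) * (ε * (1 + ζ ^ 2) + |ζ| * m) := by
    have f1 : |ζ| * ε ≤ (1 + ζ ^ 2) / 2 * ε := by gcongr
    have f2 : 0 ≤ A * (ε * ζ ^ 2 + |ζ| * m) := by positivity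
    have f3 : 0 ≤ D * (ε + |ζ| * m) := by positivity
    have f4 : 0 ≤ ε * (1 + ζ ^ 2) + |ζ| * m := by positivity
    have f5 : √2 * ℓ * (ε * ζ ^ 2) * noiseDomMean S = D * (ε * ζ ^ 2) := by ring
    have f6 : 0 ≤ |ζ| * m := by positivity
    have f7 : 0 ≤ ε * ζ ^ 2 := by positivity
    rw [f5]
    linarith
  calc _ = 2 * ℓ ^ 2 * (4 * (1 + B) * τ * noiseDomMean S + |ζ| * (2 * ε + m) +
      √2 * ℓ * (ε * ζ ^ 2) * noiseDomMean S + |ζ| * m) := by ring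
    _ ≤ 2 * ℓ ^ 2 * ((A + 4 + D) * (ε * (1 + ζ ^ 2) + |ζ| * m)) := by gcongr
    _ = _ := by ring

end

end RWM

/-! ### Domination of the coordinate errors by functions of the state with uniformly bounded mean.
-/

namespace RWM

noncomputable section

variable {N : ℕ} {a : Fin N → ℝ} {V : (Fin N → ℝ) → ℝ} {G : (Fin N → ℝ) → Fin N → ℝ} {B S ε : ℝ}

/-- An integrable function of the state dominating the errors of the conditional moments. -/
def stateDom (a : Fin N → ℝ) (i : Fin N) (X : Fin N → ℝ) : ℝ :=
  1 + X i ^ 4 + wsq a X ^ 2 + N * fluct X ^ 2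

lemma stateDom_nonneg (a : Fin N → ℝ) (i : Fin N) (X : Fin N → ℝ) : 0 ≤ stateDom a i X := by
  unfold stateDom; positivity

lemma continuous_stateDom (a : Fin N → ℝ) (i : Fin N) : Continuous (stateDom a i) := by
  have := continuous_wsq a
  have := continuous_fluct (N := N)
  unfold stateDom
  fun_prop

/-- The bound does not depend on `N` or `i`; for the last term this is because `fluct` has second
moment of order `1/N`. -/
lemma integral_stateDom_le (h : FinPotential a V G B S) (hN : 0 < N) (i : Fin N) :
    Integrable (stateDom a i) (stdPi N) ∧
    ∫ X, stateDom a i X ∂(stdPi N) ≤ 1 + 2 * gaussM4 + gaussM4 * S ^ 2 := by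
  have ha := h.weight_nonneg
  have hN' : (0 : ℝ) < N := by exact_mod_cast hN
  have i1 : Integrable (fun ξ : Fin N → ℝ => 1 + ξ i ^ 4) (stdPi N) :=
    (integrable_const 1).add (integrable_eval_pow i 4)
  have i2 : Integrable (fun ξ : Fin N → ℝ => 1 + ξ i ^ 4 + wsq a ξ ^ 2) (stdPi N) :=
    i1.add (integrable_wsq_sq ha)
  have i3 : Integrable (fun ξ : Fin N → ℝ => N * fluct ξ ^ 2) (stdPi N) :=
    integrable_fluct_sq.const_mul _
  refine ⟨i2.add i3, ?_⟩
  unfold stateDom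
  rw [integral_add i2 i3, integral_add i1 (integrable_wsq_sq ha),
    integral_add (integrable_const 1) (integrable_eval_pow i 4), integral_eval_four,
    integral_const_mul]
  have h1 : gaussM4 * (∑ j, a j) ^ 2 ≤ gaussM4 * S ^ 2 := by
    have := gaussM4_nonneg
    have := Finset.sum_nonneg fun j (_ : j ∈ Finset.univ) => ha j
    gcongr
    exact h.sum_le
  have h2 := integral_wsq_sq_le ha
  have h3 : N * ∫ ξ : Fin N → ℝ, fluct ξ ^ 2 ∂(stdPi N) ≤ gaussM4 := by
    have := mul_le_mul_of_nonneg_left (integral_fluct_sq_le hN) hN'.le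
    rwa [mul_div_cancel₀ _ hN'.ne'] at this
  simp only [integral_const, probReal_univ, one_smul]
  linarith

lemma add_pow_four_le (x y : ℝ) : (x + y) ^ 4 ≤ 8 * (x ^ 4 + y ^ 4) := by
  have h1 : (x + y) ^ 2 ≤ 2 * (x ^ 2 + y ^ 2) := by nlinarith [sq_nonneg (x - y)]
  have h2 : ((x + y) ^ 2) ^ 2 ≤ (2 * (x ^ 2 + y ^ 2)) ^ 2 := by gcongr
  nlinarith [sq_nonneg (x ^ 2 - y ^ 2)]

/-- The gradient is absorbed through `|G_i| ≤ B (1 + √w) √a_i` and `a_i ≤ S`, so its fourth power is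
controlled by `1 + w²`, where `w = wsq a X`. -/
lemma moments_le_stateDom (h : FinPotential a V G B S) (X : Fin N → ℝ) (i : Fin N) :
    1 + (X i + G X i) ^ 4 + devSize a X ^ 2 ≤ (15 + 64 * B ^ 4 * S ^ 2) * stateDom a i X := by
  have hB := h.const_nonneg
  have hS := h.sum_nonneg
  set w := wsq a X with hw
  have hw0 : 0 ≤ w := wsq_nonneg h.weight_nonneg X
  have hai : a i ≤ S :=
    (Finset.single_le_sum (fun j _ => h.weight_nonneg j) (Finset.mem_univ i)).trans h.sum_le
  have hs : √w ^ 2 = w := Real.sq_sqrt hw0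
  have hN2 : √(N : ℝ) ^ 2 = N := Real.sq_sqrt (by positivity)
  have hD : devSize a X ^ 2 ≤ 3 * (1 + w + N * fluct X ^ 2) := by
    have e : (√N * |fluct X|) ^ 2 = N * fluct X ^ 2 := by rw [mul_pow, hN2, sq_abs]
    rw [devSize, ← e, ← hs, ← hw]
    nlinarith [sq_nonneg (1 - √w), sq_nonneg (1 - √N * |fluct X|),
      sq_nonneg (√w - √N * |fluct X|)]
  have hG : G X i ^ 4 ≤ 8 * B ^ 4 * S ^ 2 * (1 + w ^ 2) := by
    calc G X i ^ 4 = |G X i| ^ 4 := (Even.pow_abs (by decide) _).symm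
      _ ≤ (B * (1 + √w) * √(a i)) ^ 4 := by gcongr; exact h.grad_le X i
      _ = B ^ 4 * (1 + √w) ^ 4 * (√(a i) ^ 2) ^ 2 := by ring
      _ = B ^ 4 * (1 + √w) ^ 4 * a i ^ 2 := by rw [Real.sq_sqrt (h.weight_nonneg i)]
      _ ≤ B ^ 4 * (8 * (1 ^ 4 + √w ^ 4)) * S ^ 2 := by
        have := h.weight_nonneg i
        gcongr
        exact add_pow_four_le _ _
      _ = 8 * B ^ 4 * S ^ 2 * (1 + w ^ 2) := by
        rw [show √w ^ 4 = (√w ^ 2) ^ 2 by ring, hs]; ring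
  have hz := add_pow_four_le (X i) (G X i)
  have hw1 : w ≤ 1 + w ^ 2 := by nlinarith [sq_nonneg (w - 1)]
  have c : 0 ≤ B ^ 4 * S ^ 2 := by positivity
  have hx : 0 ≤ X i ^ 4 := by positivity
  have hf : 0 ≤ N * fluct X ^ 2 := by positivity
  have hw2 : 0 ≤ w ^ 2 := sq_nonneg _
  rw [stateDom, ← hw]
  have f1 : 0 ≤ B ^ 4 * S ^ 2 * (X i ^ 4 + N * fluct X ^ 2) := by positivity
  linarith

/-- A number `m` in `[0, 1]` satisfies `m² ≤ m`, so squaring the minimum still leaves `|ζ| + D` to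
the first power. Only `ζ⁴` and `D²` are then needed; without the truncation `ζ² D²` would appear. -/
lemma drift_bound_sq_le {ε P D : ℝ} (hε : 0 ≤ ε) (hε1 : ε ≤ 1) (hP : 0 ≤ P) (hD : 0 ≤ D) (ζ : ℝ) :
    (ε * (1 + ζ ^ 2) + |ζ| * min 1 (P * (ε * (|ζ| + D)))) ^ 2 ≤
      2 * ((2 + 3 * P) * (ε * (1 + ζ ^ 4 + D ^ 2))) := by
  set m := min 1 (P * (ε * (|ζ| + D))) with hm
  have hz := abs_nonneg ζ
  have hm0 : 0 ≤ m := le_min zero_le_one (by positivity)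
  have hm2 : m ^ 2 ≤ P * (ε * (|ζ| + D)) :=
    (pow_le_of_le_one hm0 (min_le_left _ _) two_ne_zero).trans (min_le_right _ _)
  have g1 : (ε * (1 + ζ ^ 2) + |ζ| * m) ^ 2 ≤ 2 * ((ε * (1 + ζ ^ 2)) ^ 2 + (|ζ| * m) ^ 2) :=
    add_sq_le
  have g2 : (ε * (1 + ζ ^ 2)) ^ 2 ≤ ε * (2 * (1 + ζ ^ 4)) := by
    have e1 : ε ^ 2 ≤ ε := pow_le_of_le_one hε hε1 two_ne_zero
    have e2 : (1 + ζ ^ 2) ^ 2 ≤ 2 * (1 + ζ ^ 4) := by linarith [sq_nonneg (1 - ζ ^ 2)]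
    rw [mul_pow]; gcongr
  have g3 : (|ζ| * m) ^ 2 ≤ P * ε * (3 * (1 + ζ ^ 4 + D ^ 2)) := by
    rw [mul_pow, sq_abs]
    calc ζ ^ 2 * m ^ 2 ≤ ζ ^ 2 * (P * (ε * (|ζ| + D))) := by gcongr
      _ = P * ε * (ζ ^ 2 * |ζ| + ζ ^ 2 * D) := by ring
      _ ≤ _ := by
        refine mul_le_mul_of_nonneg_left ?_ (by positivity)
        have e1 := sq_nonneg (ζ ^ 2 - |ζ|)
        have e2 := sq_nonneg (ζ ^ 2 - D)
        have e3 := sq_nonneg (ζ ^ 2 - 1)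
        have e4 := sq_abs ζ
        have e5 := sq_nonneg (ζ ^ 2)
        have e6 := sq_nonneg D
        linarith
  have g4 : 0 ≤ ε * D ^ 2 := by positivity
  linarith

/-- The conditional mean of an accepted move, up to an error of order `ε`. -/
theorem exists_drift_sq_le (ℓ B S : ℝ) (hℓ : 0 < ℓ) (hB : 0 ≤ B) (hS : 0 ≤ S) :
    ∃ K : ℝ, 0 ≤ K ∧ ∀ (N : ℕ) (a : Fin N → ℝ) (V : (Fin N → ℝ) → ℝ)
      (G : (Fin N → ℝ) → Fin N → ℝ) (ε : ℝ), FinPotential a V G B S → 0 < ε → ε ≤ 1 →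
      ε ^ 4 * N = 1 → ∀ (X : Fin N → ℝ) (i : Fin N),
      (N * √(2 * ℓ ^ 2 / N) * ∫ ξ, acc (finQ V √(2 * ℓ ^ 2 / N) X ξ) * ξ i ∂(stdPi N) +
        ℓ ^ 2 * beta ℓ * (X i + G X i)) ^ 2 ≤ K * (ε * stateDom a i X) := by
  have hR := rateGauss_nonneg hℓ hB hS
  have hM := noiseDomMean_nonneg S
  have hP : 0 ≤ rateSlope ℓ B S := by unfold rateSlope; positivity
  refine ⟨2 * rateDrift ℓ B S ^ 2 * (2 + 3 * rateSlope ℓ B S) * (15 + 64 * B ^ 4 * S ^ 2),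
    by positivity, fun N a V G ε h hε hε1 hεN X i => ?_⟩
  have h1 := abs_drift_le h hℓ hε hε1 hεN X i
  have h2 := moments_le_stateDom h X i
  have hD := one_le_devSize a X
  set ζ := X i + G X i
  set D := devSize a X
  set P := rateSlope ℓ B S
  set m := min 1 (P * (ε * (|ζ| + D))) with hm
  have h5 := drift_bound_sq_le hε.le hε1 hP (zero_le_one.trans hD) ζ
  rw [← hm] at h5
  calc _ ≤ (rateDrift ℓ B S * (ε * (1 + ζ ^ 2) + |ζ| * m)) ^ 2 := by
        rw [← sq_abs]; gcongr
    _ = rateDrift ℓ B S ^ 2 * (ε * (1 + ζ ^ 2) + |ζ| * m) ^ 2 := by ring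
    _ ≤ rateDrift ℓ B S ^ 2 * (2 * ((2 + 3 * P) * (ε * (1 + ζ ^ 4 + D ^ 2)))) := by gcongr
    _ ≤ rateDrift ℓ B S ^ 2 * (2 * ((2 + 3 * P) *
          (ε * ((15 + 64 * B ^ 4 * S ^ 2) * stateDom a i X)))) := by gcongr
    _ = _ := by ring

/-- The conditional second moments of an accepted move, up to an error of order `ε`. -/
theorem exists_covariance_le (ℓ B S : ℝ) (hℓ : 0 < ℓ) (hB : 0 ≤ B) (hS : 0 ≤ S) :
    ∃ K : ℝ, 0 ≤ K ∧ ∀ (N : ℕ) (a : Fin N → ℝ) (V : (Fin N → ℝ) → ℝ)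
      (G : (Fin N → ℝ) → Fin N → ℝ) (ε : ℝ), FinPotential a V G B S → 0 < ε → ε ≤ 1 →
      ε ^ 4 * N = 1 → ∀ (X : Fin N → ℝ) (i j : Fin N),
      |∫ ξ, acc (finQ V √(2 * ℓ ^ 2 / N) X ξ) * (ξ i * ξ j) ∂(stdPi N) -
        (if i = j then beta ℓ else 0)| ≤ K * (ε * stateDom a i X) := by
  have hR := rateGauss_nonneg hℓ hB hS
  have hU := rateUpdate_nonneg (S := S) hℓ hB
  refine ⟨(rateUpdate ℓ B S + rateGauss ℓ B S) * (2 * (15 + 64 * B ^ 4 * S ^ 2)), by positivity,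
    fun N a V G ε h hε hε1 hεN X i j => ?_⟩
  have h1 := abs_integral_acc_mul_mul_sub_le h hℓ hε hε1 hεN X i j
  have h2 := moments_le_stateDom h X i
  have hD := one_le_devSize a X
  set ζ := X i + G X i
  set D := devSize a X
  have hz := abs_nonneg ζ
  refine h1.trans ?_
  have e1 : ε ^ 2 ≤ ε := pow_le_of_le_one hε.le hε1 two_ne_zero
  have e2 : |ζ| + D ≤ 2 * (1 + ζ ^ 4 + D ^ 2) := by
    nlinarith [sq_nonneg (|ζ| - 1), sq_abs ζ, sq_nonneg (ζ ^ 2 - 1)]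
  calc _ ≤ (rateUpdate ℓ B S + rateGauss ℓ B S) * (ε * (2 * (1 + ζ ^ 4 + D ^ 2))) := by gcongr
    _ ≤ (rateUpdate ℓ B S + rateGauss ℓ B S) *
        (ε * (2 * ((15 + 64 * B ^ 4 * S ^ 2) * stateDom a i X))) := by gcongr
    _ = _ := by ring

end

end RWM

namespace RWM

noncomputable section

open SobolevSpace

/-! ### The potential in coordinates -/

variable {s : ℝ} {lam : ℕ → ℝ} {κ : ℝ}

lemma EigenvalueDecay.pos (h : EigenvalueDecay lam κ) (j : ℕ) : 0 < lam j := by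
  obtain ⟨Mm, Mp, hm, -, hb⟩ := h
  exact pos_of_mul_pos_right (hm.trans_le (hb j).1) (by positivity)

/-- The terms decay like `(j + 1) ^ (2s - 2κ)`, with exponent below `-1` exactly when `s < κ - 1/2`.
-/
lemma EigenvalueDecay.summable (h : EigenvalueDecay lam κ) (hs : s < κ - 1 / 2) :
    Summable fun j => weight s j * lam j ^ 2 := by
  have hpos := h.pos
  obtain ⟨Mm, Mp, -, hp, hb⟩ := h
  have h1 : Summable fun j : ℕ => ((j : ℝ) + 1) ^ (2 * s - 2 * κ) := by
    have := (summable_nat_add_iff 1).2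
      (Real.summable_nat_rpow (p := 2 * s - 2 * κ).2 (by linarith))
    simpa using this
  refine Summable.of_nonneg_of_le (fun j => mul_nonneg (weight_pos s j).le (sq_nonneg _))
    (fun j => ?_) (h1.mul_left (Mp ^ 2))
  have hj : (0 : ℝ) < (j : ℝ) + 1 := by positivity
  have h2 : lam j ≤ Mp * ((j : ℝ) + 1) ^ (-κ) := by
    rw [Real.rpow_neg hj.le, ← div_eq_mul_inv, le_div_iff₀ (by positivity), mul_comm]
    exact (hb j).2
  calc weight s j * lam j ^ 2 ≤ weight s j * (Mp * ((j : ℝ) + 1) ^ (-κ)) ^ 2 := by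
        have := (weight_pos s j).le
        have := (hpos j).le
        gcongr
    _ = Mp ^ 2 * (((j : ℝ) + 1) ^ (2 * s) * (((j : ℝ) + 1) ^ (-κ) * ((j : ℝ) + 1) ^ (-κ))) := by
        rw [weight]; ring
    _ = _ := by
        rw [← Real.rpow_add hj, ← Real.rpow_add hj]; ring_nf

/-- The weights of the norm of order `s` in the normalised coordinates. -/
def finWeight (s : ℝ) (lam : ℕ → ℝ) (N : ℕ) (j : Fin N) : ℝ := weight s j * lam j ^ 2

lemma finWeight_nonneg (s : ℝ) (lam : ℕ → ℝ) (N : ℕ) (j : Fin N) : 0 ≤ finWeight s lam N j :=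
  mul_nonneg (weight_pos s j).le (sq_nonneg _)

lemma sum_finWeight_le (hsum : Summable fun j => weight s j * lam j ^ 2) (N : ℕ) :
    ∑ j, finWeight s lam N j ≤ ∑' j, weight s j * lam j ^ 2 := by
  unfold finWeight
  rw [Fin.sum_univ_eq_sum_range fun j => weight s j * lam j ^ 2]
  exact hsum.sum_le_tsum _ fun j _ => mul_nonneg (weight_pos s j).le (sq_nonneg _)

variable {N : ℕ}

/-- The element `∑_{j < N} lam_j X_j φ_j` of `H^s`. -/
def embed (s : ℝ) (lam : ℕ → ℝ) (X : Fin N → ℝ) : SobolevSpace s :=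
  ∑ j : Fin N, (lam j * X j) • basisVec s j

lemma embed_add (X Y : Fin N → ℝ) : embed s lam (X + Y) = embed s lam X + embed s lam Y := by
  simp only [embed, ← Finset.sum_add_distrib, ← add_smul, Pi.add_apply, mul_add]

lemma embed_sub (X Y : Fin N → ℝ) : embed s lam (X - Y) = embed s lam X - embed s lam Y := by
  simp only [embed, ← Finset.sum_sub_distrib, ← sub_smul, Pi.sub_apply, mul_sub]

lemma continuous_embed (s : ℝ) (lam : ℕ → ℝ) :
    Continuous (embed s lam : (Fin N → ℝ) → SobolevSpace s) := by
  unfold embed; fun_prop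

lemma coord_basisVec (s : ℝ) (j k : ℕ) : (basisVec s j).coord k = if k = j then 1 else 0 := by
  simp [basisVec, Pi.single_apply]

lemma coord_embed (X : Fin N → ℝ) (k : ℕ) :
    (embed s lam X).coord k = if h : k < N then lam k * X ⟨k, h⟩ else 0 := by
  rw [embed, coord_sum]
  simp only [coord_smul, coord_basisVec, mul_ite, mul_one, mul_zero]
  split_ifs with h
  · rw [Finset.sum_eq_single ⟨k, h⟩ (fun j _ hj => if_neg fun e => hj (Fin.ext e.symm)) (by simp)]
    simp
  · exact Finset.sum_eq_zero fun j _ => if_neg fun e => h (by rw [e]; exact j.2)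

lemma norm_embed_sq (X : Fin N → ℝ) : ‖embed s lam X‖ ^ 2 = wsq (finWeight s lam N) X := by
  rw [norm_sq_eq, tsum_eq_sum (s := Finset.range N), Finset.sum_range]
  · refine Finset.sum_congr rfl fun j _ => ?_
    rw [coord_embed, dif_pos j.2, finWeight]; ring
  · intro j hj
    rw [coord_embed, dif_neg (by simpa using hj)]; simp

lemma norm_embed (X : Fin N → ℝ) : ‖embed s lam X‖ = √(wsq (finWeight s lam N) X) := by
  rw [← norm_embed_sq, Real.sqrt_sq (norm_nonneg _)]

lemma coord_sub {r : ℝ} (x y : SobolevSpace r) (j : ℕ) :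
    (x - y).coord j = x.coord j - y.coord j := rfl

lemma coord_grad (f : SobolevSpace s → ℝ) (x : SobolevSpace s) (j : ℕ) :
    (grad f x).coord j = fderiv ℝ f x (basisVec s j) := rfl

lemma weight_mul_coord_sq_le {r : ℝ} (x : SobolevSpace r) (j : ℕ) :
    weight r j * x.coord j ^ 2 ≤ ‖x‖ ^ 2 := by
  rw [norm_sq_eq]
  exact x.summable.le_tsum j fun k _ => mul_nonneg (weight_pos r k).le (sq_nonneg _)

lemma abs_coord_le (g : SobolevSpace (-s)) (j : ℕ) : |g.coord j| ≤ √(weight s j) * ‖g‖ := by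
  have h := weight_mul_coord_sq_le g j
  rw [weight_neg, inv_mul_le_iff₀ (weight_pos s j)] at h
  refine abs_le_of_sq_le_sq ?_ (by positivity)
  rwa [mul_pow, Real.sq_sqrt (weight_pos s j).le]

/-- Duality of `H^{-s}` and `H^s`: the weights are inverse to each other, so Cauchy–Schwarz applies.
-/
lemma abs_sum_pairing_le (g : SobolevSpace (-s)) (u : Fin N → ℝ) :
    |∑ j : Fin N, lam j * u j * g.coord j| ≤ ‖g‖ * ‖embed s lam u‖ := by
  refine abs_le_of_sq_le_sq ?_ (by positivity)
  have h1 : (∑ j : Fin N, lam j * u j * g.coord j) ^ 2 ≤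
      (∑ j : Fin N, weight (-s) j * g.coord j ^ 2) *
        ∑ j : Fin N, finWeight s lam N j * u j ^ 2 := by
    refine Finset.sum_sq_le_sum_mul_sum_of_sq_le_mul _
      (fun j _ => mul_nonneg (weight_pos _ j).le (sq_nonneg _))
      (fun j _ => mul_nonneg (finWeight_nonneg _ _ _ _) (sq_nonneg _)) fun j _ => le_of_eq ?_
    rw [weight_neg, finWeight]
    have := (weight_pos s j).ne'
    field_simp
  have h2 : ∑ j : Fin N, weight (-s) j * g.coord j ^ 2 ≤ ‖g‖ ^ 2 := by
    rw [norm_sq_eq, Fin.sum_univ_eq_sum_range fun j => weight (-s) j * g.coord j ^ 2]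
    exact g.summable.sum_le_tsum _ fun j _ => mul_nonneg (weight_pos _ j).le (sq_nonneg _)
  rw [mul_pow, norm_embed_sq]
  exact h1.trans (mul_le_mul_of_nonneg_right h2 (wsq_nonneg (finWeight_nonneg _ _ _) _))

lemma fderiv_embed (f : SobolevSpace s → ℝ) (q : SobolevSpace s) (u : Fin N → ℝ) :
    fderiv ℝ f q (embed s lam u) = ∑ j : Fin N, lam j * u j * (grad f q).coord j := by
  simp only [embed, map_sum, map_smul, smul_eq_mul, coord_grad]

/-- The gradient of the potential in the normalised coordinates. -/
def finGrad (lam : ℕ → ℝ) (Ψ : SobolevSpace s → ℝ) (X : Fin N → ℝ) (j : Fin N) : ℝ :=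
  lam j * (grad Ψ (embed s lam X)).coord j

/-- The only place where the assumptions on the gradient and the second derivative are turned into
finite-dimensional estimates. The constants `B` and `S` do not depend on `N`, which makes all later
bounds uniform. -/
lemma finPotential (hlam : ∀ j, 0 < lam j) (hsum : Summable fun j => weight s j * lam j ^ 2)
    {Ψ : SobolevSpace s → ℝ} (hd : Differentiable ℝ Ψ) (hg : Differentiable ℝ (grad Ψ))
    {B : ℝ} (hB : 0 ≤ B) (h3 : ∀ x, ‖grad Ψ x‖ ≤ B * (1 + ‖x‖)) (h4 : ∀ x, ‖hess Ψ x‖ ≤ B) :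
    FinPotential (finWeight s lam N) (fun X => Ψ (embed s lam X)) (finGrad lam Ψ) B
      (∑' j, weight s j * lam j ^ 2) where
  weight_nonneg := finWeight_nonneg s lam N
  sum_le := sum_finWeight_le hsum N
  const_nonneg := hB
  continuous := hd.continuous.comp (continuous_embed s lam)
  grad_le X j := by
    have h1 := abs_coord_le (grad Ψ (embed s lam X)) j
    have h2 := h3 (embed s lam X)
    rw [norm_embed] at h2
    have h5 : √(finWeight s lam N j) = lam j * √(weight s j) := by
      rw [finWeight, Real.sqrt_mul (weight_pos s j).le, Real.sqrt_sq (hlam j).le, mul_comm]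
    rw [finGrad, abs_mul, abs_of_pos (hlam j), h5]
    calc _ ≤ lam j * (√(weight s j) * (B * (1 + √(wsq (finWeight s lam N) X)))) := by
          have := (hlam j).le
          gcongr
          exact h1.trans (by gcongr)
      _ = _ := by ring
  taylor_le X u v := by
    rw [← norm_embed, ← norm_embed, ← norm_embed, embed_add, embed_add, embed_sub]
    set p := embed s lam X with hp
    set U := embed s lam u with hU
    set W := embed s lam v with hW
    have hlip : ∀ q, ‖grad Ψ q - grad Ψ p‖ ≤ B * ‖q - p‖ := fun q =>
      Convex.norm_image_sub_le_of_norm_fderiv_le (𝕜 := ℝ) (s := Set.univ)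
        (fun x _ => hg x) (fun x _ => h4 x) convex_univ (Set.mem_univ _) (Set.mem_univ _)
    have hG : ∑ j, finGrad lam Ψ X j * (u j - v j) = fderiv ℝ Ψ p (U - W) := by
      rw [hU, hW, ← embed_sub, fderiv_embed]
      exact Finset.sum_congr rfl fun j _ => by simp only [finGrad, Pi.sub_apply]; ring
    have hpair : ∀ q, |fderiv ℝ Ψ q (U - W) - fderiv ℝ Ψ p (U - W)| ≤
        ‖grad Ψ q - grad Ψ p‖ * ‖U - W‖ := by
      intro q
      rw [hU, hW, ← embed_sub, fderiv_embed, fderiv_embed, ← Finset.sum_sub_distrib]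
      refine le_trans (le_of_eq ?_) (abs_sum_pairing_le _ _)
      congr 1
      exact Finset.sum_congr rfl fun j _ => by rw [coord_sub]; ring
    -- The mean value inequality on the segment from `p + W` to `p + U`, after subtracting the
    -- linear part at `p`. A point of the segment differs from `p` by `t U + (1 - t) W`, so the
    -- Lipschitz gradient changes by at most `B (‖U‖ + ‖W‖)`.
    let f : ℝ → ℝ := fun t => Ψ (p + W + t • (U - W)) - t * fderiv ℝ Ψ p (U - W)
    have hf : ∀ t, HasDerivAt f (fderiv ℝ Ψ (p + W + t • (U - W)) (U - W) -
        fderiv ℝ Ψ p (U - W)) t := by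
      intro t
      have c1 : HasDerivAt (fun t : ℝ => p + W + t • (U - W)) (U - W) t := by
        simpa using ((hasDerivAt_id t).smul_const (U - W)).const_add (p + W)
      have c2 := (hd (p + W + t • (U - W))).hasFDerivAt.comp_hasDerivAt t c1
      have c3 := c2.sub ((hasDerivAt_id t).mul_const (fderiv ℝ Ψ p (U - W)))
      rw [one_mul] at c3
      exact c3
    have hmv := norm_image_sub_le_of_norm_deriv_le_segment_01'
      (C := B * (‖U‖ + ‖W‖) * ‖U - W‖)
      (fun t _ => (hf t).hasDerivWithinAt) (fun t ht => ?_)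
    · rw [hG]
      refine le_trans (le_of_eq ?_) hmv
      simp only [f, one_smul, zero_smul, add_zero, one_mul, zero_mul, sub_zero, Real.norm_eq_abs]
      congr 1
      rw [show p + W + (U - W) = p + U by abel]
      ring
    · refine (hpair _).trans (mul_le_mul_of_nonneg_right ((hlip _).trans ?_) (norm_nonneg _))
      refine mul_le_mul_of_nonneg_left ?_ hB
      have e : p + W + t • (U - W) - p = t • U + (1 - t) • W := by module
      rw [e]
      refine (norm_add_le _ _).trans ?_
      rw [norm_smul, norm_smul, Real.norm_of_nonneg ht.1, Real.norm_of_nonneg (by linarith [ht.2])]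
      have := norm_nonneg U
      have := norm_nonneg W
      have := ht.1
      have := ht.2
      nlinarith

end

end RWM

namespace RWM

noncomputable section

open SobolevSpace

variable {H : Type*} [NormedAddCommGroup H] [InnerProductSpace ℝ H]
variable {s : ℝ} {lam : ℕ → ℝ} {N : ℕ}

/-! ### Coordinates on the Hilbert space -/

/-- The first `N` coordinates of a vector. -/
def hcoord (φ : HilbertBasis ℕ ℝ H) (N : ℕ) (x : H) (j : Fin N) : ℝ := inner ℝ (φ j) x

/-- The first `N` normalised coordinates of a vector. -/
def ncoord (φ : HilbertBasis ℕ ℝ H) (lam : ℕ → ℝ) (N : ℕ) (x : H) (j : Fin N) : ℝ :=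
  inner ℝ (φ j) x / lam j

lemma continuous_hcoord (φ : HilbertBasis ℕ ℝ H) (N : ℕ) : Continuous (hcoord φ N) := by
  unfold hcoord; fun_prop

lemma continuous_ncoord (φ : HilbertBasis ℕ ℝ H) (lam : ℕ → ℝ) (N : ℕ) :
    Continuous (ncoord φ lam N) := by
  unfold ncoord; fun_prop

lemma inner_basis (φ : HilbertBasis ℕ ℝ H) (i j : ℕ) :
    inner ℝ (φ i) (φ j) = if i = j then (1 : ℝ) else 0 :=
  orthonormal_iff_ite.1 φ.orthonormal i j

lemma diagN_apply (φ : HilbertBasis ℕ ℝ H) (d : ℕ → ℝ) (N : ℕ) (x : H) :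
    diagN φ d N x = ∑ j ∈ Finset.range N, (d j * inner ℝ (φ j) x) • φ j := by
  simp [diagN, mul_smul]

lemma inner_diagN (φ : HilbertBasis ℕ ℝ H) (d : ℕ → ℝ) (N : ℕ) (i : ℕ) (x : H) :
    inner ℝ (φ i) (diagN φ d N x) = if i < N then d i * inner ℝ (φ i) x else 0 := by
  simp only [diagN_apply, inner_sum, inner_smul_right, inner_basis, mul_ite, mul_one, mul_zero,
    Finset.sum_ite_eq, Finset.mem_range]

lemma norm_sum_basis_sq (φ : HilbertBasis ℕ ℝ H) (c : Fin N → ℝ) :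
    ‖∑ j : Fin N, c j • φ j‖ ^ 2 = ∑ j, c j ^ 2 := by
  have h : Orthonormal ℝ fun j : Fin N => φ j :=
    φ.orthonormal.comp _ Fin.val_injective
  rw [← real_inner_self_eq_norm_sq, h.inner_sum]
  simp [sq]

lemma norm_diagN_sq (φ : HilbertBasis ℕ ℝ H) (d : ℕ → ℝ) (N : ℕ) (x : H) :
    ‖diagN φ d N x‖ ^ 2 = ∑ j : Fin N, (d j * inner ℝ (φ j) x) ^ 2 := by
  rw [diagN_apply, Finset.sum_range, norm_sum_basis_sq φ fun j : Fin N => d j * inner ℝ (φ j) x]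

lemma proj_toSobolev (φ : HilbertBasis ℕ ℝ H) (s : ℝ) (N : ℕ) (x : H) :
    proj N (toSobolev φ s N x) = toSobolev φ s N x := by
  ext j
  simp only [proj, toSobolev, ofFinite, coord_mk]
  split_ifs <;> rfl

lemma toSobolev_eq_embed (hlam : ∀ j, 0 < lam j) (φ : HilbertBasis ℕ ℝ H) (x : H) :
    toSobolev φ s N x = embed s lam (ncoord φ lam N x) := by
  ext j
  rw [coord_embed]
  simp only [toSobolev, ofFinite, coord_mk, ncoord]
  have := (hlam j).ne'
  split_ifs <;> field_simp

lemma psiN_eq (hlam : ∀ j, 0 < lam j) (φ : HilbertBasis ℕ ℝ H) (Ψ : SobolevSpace s → ℝ) (x : H) :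
    psiN Ψ N (toSobolev φ s N x) = Ψ (embed s lam (ncoord φ lam N x)) := by
  rw [psiN, proj_toSobolev, toSobolev_eq_embed hlam]

lemma ncoord_proposal (hlam : ∀ j, 0 < lam j) (φ : HilbertBasis ℕ ℝ H) (ℓ : ℝ) (x ξ : H) :
    ncoord φ lam N (proposal φ lam ℓ N x ξ) =
      ncoord φ lam N x + √(2 * ℓ ^ 2 / N) • hcoord φ N ξ := by
  ext j
  simp only [ncoord, proposal, inner_add_right, inner_smul_right, inner_diagN, j.2, if_true,
    Pi.add_apply, Pi.smul_apply, smul_eq_mul, hcoord]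
  have := (hlam j).ne'
  field_simp

lemma logRatio_eq (hlam : ∀ j, 0 < lam j) (φ : HilbertBasis ℕ ℝ H) (Ψ : SobolevSpace s → ℝ)
    (ℓ : ℝ) (x ξ : H) :
    logRatio φ lam Ψ ℓ N x ξ =
      finQ (fun X => Ψ (embed s lam X)) √(2 * ℓ ^ 2 / N) (ncoord φ lam N x) (hcoord φ N ξ) := by
  have h : ∀ y, ‖diagN φ (fun j => (lam j)⁻¹) N y‖ ^ 2 = ∑ j, ncoord φ lam N y j ^ 2 := by
    intro y
    rw [norm_diagN_sq]
    exact Finset.sum_congr rfl fun j _ => by rw [ncoord, div_eq_inv_mul]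
  simp only [logRatio, h, psiN_eq hlam, ncoord_proposal hlam, finQ, Pi.add_apply, Pi.smul_apply,
    smul_eq_mul]

lemma acceptProb_eq (hlam : ∀ j, 0 < lam j) (φ : HilbertBasis ℕ ℝ H) (Ψ : SobolevSpace s → ℝ)
    (ℓ : ℝ) (x ξ : H) :
    acceptProb φ lam Ψ ℓ N x ξ =
      acc (finQ (fun X => Ψ (embed s lam X)) √(2 * ℓ ^ 2 / N) (ncoord φ lam N x)
        (hcoord φ N ξ)) := by
  rw [acceptProb, logRatio_eq hlam, acc]

/-- The projection `P^N` of `H^r` as a bounded operator. -/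
def projCLM (r : ℝ) (N : ℕ) : SobolevSpace r →L[ℝ] SobolevSpace r :=
  LinearMap.mkContinuous
    { toFun := proj N
      map_add' := fun x y => by
        ext j
        simp only [proj, ofFinite, coord_mk, coord_add]
        split_ifs <;> simp
      map_smul' := fun c x => by
        ext j
        simp only [proj, ofFinite, coord_mk, coord_smul, RingHom.id_apply]
        split_ifs <;> simp }
    1 fun x => by
      rw [one_mul]
      refine abs_le_of_sq_le_sq' ?_ (norm_nonneg _) |>.2
      rw [norm_sq_eq, norm_sq_eq]
      refine Summable.tsum_le_tsum (fun j => ?_) (SobolevSpace.summable _) x.summable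
      refine mul_le_mul_of_nonneg_left ?_ (weight_pos r j).le
      simp only [LinearMap.coe_mk, AddHom.coe_mk, proj, ofFinite, coord_mk]
      split_ifs
      · exact le_rfl
      · simpa using sq_nonneg _

lemma projCLM_apply (r : ℝ) (N : ℕ) (x : SobolevSpace r) : projCLM r N x = proj N x := rfl

lemma proj_basisVec {j : ℕ} (hj : j < N) : proj N (basisVec s j) = basisVec s j := by
  ext k
  simp only [proj, ofFinite, coord_mk, coord_basisVec]
  by_cases h : k = j
  · simp [h, hj]
  · simp [h]

/-- Chain rule: the projection fixes both the base point and the direction `φ_j`, as `j < N`. -/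
lemma coord_grad_psiN (φ : HilbertBasis ℕ ℝ H) {Ψ : SobolevSpace s → ℝ}
    (hd : Differentiable ℝ Ψ) (x : H) {j : ℕ} (hj : j < N) :
    (grad (psiN Ψ N) (toSobolev φ s N x)).coord j =
      (grad Ψ (toSobolev φ s N x)).coord j := by
  have h : psiN Ψ N = Ψ ∘ projCLM s N := rfl
  rw [coord_grad, coord_grad, h, fderiv_comp _ (hd _) (projCLM s N).differentiableAt,
    ContinuousLinearMap.fderiv, ContinuousLinearMap.comp_apply, projCLM_apply, projCLM_apply,
    proj_basisVec hj, proj_toSobolev]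

lemma CN_apply (φ : HilbertBasis ℕ ℝ H) {C : H →L[ℝ] H} (hC : ∀ j, C (φ j) = (lam j) ^ 2 • φ j)
    (N : ℕ) : CN φ C N = diagN φ (fun j => lam j ^ 2) N := by
  ext x
  have h : C (PN φ N x) = ∑ j ∈ Finset.range N, (lam j ^ 2 * inner ℝ (φ j) x) • φ j := by
    rw [PN, diagN_apply, map_sum]
    refine Finset.sum_congr rfl fun j _ => ?_
    rw [map_smul, hC, one_mul, smul_smul, mul_comm]
  simp only [CN, ContinuousLinearMap.comp_apply]
  rw [h, ← diagN_apply φ (fun j => lam j ^ 2), PN, diagN_apply φ (fun _ => 1)]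
  conv_rhs => rw [diagN_apply]
  refine Finset.sum_congr rfl fun j hj => ?_
  rw [inner_diagN, if_pos (Finset.mem_range.1 hj), one_mul]

lemma inner_drift (hlam : ∀ j, 0 < lam j) (φ : HilbertBasis ℕ ℝ H) {C : H →L[ℝ] H}
    (hC : ∀ j, C (φ j) = (lam j) ^ 2 • φ j) {Ψ : SobolevSpace s → ℝ} (hd : Differentiable ℝ Ψ)
    (x : H) (i : Fin N) :
    inner ℝ (φ i) (PN φ N x + CN φ C N (gradPsiN φ Ψ N x)) =
      lam i * (ncoord φ lam N x i + finGrad lam Ψ (ncoord φ lam N x) i) := by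
  have h1 : inner ℝ (φ i) (gradPsiN φ Ψ N x) = (grad Ψ (toSobolev φ s N x)).coord i := by
    rw [gradPsiN]
    simp only [inner_sum, inner_smul_right, inner_basis, mul_ite, mul_one, mul_zero,
      Finset.sum_ite_eq, Finset.mem_range, i.2, if_true]
    exact coord_grad_psiN φ hd x i.2
  rw [CN_apply φ hC, inner_add_right, PN, inner_diagN, inner_diagN, if_pos i.2, if_pos i.2, h1,
    finGrad, ncoord, toSobolev_eq_embed hlam]
  have := (hlam i).ne'
  field_simp

lemma inner_drift_eq_zero (φ : HilbertBasis ℕ ℝ H) {C : H →L[ℝ] H}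
    (hC : ∀ j, C (φ j) = (lam j) ^ 2 • φ j) (x y : H) {i : ℕ} (hi : ¬ i < N) :
    inner ℝ (φ i) (PN φ N x + CN φ C N y) = 0 := by
  rw [CN_apply φ hC, inner_add_right, PN, inner_diagN, inner_diagN, if_neg hi, if_neg hi,
    add_zero]

lemma sobInner_basis (φ : HilbertBasis ℕ ℝ H) (s : ℝ) (i : ℕ) (v : H) :
    sobInner φ s (φ i) v = weight s i * inner ℝ (φ i) v := by
  rw [sobInner, tsum_eq_single i]
  · rw [inner_basis, if_pos rfl, one_mul]
  · intro j hj
    rw [inner_basis, if_neg hj, zero_mul, mul_zero]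

lemma hcoord_sum (φ : HilbertBasis ℕ ℝ H) (z : Fin N → ℝ) :
    hcoord φ N (∑ i : Fin N, z i • φ i) = z := by
  ext j
  simp only [hcoord, inner_sum, inner_smul_right, inner_basis, mul_ite, mul_one, mul_zero,
    Fin.val_inj, Finset.sum_ite_eq, Finset.mem_univ, if_true]

/-! ### Gaussian laws of the coordinates, and the density of the target. -/

section Laws

variable [MeasurableSpace H] [BorelSpace H]

lemma measurable_sum_basis (φ : HilbertBasis ℕ ℝ H) :
    Measurable fun z : Fin N → ℝ => ∑ i : Fin N, z i • φ i :=
  Continuous.measurable (by fun_prop)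

lemma map_hcoord_noiseLaw (φ : HilbertBasis ℕ ℝ H) (N : ℕ) :
    (noiseLaw φ N).map (hcoord φ N) = stdPi N := by
  rw [noiseLaw, Measure.map_map (continuous_hcoord φ N).measurable (measurable_sum_basis φ)]
  have : (hcoord φ N ∘ fun z : Fin N → ℝ => ∑ i : Fin N, z i • φ i) = id := by
    ext1 z; exact hcoord_sum φ z
  rw [this, Measure.map_id]

variable [CompleteSpace H] [TopologicalSpace.SeparableSpace H]

/-- The normalised coordinates are jointly Gaussian, centred and uncorrelated with unit variance,
hence independent. -/
lemma map_ncoord (hlam : ∀ j, 0 < lam j) (φ : HilbertBasis ℕ ℝ H) {C : H →L[ℝ] H}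
    (hC : ∀ j, C (φ j) = (lam j) ^ 2 • φ j) {π₀ : Measure H} (hπ₀ : IsCenteredGaussian π₀ C)
    (N : ℕ) : π₀.map (ncoord φ lam N) = stdPi N := by
  have hG := hπ₀.gaussian
  have : SecondCountableTopology H := UniformSpace.secondCountable_of_separable H
  have hmem : MemLp id 2 π₀ := IsGaussian.memLp_two_id
  let L : H →L[ℝ] (Fin N → ℝ) :=
    ContinuousLinearMap.pi fun j => (lam j)⁻¹ • innerSL ℝ (φ j)
  have hL : ∀ x, L x = ncoord φ lam N x := fun x => by
    ext j; simp [L, ncoord, div_eq_inv_mul]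
  have hlaw : HasGaussianLaw (fun x : H => fun j => ncoord φ lam N x j) π₀ := by
    have := (IsGaussian.hasGaussianLaw_id (μ := π₀)).map_fun L
    simpa only [id, hL] using this
  have hcov : ∀ i j : Fin N, cov[fun x => ncoord φ lam N x i, fun x => ncoord φ lam N x j; π₀] =
      if i = j then 1 else 0 := by
    intro i j
    have h1 := covarianceBilin_apply_eq_cov hmem (φ i) (φ j)
    rw [hπ₀.covariance, hC, inner_smul_left, inner_basis] at h1
    simp only [ncoord, div_eq_inv_mul]
    rw [covariance_const_mul_left, covariance_const_mul_right, ← h1]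
    simp only [conj_trivial, Fin.val_inj]
    split_ifs with hij
    · subst hij
      have := (hlam i).ne'
      field_simp
    · simp
  have hmean : ∀ j : Fin N, ∫ x, ncoord φ lam N x j ∂π₀ = 0 := by
    intro j
    have h1 := IsGaussian.integral_dual (μ := π₀) (innerSL ℝ (φ j))
    rw [hπ₀.mean_zero, map_zero] at h1
    simp only [ncoord, integral_div]
    simp only [innerSL_apply_apply] at h1
    rw [h1, zero_div]
  have hind : iIndepFun (fun (j : Fin N) x => ncoord φ lam N x j) π₀ :=
    hlaw.iIndepFun_of_covariance_eq_zero fun i j hij => by rw [hcov, if_neg hij]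
  have hm : ∀ j : Fin N, Measurable fun x => ncoord φ lam N x j := fun j =>
    ((continuous_apply j).comp (continuous_ncoord φ lam N)).measurable
  have h := (iIndepFun_iff_map_fun_eq_pi_map fun j => (hm j).aemeasurable).1 hind
  refine h.trans ?_
  congr 1
  ext1 j
  rw [(hlaw.eval j).map_eq_gaussianReal, hmean, ← covariance_self (hm j).aemeasurable, hcov,
    if_pos rfl, Real.toNNReal_one]

/-- The densities of the target measures with respect to the Gaussian reference measure are bounded
uniformly in the dimension. -/
lemma exists_lintegral_targetN_le (hlam : ∀ j, 0 < lam j)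
    (hsum : Summable fun j => weight s j * lam j ^ 2) (φ : HilbertBasis ℕ ℝ H) {C : H →L[ℝ] H}
    (hC : ∀ j, C (φ j) = (lam j) ^ 2 • φ j) {π₀ : Measure H} (hπ₀ : IsCenteredGaussian π₀ C)
    {Ψ : SobolevSpace s → ℝ} (hd : Differentiable ℝ Ψ) {M₁ M₂ : ℝ} (h1 : ∀ x, M₁ ≤ Ψ x)
    (h2 : ∀ x, Ψ x ≤ M₂ * (1 + ‖x‖ ^ 2)) :
    ∃ K : ℝ, 0 ≤ K ∧ ∀ (N : ℕ) (f : (Fin N → ℝ) → ENNReal), Measurable f →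
      ∫⁻ x, f (ncoord φ lam N x) ∂(targetN φ Ψ π₀ N) ≤ ENNReal.ofReal K * ∫⁻ X, f X ∂(stdPi N) := by
  set S := ∑' j, weight s j * lam j ^ 2 with hS
  have hM2 : 0 ≤ |M₂| := abs_nonneg _
  refine ⟨Real.exp (-M₁) / Real.exp (-(|M₂| * (1 + S))), by positivity, fun N f hf => ?_⟩
  have hG := hπ₀.gaussian
  have hm := (continuous_ncoord φ lam N).measurable
  let V : (Fin N → ℝ) → ℝ := fun X => Ψ (embed s lam X)
  have hV : Continuous V := hd.continuous.comp (continuous_embed s lam)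
  have hZ : Real.exp (-(|M₂| * (1 + S))) ≤
      ∫ x, Real.exp (-psiN Ψ N (toSobolev φ s N x)) ∂π₀ := by
    have e1 : ∫ x, Real.exp (-psiN Ψ N (toSobolev φ s N x)) ∂π₀ =
        ∫ X, Real.exp (-V X) ∂(stdPi N) := by
      simp only [psiN_eq hlam]
      rw [← map_ncoord hlam φ hC hπ₀ N, integral_map hm.aemeasurable
        (Continuous.aestronglyMeasurable (by fun_prop))]
    rw [e1]
    -- Jensen by a tangent line: `exp (-t) ≥ exp (-c) (1 + c - t)` for `t = |M₂| (1 + wsq X)`, whose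
    -- mean is at most `c`. The absolute value is taken because `M₂` may have either sign.
    set c := |M₂| * (1 + S) with hc
    have hw := integrable_wsq (finWeight s lam N)
    have i1 : Integrable (fun X => Real.exp (-c) *
        (1 + c - |M₂| * (1 + wsq (finWeight s lam N) X))) (stdPi N) :=
      ((integrable_const _).sub (((integrable_const _).add hw).const_mul _)).const_mul _
    have i2 : Integrable (fun X => Real.exp (-V X)) (stdPi N) := by
      refine integrable_of_bounded (c := Real.exp (-M₁)) (by fun_prop) fun X => ?_
      rw [abs_of_pos (Real.exp_pos _), Real.exp_le_exp]
      linarith [h1 (embed s lam X)]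
    have i3 : Integrable (fun X : Fin N → ℝ => 1 + wsq (finWeight s lam N) X) (stdPi N) :=
      (integrable_const _).add hw
    have e2 := integral_mono i1 i2 fun X => ?_
    · refine le_trans ?_ e2
      rw [integral_const_mul, integral_sub (integrable_const _) (i3.const_mul _),
        integral_const_mul, integral_add (integrable_const _) hw, integral_wsq]
      simp only [integral_const, probReal_univ, one_smul]
      have := sum_finWeight_le hsum N
      refine le_mul_of_one_le_right (Real.exp_pos _).le ?_
      have : |M₂| * (1 + ∑ j, finWeight s lam N j) ≤ c := by rw [hc]; gcongr
      linarith
    · set t := |M₂| * (1 + wsq (finWeight s lam N) X) with ht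
      have e3 : V X ≤ t := by
        refine (h2 _).trans ?_
        rw [norm_embed_sq, ht]
        have := wsq_nonneg (finWeight_nonneg s lam N) X
        gcongr
        exact le_abs_self _
      calc Real.exp (-c) * (1 + c - t) ≤ Real.exp (-c) * Real.exp (c - t) := by
            gcongr; linarith [Real.add_one_le_exp (c - t)]
        _ = Real.exp (-t) := by rw [← Real.exp_add]; ring_nf
        _ ≤ _ := Real.exp_le_exp.2 (by linarith)
  have hmf : Measurable fun x => f (ncoord φ lam N x) := hf.comp hm
  have hdm : Measurable fun x => ENNReal.ofReal (Real.exp (-psiN Ψ N (toSobolev φ s N x)) /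
      ∫ x, Real.exp (-psiN Ψ N (toSobolev φ s N x)) ∂π₀) := by
    simp only [psiN_eq hlam]
    have : Measurable fun x => V (ncoord φ lam N x) := hV.measurable.comp hm
    exact ((Real.measurable_exp.comp this.neg).div_const _).ennreal_ofReal
  rw [targetN, Measure.tilted, lintegral_withDensity_eq_lintegral_mul _ hdm hmf,
    ← map_ncoord hlam φ hC hπ₀ N, lintegral_map hf hm, ← lintegral_const_mul _ hmf]
  refine lintegral_mono fun x => ?_
  simp only [Pi.mul_apply]
  gcongr
  rw [psiN_eq hlam]
  exact h1 _

end Laws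

end

end RWM

namespace RWM

noncomputable section

open SobolevSpace

variable {H : Type*} [NormedAddCommGroup H] [InnerProductSpace ℝ H] [MeasurableSpace H]
variable {s : ℝ} {lam : ℕ → ℝ} {N : ℕ}
variable {Ω : Type*} [MeasurableSpace Ω] {P : Measure Ω} {φ : HilbertBasis ℕ ℝ H}
  {Ψ : SobolevSpace s → ℝ} {π₀ : Measure H} {ℓ : ℝ} {x ξ : ℕ → Ω → H} {γ : ℕ → Ω → ℝ}

/-! ### One step of the chain -/

namespace IsRWMChain

/-- The variables `ξ 0` and `γ 0` are constant, so they generate the trivial σ-algebra. -/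
lemma history_zero (h : IsRWMChain P φ lam Ψ π₀ ℓ N x ξ γ) :
    history x ξ γ 0 = MeasurableSpace.comap (x 0) inferInstance := by
  have h1 : MeasurableSpace.comap (ξ 0) inferInstance = (⊥ : MeasurableSpace Ω) := by
    rw [h.noise_zero]; exact MeasurableSpace.comap_const _
  have h2 : MeasurableSpace.comap (γ 0) inferInstance = (⊥ : MeasurableSpace Ω) := by
    rw [h.accept_zero]; exact MeasurableSpace.comap_const _
  simp [history, h1, h2]

lemma abs_accept_le_one (h : IsRWMChain P φ lam Ψ π₀ ℓ N x ξ γ) (ω : Ω) : |γ 1 ω| ≤ 1 := by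
  rcases h.accept_values 0 ω with h | h <;> simp only [zero_add] at h <;> simp [h]

lemma integrable_accept [IsProbabilityMeasure P]
    (h : IsRWMChain P φ lam Ψ π₀ ℓ N x ξ γ) : Integrable (γ 1) P :=
  Integrable.of_bound (h.measurable_accept 1).aestronglyMeasurable 1
    (Eventually.of_forall h.abs_accept_le_one)

variable [BorelSpace H]

lemma measurable_hcoord_noise (h : IsRWMChain P φ lam Ψ π₀ ℓ N x ξ γ) :
    Measurable fun ω => hcoord φ N (ξ 1 ω) :=
  (continuous_hcoord φ N).measurable.comp (h.measurable_noise 1)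

lemma map_hcoord_noise (h : IsRWMChain P φ lam Ψ π₀ ℓ N x ξ γ) :
    P.map (fun ω => hcoord φ N (ξ 1 ω)) = stdPi N := by
  have := Measure.map_map (μ := P) (continuous_hcoord φ N).measurable (h.measurable_noise 1)
  rw [h.law_noise 0, map_hcoord_noiseLaw] at this
  exact this.symm

lemma integrable_noise (h : IsRWMChain P φ lam Ψ π₀ ℓ N x ξ γ) {p : (Fin N → ℝ) → ℝ}
    (hp : Integrable p (stdPi N)) : Integrable (fun ω => p (hcoord φ N (ξ 1 ω))) P := by
  rw [← h.map_hcoord_noise] at hp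
  exact hp.comp_measurable h.measurable_hcoord_noise

lemma integrable_accept_mul (h : IsRWMChain P φ lam Ψ π₀ ℓ N x ξ γ) {p : (Fin N → ℝ) → ℝ}
    (hp : Integrable p (stdPi N)) :
    Integrable (fun ω => γ 1 ω * p (hcoord φ N (ξ 1 ω))) P :=
  (h.integrable_noise hp).bdd_mul (h.measurable_accept 1).aestronglyMeasurable
    (Eventually.of_forall h.abs_accept_le_one)

variable [IsProbabilityMeasure P]

/-- Conditional expectations given the initial state, for functions of the acceptance variable and
of the noise. -/
lemma condExp_accept_mul (h : IsRWMChain P φ lam Ψ π₀ ℓ N x ξ γ) (hlam : ∀ j, 0 < lam j)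
    (hV : Continuous fun X : Fin N → ℝ => Ψ (embed s lam X)) {p : (Fin N → ℝ) → ℝ}
    (hpc : Continuous p) (hp : Integrable p (stdPi N)) :
    P[fun ω => γ 1 ω * p (hcoord φ N (ξ 1 ω)) | history x ξ γ 0] =ᵐ[P] fun ω =>
      ∫ z, acc (finQ (fun X => Ψ (embed s lam X)) √(2 * ℓ ^ 2 / N) (ncoord φ lam N (x 0 ω)) z) *
        p z ∂(stdPi N) := by
  set f : H × (Fin N → ℝ) → ℝ := fun q =>
    acc (finQ (fun X => Ψ (embed s lam X)) √(2 * ℓ ^ 2 / N) (ncoord φ lam N q.1) q.2) * p q.2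
    with hf
  have hfm : Measurable f := by
    have h1 : Measurable fun q : H × (Fin N → ℝ) => (ncoord φ lam N q.1, q.2) :=
      ((continuous_ncoord φ lam N).measurable.comp measurable_fst).prodMk measurable_snd
    have h2 := (continuous_acc.comp (continuous_finQ hV √(2 * ℓ ^ 2 / N))).measurable.comp h1
    exact h2.mul (hpc.measurable.comp measurable_snd)
  have hx := h.measurable_x 0
  have hz := h.measurable_hcoord_noise
  have hint : Integrable (fun ω => f (x 0 ω, hcoord φ N (ξ 1 ω))) P := by
    refine (h.integrable_noise hp).mono (hfm.comp (hx.prodMk hz)).aestronglyMeasurable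
      (Eventually.of_forall fun ω => ?_)
    simp only [hf, norm_mul]
    exact mul_le_of_le_one_left (norm_nonneg _) (abs_acc_le_one _)
  have hle0 : history x ξ γ 0 ≤ ‹MeasurableSpace Ω› := by
    rw [h.history_zero]; exact hx.comap_le
  have hle : history x ξ γ 0 ⊔ MeasurableSpace.comap (ξ 1) inferInstance ≤ ‹MeasurableSpace Ω› :=
    sup_le hle0 (h.measurable_noise 1).comap_le
  have hpm : StronglyMeasurable[history x ξ γ 0 ⊔ MeasurableSpace.comap (ξ 1) inferInstance]
      fun ω => p (hcoord φ N (ξ 1 ω)) := by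
    refine Measurable.stronglyMeasurable ?_
    have h1 : Measurable[MeasurableSpace.comap (ξ 1) inferInstance] (ξ 1) :=
      comap_measurable (ξ 1)
    exact ((hpc.comp (continuous_hcoord φ N)).measurable.comp h1).mono le_sup_right le_rfl
  -- Conditioning first on the past and the noise: the factor `p` is measurable and comes out, and
  -- `γ 1` becomes the acceptance probability. The tower property then returns to the past alone.
  have e1 : P[fun ω => γ 1 ω * p (hcoord φ N (ξ 1 ω)) |
      history x ξ γ 0 ⊔ MeasurableSpace.comap (ξ 1) inferInstance] =ᵐ[P]
        fun ω => f (x 0 ω, hcoord φ N (ξ 1 ω)) := by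
    filter_upwards [condExp_mul_of_stronglyMeasurable_right hpm (h.integrable_accept_mul hp)
      h.integrable_accept, h.accept_prob 0] with ω h1 h2
    refine h1.trans ?_
    simp only [zero_add] at h2
    rw [Pi.mul_apply, h2, acceptProb_eq hlam]
  have e2 := (condExp_condExp_of_le (f := fun ω => γ 1 ω * p (hcoord φ N (ξ 1 ω)))
    (le_sup_left (a := history x ξ γ 0) (b := MeasurableSpace.comap (ξ 1) inferInstance))
    hle).symm.trans (condExp_congr_ae e1)
  refine e2.trans ?_
  rw [h.history_zero]
  have hind : IndepFun (x 0) (fun ω => hcoord φ N (ξ 1 ω)) P := by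
    have h1 := (h.indep_noise 0).symm
    rw [h.history_zero] at h1
    have h2 : IndepFun (x 0) (ξ 1) P := (IndepFun_iff_Indep _ _ _).2 h1
    exact h2.comp measurable_id (continuous_hcoord φ N).measurable
  have hlaw := (indepFun_iff_map_prod_eq_prod_map_map hx.aemeasurable hz.aemeasurable).1 hind
  rw [h.map_hcoord_noise, ← Measure.compProd_const] at hlaw
  -- The noise is independent of `x 0`, so its conditional law is the constant kernel `stdPi N`.
  have e3 := ae_of_ae_map hx.aemeasurable
    (condDistrib_ae_eq_of_measure_eq_compProd (x 0) hz.aemeasurable hlaw)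
  filter_upwards [condExp_prod_ae_eq_integral_condDistrib hx hz.aemeasurable
    hfm.stronglyMeasurable hint, e3] with ω h1 h2
  rw [h1, h2, Kernel.const_apply]

end IsRWMChain

end

end RWM

/-! ### The increment of the chain and its conditional moments. -/

namespace RWM

noncomputable section

open SobolevSpace

variable {H : Type*} [NormedAddCommGroup H] [InnerProductSpace ℝ H] [MeasurableSpace H]
variable {s : ℝ} {lam : ℕ → ℝ} {N : ℕ}
variable {Ω : Type*} [MeasurableSpace Ω] {P : Measure Ω} {φ : HilbertBasis ℕ ℝ H}
  {Ψ : SobolevSpace s → ℝ} {π₀ : Measure H} {ℓ : ℝ} {x ξ : ℕ → Ω → H} {γ : ℕ → Ω → ℝ}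

namespace IsRWMChain

lemma increment_eq (h : IsRWMChain P φ lam Ψ π₀ ℓ N x ξ γ) (ω : Ω) :
    x 1 ω - x 0 ω = (γ 1 ω * √(2 * ℓ ^ 2 / N)) • diagN φ lam N (ξ 1 ω) := by
  have := h.step 0 ω
  simp only [zero_add] at this
  rw [this, proposal]
  module

lemma inner_increment (h : IsRWMChain P φ lam Ψ π₀ ℓ N x ξ γ) (ω : Ω) (i : ℕ) :
    inner ℝ (φ i) (x 1 ω - x 0 ω) =
      if i < N then γ 1 ω * √(2 * ℓ ^ 2 / N) * (lam i * inner ℝ (φ i) (ξ 1 ω)) else 0 := by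
  rw [h.increment_eq, inner_smul_right, inner_diagN, mul_ite, mul_zero]

/-- Since `γ² = γ`, the product is again linear in `γ`, so `condExp_accept_mul` also covers second
moments. -/
lemma inner_increment_mul (h : IsRWMChain P φ lam Ψ π₀ ℓ N x ξ γ) (ω : Ω) (i j : Fin N) :
    inner ℝ (φ i) (x 1 ω - x 0 ω) * inner ℝ (φ j) (x 1 ω - x 0 ω) =
      γ 1 ω * (2 * ℓ ^ 2 / N * (lam i * lam j) *
        (hcoord φ N (ξ 1 ω) i * hcoord φ N (ξ 1 ω) j)) := by
  have hτ : √(2 * ℓ ^ 2 / N) * √(2 * ℓ ^ 2 / N) = 2 * ℓ ^ 2 / N :=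
    Real.mul_self_sqrt (by positivity)
  have hγ : γ 1 ω * γ 1 ω = γ 1 ω := by
    rcases h.accept_values 0 ω with h | h <;> simp only [zero_add] at h <;> simp [h]
  rw [h.inner_increment, h.inner_increment, if_pos i.2, if_pos j.2]
  simp only [hcoord]
  calc _ = (γ 1 ω * γ 1 ω) * ((√(2 * ℓ ^ 2 / N) * √(2 * ℓ ^ 2 / N)) * (lam i * lam j) *
        (inner ℝ (φ i) (ξ 1 ω) * inner ℝ (φ j) (ξ 1 ω))) := by ring
    _ = _ := by rw [hτ, hγ]

variable [BorelSpace H] [TopologicalSpace.SeparableSpace H]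

lemma aestronglyMeasurable_increment (h : IsRWMChain P φ lam Ψ π₀ ℓ N x ξ γ) :
    AEStronglyMeasurable (fun ω => x 1 ω - x 0 ω) P := by
  have : SecondCountableTopology H := UniformSpace.secondCountable_of_separable H
  exact ((h.measurable_x 1).sub (h.measurable_x 0)).aestronglyMeasurable

/-- The increment is dominated by the proposed move, a finite Gaussian sum; no moment of `x 0`
enters. -/
lemma memLp_increment (h : IsRWMChain P φ lam Ψ π₀ ℓ N x ξ γ) :
    MemLp (fun ω => x 1 ω - x 0 ω) 2 P := by
  rw [memLp_two_iff_integrable_sq_norm h.aestronglyMeasurable_increment]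
  have hi : Integrable (fun z : Fin N → ℝ => ∑ j : Fin N, (√(2 * ℓ ^ 2 / N) * lam j) ^ 2 * z j ^ 2)
      (stdPi N) :=
    integrable_finsetSum _ fun j _ => (integrable_eval_pow j 2).const_mul _
  refine (h.integrable_noise hi).mono (h.aestronglyMeasurable_increment.norm.pow 2)
    (Eventually.of_forall fun ω => ?_)
  have h0 : 0 ≤ ∑ j : Fin N, (√(2 * ℓ ^ 2 / N) * lam j) ^ 2 * hcoord φ N (ξ 1 ω) j ^ 2 :=
    Finset.sum_nonneg fun j _ => by positivity
  have hγ : γ 1 ω ^ 2 ≤ 1 := by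
    rw [sq_le_one_iff_abs_le_one]; exact h.abs_accept_le_one ω
  rw [Real.norm_of_nonneg (by positivity), Real.norm_of_nonneg h0, h.increment_eq, norm_smul,
    mul_pow, norm_diagN_sq, Real.norm_eq_abs, sq_abs, mul_pow, mul_assoc, Finset.mul_sum]
  refine (mul_le_of_le_one_left (Finset.sum_nonneg fun j _ => by positivity) hγ).trans_eq ?_
  refine Finset.sum_congr rfl fun j _ => ?_
  rw [hcoord]
  ring

lemma integrable_rankOne_increment (h : IsRWMChain P φ lam Ψ π₀ ℓ N x ξ γ) :
    Integrable (fun ω => InnerProductSpace.rankOne ℝ (x 1 ω - x 0 ω) (x 1 ω - x 0 ω)) P := by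
  have hc : Continuous fun v : H => InnerProductSpace.rankOne ℝ v v :=
    (InnerProductSpace.rankOne ℝ (E := H) (F := H)).continuous.clm_apply continuous_id
  refine ((memLp_two_iff_integrable_sq_norm h.aestronglyMeasurable_increment).1
    h.memLp_increment).mono (hc.comp_aestronglyMeasurable h.aestronglyMeasurable_increment)
    (Eventually.of_forall fun ω => ?_)
  rw [InnerProductSpace.norm_rankOne, Real.norm_of_nonneg (by positivity), sq]

variable [IsProbabilityMeasure P]

lemma integrable_increment (h : IsRWMChain P φ lam Ψ π₀ ℓ N x ξ γ) :
    Integrable (fun ω => x 1 ω - x 0 ω) P :=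
  h.memLp_increment.integrable one_le_two

variable [CompleteSpace H]

/-- Bounded linear functionals commute with the Bochner conditional expectation, which reduces the
vector statement to a scalar one. -/
lemma inner_condExp_increment (h : IsRWMChain P φ lam Ψ π₀ ℓ N x ξ γ) (hlam : ∀ j, 0 < lam j)
    (hV : Continuous fun X : Fin N → ℝ => Ψ (embed s lam X)) (i : Fin N) :
    ∀ᵐ ω ∂P, inner ℝ (φ i) (condExp (history x ξ γ 0) P (fun ω' => x 1 ω' - x 0 ω') ω) =
      √(2 * ℓ ^ 2 / N) * lam i * ∫ z, acc (finQ (fun X => Ψ (embed s lam X)) √(2 * ℓ ^ 2 / N)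
        (ncoord φ lam N (x 0 ω)) z) * z i ∂(stdPi N) := by
  have h1 := (innerSL ℝ (φ i)).comp_condExp_comm (m := history x ξ γ 0) h.integrable_increment
  have h2 : (innerSL ℝ (φ i)) ∘ (fun ω => x 1 ω - x 0 ω) =
      fun ω => γ 1 ω * (fun z : Fin N → ℝ => √(2 * ℓ ^ 2 / N) * lam i * z i)
        (hcoord φ N (ξ 1 ω)) := by
    ext ω
    rw [Function.comp_apply, innerSL_apply_apply, h.inner_increment, if_pos i.2]
    simp only [hcoord]
    ring
  rw [h2] at h1
  filter_upwards [h1, h.condExp_accept_mul hlam hV (p := fun z => √(2 * ℓ ^ 2 / N) * lam i * z i)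
    (by fun_prop) ((integrable_eval i).const_mul _)] with ω e1 e2
  rw [Function.comp_apply, innerSL_apply_apply] at e1
  rw [e1, e2, ← integral_const_mul]
  congr 1 with z
  ring

lemma inner_condExp_increment_eq_zero (h : IsRWMChain P φ lam Ψ π₀ ℓ N x ξ γ) {i : ℕ}
    (hi : ¬ i < N) :
    ∀ᵐ ω ∂P, inner ℝ (φ i) (condExp (history x ξ γ 0) P (fun ω' => x 1 ω' - x 0 ω') ω) =
      0 := by
  have h1 := (innerSL ℝ (φ i)).comp_condExp_comm (m := history x ξ γ 0) h.integrable_increment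
  have h2 : (innerSL ℝ (φ i)) ∘ (fun ω => x 1 ω - x 0 ω) = 0 := by
    ext ω
    rw [Function.comp_apply, innerSL_apply_apply, h.inner_increment, if_neg hi, Pi.zero_apply]
  rw [h2, condExp_zero] at h1
  filter_upwards [h1] with ω e1
  rwa [Function.comp_apply, innerSL_apply_apply] at e1

lemma inner_condExp_rankOne (h : IsRWMChain P φ lam Ψ π₀ ℓ N x ξ γ) (hlam : ∀ j, 0 < lam j)
    (hV : Continuous fun X : Fin N → ℝ => Ψ (embed s lam X)) (i j : Fin N) :
    ∀ᵐ ω ∂P, inner ℝ (φ i) (condExp (history x ξ γ 0) P (fun ω' =>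
        InnerProductSpace.rankOne ℝ (x 1 ω' - x 0 ω') (x 1 ω' - x 0 ω')) ω (φ j)) =
      2 * ℓ ^ 2 / N * (lam i * lam j) * ∫ z, acc (finQ (fun X => Ψ (embed s lam X))
        √(2 * ℓ ^ 2 / N) (ncoord φ lam N (x 0 ω)) z) * (z i * z j) ∂(stdPi N) := by
  let T : (H →L[ℝ] H) →L[ℝ] ℝ := innerSL ℝ (φ i) ∘L ContinuousLinearMap.apply ℝ H (φ j)
  have hT : ∀ A : H →L[ℝ] H, T A = inner ℝ (φ i) (A (φ j)) := fun A => rfl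
  have h1 := T.comp_condExp_comm (m := history x ξ γ 0) h.integrable_rankOne_increment
  have h2 : (T ∘ fun ω' => InnerProductSpace.rankOne ℝ (x 1 ω' - x 0 ω') (x 1 ω' - x 0 ω')) =
      fun ω => γ 1 ω * (fun z : Fin N → ℝ => 2 * ℓ ^ 2 / N * (lam i * lam j) * (z i * z j))
        (hcoord φ N (ξ 1 ω)) := by
    ext ω
    rw [Function.comp_apply, hT, InnerProductSpace.rankOne_apply, inner_smul_right,
      ← h.inner_increment_mul, real_inner_comm (φ j), mul_comm]
  rw [h2] at h1
  filter_upwards [h1, h.condExp_accept_mul hlam hV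
    (p := fun z => 2 * ℓ ^ 2 / N * (lam i * lam j) * (z i * z j))
    (by fun_prop) ((integrable_eval_mul i j).const_mul _)] with ω e1 e2
  rw [Function.comp_apply, hT] at e1
  rw [e1, e2, ← integral_const_mul]
  congr 1 with z
  ring

end IsRWMChain

end

end RWM

namespace RWM

noncomputable section

open SobolevSpace

/-! ### The error terms -/

section Rate

/-- The rate `N ^ (-1/4)` at which the errors vanish. -/
def rate (N : ℕ) : ℝ := (N : ℝ) ^ (-(1 / 4) : ℝ)

lemma rate_pos {N : ℕ} (hN : 0 < N) : 0 < rate N :=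
  Real.rpow_pos_of_pos (Nat.cast_pos.2 hN) _

lemma rate_le_one {N : ℕ} (hN : 0 < N) : rate N ≤ 1 :=
  Real.rpow_le_one_of_one_le_of_nonpos (Nat.one_le_cast.2 hN) (by norm_num)

lemma rate_pow_four_mul {N : ℕ} (hN : 0 < N) : rate N ^ 4 * N = 1 := by
  have h : (0 : ℝ) < N := Nat.cast_pos.2 hN
  rw [rate, ← Real.rpow_natCast, ← Real.rpow_mul h.le]
  norm_num
  rw [Real.rpow_neg_one, inv_mul_cancel₀ h.ne']

lemma tendsto_rate : Tendsto rate atTop (𝓝 0) :=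
  (tendsto_rpow_neg_atTop (y := 1 / 4) (by norm_num)).comp tendsto_natCast_atTop_atTop

lemma tendsto_zero_of_le_rate {u : ℕ → ENNReal} (c : ℝ)
    (h : ∀ᶠ N in atTop, u N ≤ ENNReal.ofReal (c * rate N)) : Tendsto u atTop (𝓝 0) := by
  refine tendsto_of_tendsto_of_tendsto_of_le_of_le' tendsto_const_nhds ?_
    (Eventually.of_forall fun _ => zero_le) h
  simpa using ENNReal.tendsto_ofReal (tendsto_rate.const_mul c)

end Rate

variable {H : Type*} [NormedAddCommGroup H] [InnerProductSpace ℝ H] [MeasurableSpace H]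
variable {s : ℝ} {lam : ℕ → ℝ} {N : ℕ}
variable {Ω : Type*} [MeasurableSpace Ω]

section

variable [CompleteSpace H]

/-- The error in the drift of one step of the chain. -/
def driftError (P : Measure Ω) (φ : HilbertBasis ℕ ℝ H) (C : H →L[ℝ] H) (Ψ : SobolevSpace s → ℝ)
    (ℓ : ℝ) (N : ℕ) (x ξ : ℕ → Ω → H) (γ : ℕ → Ω → ℝ) (ω : Ω) : H :=
  (N : ℝ) • condExp (history x ξ γ 0) P (fun ω' => x 1 ω' - x 0 ω') ω -
    -(ℓ ^ 2 * beta ℓ) • (PN φ N (x 0 ω) + CN φ C N (gradPsiN φ Ψ N (x 0 ω)))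

/-- The error in the covariance of one step of the chain. -/
def covError (P : Measure Ω) (φ : HilbertBasis ℕ ℝ H) (C : H →L[ℝ] H)
    (ℓ : ℝ) (N : ℕ) (x ξ : ℕ → Ω → H) (γ : ℕ → Ω → ℝ) (ω : Ω) : H →L[ℝ] H :=
  (N : ℝ) • condExp (history x ξ γ 0) P (fun ω' =>
      InnerProductSpace.rankOne ℝ (x 1 ω' - x 0 ω') (x 1 ω' - x 0 ω')) ω -
    (2 * ℓ ^ 2 * beta ℓ) • CN φ C N

end

variable {P : Measure Ω} {φ : HilbertBasis ℕ ℝ H}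
  {Ψ : SobolevSpace s → ℝ} {π₀ : Measure H} {ℓ : ℝ} {x ξ : ℕ → Ω → H} {γ : ℕ → Ω → ℝ}
  {C : H →L[ℝ] H}

variable (s lam N) in
/-- The weighted sum of the functions that dominate the errors of the coordinates. -/
def totalDom (X : Fin N → ℝ) : ℝ :=
  ∑ i, finWeight s lam N i * stateDom (finWeight s lam N) i X

lemma totalDom_nonneg (X : Fin N → ℝ) : 0 ≤ totalDom s lam N X :=
  Finset.sum_nonneg fun i _ => mul_nonneg (finWeight_nonneg s lam N i) (stateDom_nonneg _ _ _)

lemma sum_ofReal_le_totalDom {c : ℝ} {f : Fin N → ℝ} {X : Fin N → ℝ}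
    (h0 : ∀ i, 0 ≤ f i)
    (h : ∀ i, f i ≤ finWeight s lam N i * (c * stateDom (finWeight s lam N) i X)) :
    ∑ i, ENNReal.ofReal (f i) ≤ ENNReal.ofReal (c * totalDom s lam N X) := by
  rw [← ENNReal.ofReal_sum_of_nonneg fun i _ => h0 i]
  refine ENNReal.ofReal_le_ofReal ?_
  rw [totalDom, Finset.mul_sum]
  exact Finset.sum_le_sum fun i _ => (h i).trans_eq (by ring)

lemma measurable_totalDom : Measurable (totalDom s lam N) :=
  Continuous.measurable <| continuous_finsetSum _ fun i _ =>
    continuous_const.mul (continuous_stateDom (finWeight s lam N) i)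

lemma integral_totalDom_le {G : (Fin N → ℝ) → Fin N → ℝ} {V : (Fin N → ℝ) → ℝ} {B S : ℝ}
    (h : FinPotential (finWeight s lam N) V G B S) (hN : 0 < N) :
    Integrable (totalDom s lam N) (stdPi N) ∧
    ∫ X, totalDom s lam N X ∂(stdPi N) ≤ S * (1 + 2 * gaussM4 + gaussM4 * S ^ 2) := by
  have hi : ∀ i : Fin N, Integrable (fun X => finWeight s lam N i *
      stateDom (finWeight s lam N) i X) (stdPi N) := fun i =>
    (integral_stateDom_le h hN i).1.const_mul _
  refine ⟨integrable_finsetSum _ fun i _ => hi i, ?_⟩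
  unfold totalDom
  rw [integral_finsetSum _ fun i _ => hi i]
  simp only [integral_const_mul]
  have h0 := gaussM4_nonneg
  calc _ ≤ ∑ i, finWeight s lam N i * (1 + 2 * gaussM4 + gaussM4 * S ^ 2) :=
        Finset.sum_le_sum fun i _ => mul_le_mul_of_nonneg_left (integral_stateDom_le h hN i).2
          (finWeight_nonneg s lam N i)
    _ ≤ _ := by
      rw [← Finset.sum_mul]
      exact mul_le_mul_of_nonneg_right h.sum_le (by positivity)

namespace IsRWMChain

variable [BorelSpace H]

lemma lintegral_init_le (h : IsRWMChain P φ lam Ψ π₀ ℓ N x ξ γ) {K : ℝ} (hK : 0 ≤ K)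
    (hle : ∀ f : (Fin N → ℝ) → ENNReal, Measurable f →
      ∫⁻ x, f (ncoord φ lam N x) ∂(targetN φ Ψ π₀ N) ≤ ENNReal.ofReal K * ∫⁻ X, f X ∂(stdPi N))
    {g : (Fin N → ℝ) → ℝ} (hg : Measurable g) (hg0 : ∀ X, 0 ≤ g X)
    (hgi : Integrable g (stdPi N)) :
    ∫⁻ ω, ENNReal.ofReal (g (ncoord φ lam N (x 0 ω))) ∂P ≤
      ENNReal.ofReal (K * ∫ X, g X ∂(stdPi N)) := by
  have hm : Measurable fun y : H => ENNReal.ofReal (g (ncoord φ lam N y)) :=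
    (hg.comp (continuous_ncoord φ lam N).measurable).ennreal_ofReal
  rw [← lintegral_map hm (h.measurable_x 0), h.law_init, ENNReal.ofReal_mul hK,
    ofReal_integral_eq_lintegral_ofReal hgi (Eventually.of_forall hg0)]
  exact hle _ hg.ennreal_ofReal

variable [CompleteSpace H] [TopologicalSpace.SeparableSpace H] [IsProbabilityMeasure P]

/-- The error lies in `X^N` almost surely, so its norm is a finite sum; pulling `λ_i²` out of the
`i`-th squared coordinate turns the Sobolev weight into `finWeight`. -/
lemma sobNormSq_driftError_le (h : IsRWMChain P φ lam Ψ π₀ ℓ N x ξ γ) (hlam : ∀ j, 0 < lam j)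
    (hC : ∀ j, C (φ j) = (lam j) ^ 2 • φ j) (hd : Differentiable ℝ Ψ) {c : ℝ}
    (hc : ∀ X i, (N * √(2 * ℓ ^ 2 / N) * ∫ z, acc (finQ (fun X : Fin N → ℝ => Ψ (embed s lam X))
      √(2 * ℓ ^ 2 / N) X z) * z i ∂(stdPi N) + ℓ ^ 2 * beta ℓ * (X i + finGrad lam Ψ X i)) ^ 2 ≤
        c * stateDom (finWeight s lam N) i X) :
    ∀ᵐ ω ∂P, sobNormSq φ s (driftError P φ C Ψ ℓ N x ξ γ ω) ≤
      ENNReal.ofReal (c * totalDom s lam N (ncoord φ lam N (x 0 ω))) := by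
  have hV : Continuous fun X : Fin N → ℝ => Ψ (embed s lam X) :=
    hd.continuous.comp (continuous_embed s lam)
  have e1 := ae_all_iff.2 fun i : Fin N => h.inner_condExp_increment hlam hV i
  have e2 : ∀ᵐ ω ∂P, ∀ i : ℕ, ¬ i < N →
      inner ℝ (φ i) (condExp (history x ξ γ 0) P (fun ω' => x 1 ω' - x 0 ω') ω) = 0 := by
    refine ae_all_iff.2 fun i => ?_
    by_cases hi : i < N
    · exact Eventually.of_forall fun _ hi' => absurd hi hi'
    · filter_upwards [h.inner_condExp_increment_eq_zero hi] with ω h1 _ using h1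
  filter_upwards [e1, e2] with ω h1 h2
  rw [sobNormSq, tsum_eq_sum (s := Finset.range N), Finset.sum_range]
  · refine sum_ofReal_le_totalDom (fun i => mul_nonneg (weight_pos s i).le (sq_nonneg _))
      fun i => ?_
    refine le_trans (le_of_eq ?_)
      (mul_le_mul_of_nonneg_left (hc (ncoord φ lam N (x 0 ω)) i) (finWeight_nonneg s lam N i))
    rw [driftError, inner_sub_right, inner_smul_right, inner_smul_right, h1 i,
      inner_drift hlam φ hC hd, finWeight]
    ring
  · intro i hi
    have hi' : ¬ i < N := fun h => hi (Finset.mem_range.2 h)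
    rw [driftError, inner_sub_right, inner_smul_right, inner_smul_right, h2 i hi',
      inner_drift_eq_zero φ hC _ _ hi']
    simp

lemma sobInner_covError (h : IsRWMChain P φ lam Ψ π₀ ℓ N x ξ γ) (hN : 0 < N)
    (hlam : ∀ j, 0 < lam j)
    (hC : ∀ j, C (φ j) = (lam j) ^ 2 • φ j) (hd : Differentiable ℝ Ψ) (i j : Fin N) :
    ∀ᵐ ω ∂P, sobInner φ s (φ i) (covError P φ C ℓ N x ξ γ ω (φ j)) =
      2 * ℓ ^ 2 * (weight s i * lam i * lam j) * (∫ z, acc (finQ (fun X : Fin N → ℝ =>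
        Ψ (embed s lam X)) √(2 * ℓ ^ 2 / N) (ncoord φ lam N (x 0 ω)) z) * (z i * z j) ∂(stdPi N) -
          if i = j then beta ℓ else 0) := by
  have hV : Continuous fun X : Fin N → ℝ => Ψ (embed s lam X) :=
    hd.continuous.comp (continuous_embed s lam)
  have hN' : (N : ℝ) ≠ 0 := (Nat.cast_pos.2 hN).ne'
  filter_upwards [h.inner_condExp_rankOne hlam hV i j] with ω h1
  rw [sobInner_basis, covError, sub_apply, smul_apply,
    smul_apply, inner_sub_right, inner_smul_right, inner_smul_right, h1,
    CN_apply φ hC, inner_diagN, if_pos i.2, inner_basis]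
  simp only [Fin.val_inj]
  split_ifs with hij
  · subst hij
    field_simp
  · field_simp
    ring

lemma enorm_sobInner_covError_le (h : IsRWMChain P φ lam Ψ π₀ ℓ N x ξ γ) (hN : 0 < N)
    (hlam : ∀ j, 0 < lam j)
    (hC : ∀ j, C (φ j) = (lam j) ^ 2 • φ j) (hd : Differentiable ℝ Ψ) {c : ℝ}
    (hc : ∀ X i j, |∫ z, acc (finQ (fun X : Fin N → ℝ => Ψ (embed s lam X)) √(2 * ℓ ^ 2 / N) X z) *
      (z i * z j) ∂(stdPi N) - (if i = j then beta ℓ else 0)| ≤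
        c * stateDom (finWeight s lam N) i X) (i j : Fin N) :
    ∀ᵐ ω ∂P, ‖sobInner φ s (φ i) (covError P φ C ℓ N x ξ γ ω (φ j))‖ₑ ≤
      ENNReal.ofReal (2 * ℓ ^ 2 * (weight s i * lam i * lam j) *
        (c * stateDom (finWeight s lam N) i (ncoord φ lam N (x 0 ω)))) := by
  filter_upwards [h.sobInner_covError hN hlam hC hd i j] with ω h1
  have h2 : 0 ≤ 2 * ℓ ^ 2 * (weight s i * lam i * lam j) := by
    have := weight_pos s i
    have := hlam i
    have := hlam j
    positivity
  rw [h1, Real.enorm_eq_ofReal_abs, abs_mul, abs_of_nonneg h2]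
  exact ENNReal.ofReal_le_ofReal (mul_le_mul_of_nonneg_left (hc _ i j) h2)

lemma sum_enorm_sobInner_covError_le (h : IsRWMChain P φ lam Ψ π₀ ℓ N x ξ γ) (hN : 0 < N)
    (hlam : ∀ j, 0 < lam j)
    (hC : ∀ j, C (φ j) = (lam j) ^ 2 • φ j) (hd : Differentiable ℝ Ψ) {c : ℝ} (hc0 : 0 ≤ c)
    (hc : ∀ X i j, |∫ z, acc (finQ (fun X : Fin N → ℝ => Ψ (embed s lam X)) √(2 * ℓ ^ 2 / N) X z) *
      (z i * z j) ∂(stdPi N) - (if i = j then beta ℓ else 0)| ≤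
        c * stateDom (finWeight s lam N) i X) :
    ∀ᵐ ω ∂P, ∑ i ∈ Finset.range N, ‖sobInner φ s (φ i) (covError P φ C ℓ N x ξ γ ω (φ i))‖ₑ ≤
      ENNReal.ofReal (2 * ℓ ^ 2 * c * totalDom s lam N (ncoord φ lam N (x 0 ω))) := by
  filter_upwards [ae_all_iff.2 fun i => h.enorm_sobInner_covError_le hN hlam hC hd hc i i]
    with ω h1
  rw [Finset.sum_range]
  refine (Finset.sum_le_sum fun i _ => h1 i).trans (sum_ofReal_le_totalDom (fun i => ?_)
    fun i => le_of_eq ?_)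
  · have := weight_pos s i
    have := stateDom_nonneg (finWeight s lam N) i (ncoord φ lam N (x 0 ω))
    rw [mul_assoc (weight s i)]
    have := mul_self_nonneg (lam i)
    positivity
  · rw [finWeight]
    ring

end IsRWMChain

end

end RWM

/-! ### Assembly of the estimates. -/

theorem proposition2p1 {H : Type*} [NormedAddCommGroup H] [InnerProductSpace ℝ H]
    [CompleteSpace H] [TopologicalSpace.SeparableSpace H] [MeasurableSpace H] [BorelSpace H]
    (φ : HilbertBasis ℕ ℝ H) (lam : ℕ → ℝ) (C : H →L[ℝ] H)
    (hC : ∀ j, C (φ j) = (lam j) ^ 2 • φ j)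
    (κ s ℓ : ℝ) (hκ : 1 / 2 < κ) (hlam : RWM.EigenvalueDecay lam κ)
    (hs0 : 0 ≤ s) (hs : s < κ - 1 / 2)
    (Ψ : RWM.SobolevSpace s → ℝ) (hΨ : RWM.PotentialBounds Ψ)
    (hℓ : 0 < ℓ)
    (π₀ : Measure H) (hπ₀ : RWM.IsCenteredGaussian π₀ C)
    {Ω : ℕ → Type*} [∀ N, MeasurableSpace (Ω N)]
    (P : ∀ N, Measure (Ω N)) [∀ N, IsProbabilityMeasure (P N)]
    (x ξ : ∀ N, ℕ → Ω N → H) (γ : ∀ N, ℕ → Ω N → ℝ)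
    (hchain : ∀ N, RWM.IsRWMChain (P N) φ lam Ψ π₀ ℓ N (x N) (ξ N) (γ N)) :
    (∀ N, Integrable (fun ω => x N 1 ω - x N 0 ω) (P N)) ∧
    (∀ N, Integrable (fun ω => InnerProductSpace.rankOne ℝ (x N 1 ω - x N 0 ω)
      (x N 1 ω - x N 0 ω)) (P N)) ∧
    ∃ (r : ∀ N, Ω N → H) (E : ∀ N, Ω N → H →L[ℝ] H),
      (∀ N : ℕ, ∀ᵐ ω ∂(P N),
        (N : ℝ) • condExp (RWM.history (x N) (ξ N) (γ N) 0) (P N)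
            (fun ω' => x N 1 ω' - x N 0 ω') ω =
          -(ℓ ^ 2 * RWM.beta ℓ) •
            (RWM.PN φ N (x N 0 ω) + RWM.CN φ C N (RWM.gradPsiN φ Ψ N (x N 0 ω))) + r N ω) ∧
      (∀ N : ℕ, ∀ᵐ ω ∂(P N),
        (N : ℝ) • condExp (RWM.history (x N) (ξ N) (γ N) 0) (P N)
            (fun ω' => InnerProductSpace.rankOne ℝ (x N 1 ω' - x N 0 ω')
              (x N 1 ω' - x N 0 ω')) ω =
          (2 * ℓ ^ 2 * RWM.beta ℓ) • RWM.CN φ C N + E N ω) ∧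
      Tendsto (fun N => ∫⁻ ω, RWM.sobNormSq φ s (r N ω) ∂(P N)) atTop (𝓝 0) ∧
      Tendsto (fun N => ∫⁻ ω, ∑ i ∈ Finset.range N,
        ‖RWM.sobInner φ s (φ i) (E N ω (φ i))‖ₑ ∂(P N)) atTop (𝓝 0) ∧
      ∀ i j : ℕ, Tendsto (fun N => ∫⁻ ω,
        ‖RWM.sobInner φ s (φ i) (E N ω (φ j))‖ₑ ∂(P N)) atTop (𝓝 0) := by
  have hpos := hlam.pos
  have hsum := hlam.summable hs
  have hd := hΨ.differentiable
  obtain ⟨M₁, M₂, M₃, M₄, hM⟩ := hΨ.bounds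
  set S := ∑' j, RWM.weight s j * lam j ^ 2 with hSdef
  have hS : 0 ≤ S := tsum_nonneg fun j => mul_nonneg (RWM.weight_pos s j).le (sq_nonneg _)
  set B := max |M₃| |M₄| with hBdef
  have hB : 0 ≤ B := (abs_nonneg _).trans (le_max_left _ _)
  have hfin : ∀ N, RWM.FinPotential (RWM.finWeight s lam N)
      (fun X => Ψ (RWM.embed s lam X)) (RWM.finGrad lam Ψ) B S := fun N =>
    RWM.finPotential hpos hsum hd hΨ.differentiable_grad hB
      (fun x => (hM x).2.2.1.trans (mul_le_mul_of_nonneg_right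
        ((le_abs_self _).trans (le_max_left _ _)) (by positivity)))
      fun x => (hM x).2.2.2.trans ((le_abs_self _).trans (le_max_right _ _))
  obtain ⟨K₁, hK₁, hdrift⟩ := RWM.exists_drift_sq_le ℓ B S hℓ hB hS
  obtain ⟨K₂, hK₂, hcov⟩ := RWM.exists_covariance_le ℓ B S hℓ hB hS
  obtain ⟨K₀, hK₀, hden⟩ := RWM.exists_lintegral_targetN_le hpos hsum φ hC hπ₀ hd
    (fun x => (hM x).1) fun x => (hM x).2.1
  set D := 1 + 2 * RWM.gaussM4 + RWM.gaussM4 * S ^ 2 with hD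
  have hdom : ∀ N, 0 < N → ∀ {c}, 0 ≤ c → ∫⁻ ω, ENNReal.ofReal
      (c * RWM.totalDom s lam N (RWM.ncoord φ lam N (x N 0 ω))) ∂(P N) ≤
        ENNReal.ofReal (K₀ * (c * (S * D))) := fun N hN c hc => by
    obtain ⟨hi, hle⟩ := RWM.integral_totalDom_le (hfin N) hN
    refine ((hchain N).lintegral_init_le hK₀ (hden N) (RWM.measurable_totalDom.const_mul c)
      (fun X => mul_nonneg hc (RWM.totalDom_nonneg X)) (hi.const_mul c)).trans ?_
    rw [integral_const_mul]
    gcongr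
  have hdrift' := fun (N : ℕ) (hN : 0 < N) => (hchain N).sobNormSq_driftError_le
    (c := K₁ * RWM.rate N) hpos hC hd fun X i => (hdrift N _ _ _ _ (hfin N) (RWM.rate_pos hN) (RWM.rate_le_one hN)
      (RWM.rate_pow_four_mul hN) X i).trans_eq (by ring)
  have hcov' : ∀ N, 0 < N → ∀ X i j, |∫ z, RWM.acc (RWM.finQ (fun X : Fin N → ℝ =>
      Ψ (RWM.embed s lam X)) √(2 * ℓ ^ 2 / N) X z) * (z i * z j) ∂(RWM.stdPi N) -
        (if i = j then RWM.beta ℓ else 0)| ≤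
          K₂ * RWM.rate N * RWM.stateDom (RWM.finWeight s lam N) i X := fun N hN X i j =>
    (hcov N _ _ _ _ (hfin N) (RWM.rate_pos hN) (RWM.rate_le_one hN)
      (RWM.rate_pow_four_mul hN) X i j).trans_eq (by ring)
  refine ⟨fun N => (hchain N).integrable_increment,
    fun N => (hchain N).integrable_rankOne_increment,
    fun N => RWM.driftError (P N) φ C Ψ ℓ N (x N) (ξ N) (γ N),
    fun N => RWM.covError (P N) φ C ℓ N (x N) (ξ N) (γ N),
    -- The errors are defined as differences, so both identities hold at every `ω`; the content is
    -- in the three limits.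
    fun N => Eventually.of_forall fun ω => (add_sub_cancel _ _).symm,
    fun N => Eventually.of_forall fun ω => (add_sub_cancel _ _).symm, ?_, ?_, fun i j => ?_⟩
  · refine RWM.tendsto_zero_of_le_rate (K₀ * (K₁ * (S * D))) ?_
    filter_upwards [eventually_gt_atTop 0] with N hN
    have := (RWM.rate_pos hN).le
    refine ((lintegral_mono_ae (hdrift' N hN)).trans (hdom N hN (by positivity))).trans_eq ?_
    congr 1
    ring
  · refine RWM.tendsto_zero_of_le_rate (K₀ * (2 * ℓ ^ 2 * K₂ * (S * D))) ?_
    filter_upwards [eventually_gt_atTop 0] with N hN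
    have := (RWM.rate_pos hN).le
    refine ((lintegral_mono_ae ((hchain N).sum_enorm_sobInner_covError_le hN hpos hC hd
      (by positivity) (hcov' N hN))).trans (hdom N hN (by positivity))).trans_eq ?_
    congr 1
    ring
  · set w := 2 * ℓ ^ 2 * (RWM.weight s i * lam i * lam j) with hw
    have hw0 : 0 ≤ w := by
      have := RWM.weight_pos s i
      have := hpos i
      have := hpos j
      positivity
    refine RWM.tendsto_zero_of_le_rate (K₀ * (w * K₂ * D)) ?_
    -- For such `N` both `φ i` and `φ j` lie in `X^N`, where the coordinate bounds apply.
    filter_upwards [eventually_gt_atTop (max i j)] with N hN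
    have hi : i < N := (le_max_left _ _).trans_lt hN
    have hj : j < N := (le_max_right _ _).trans_lt hN
    have hN0 : 0 < N := (Nat.zero_le _).trans_lt hi
    have := (RWM.rate_pos hN0).le
    obtain ⟨hint, hle⟩ := RWM.integral_stateDom_le (hfin N) hN0 ⟨i, hi⟩
    refine (lintegral_mono_ae ((hchain N).enorm_sobInner_covError_le hN0 hpos hC hd
      (hcov' N hN0) ⟨i, hi⟩ ⟨j, hj⟩)).trans ?_
    have hc : 0 ≤ w * K₂ * RWM.rate N := by positivity
    simp only [← hw, ← mul_assoc w]
    refine ((hchain N).lintegral_init_le hK₀ (hden N)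
      ((RWM.continuous_stateDom _ _).measurable.const_mul (w * K₂ * RWM.rate N))
      (fun X => mul_nonneg hc (RWM.stateDom_nonneg _ _ X)) (hint.const_mul _)).trans ?_
    rw [integral_const_mul]
    refine ENNReal.ofReal_le_ofReal ?_
    calc _ ≤ K₀ * (w * K₂ * RWM.rate N * D) := by gcongr
      _ = _ := by ring
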